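/- Let $n\ge 2$ and work over $\mathbb{C}(q)$, $q$ an indeterminate. Let $(A_{ij})_{1\le i,j\le n}$ be the Cartan matrix of type $C_n$ with simple roots $\alpha_i=\epsilon_i-\epsilon_{i+1}$ ($i<n$), $\alpha_n=2\epsilon_n$, where $(\epsilon_i,\epsilon_j)=\delta_{ij}$; put $d_i=\tfrac12(\alpha_i,\alpha_i)$ (so $d_i=1$ for $i<n$, $d_n=2$), $A_{ij}=(\alpha_i,\alpha_j)/d_i$, $d_{ij}=\max\{d_i,d_j\}$, $q_i=q^{d_i}$, $[k]_t=\frac{t^k-t^{-k}}{t-t^{-1}}$. All relations below are between formal series, coefficient by coefficient; $u_\pm=uq^{\pm c/2}$, $\delta(u)=\sum_{r\in\mathbb Z}u^r$. **The algebra $U_q(A^{(2)}_{2n-1})$** (Drinfeld realization) is the unital associative algebra generated by $x^\pm_{i,m}$ ($m\in\mathbb Z$), $a_{i,l}$ ($l\in\mathbb Z\setminus\{0\}$), $k_i^{\pm1}$ ($1\le i\le n$) and $q^{\pm c/2}$, subject to: $q^{\pm c/2}$ are central and mutually inverse; $k_ik_i^{-1}=k_i^{-1}k_i=1$; $x^\pm_{n,2m+1}=a_{n,2m+1}=0$;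 $k_ik_j=k_jk_i$; $k_ia_{j,l}=a_{j,l}k_i$; $k_ix^\pm_{j,m}k_i^{-1}=q_i^{\pm A_{ij}}x^\pm_{j,m}$; with $b_{ij}(m)=\frac{d_{ij}[mA_{ij}/d_{ij}]_{q_i}}{m}$ if $d_{ij}\mid m$ and $b_{ij}(m)=0$ otherwise, $$[a_{i,m},a_{j,l}]=\delta_{m,-l}\,b_{ij}(m)\frac{q^{mc}-q^{-mc}}{q_j-q_j^{-1}},\qquad [a_{i,m},x^\pm_{j,l}]=\pm b_{ij}(m)\,q^{\mp|m|c/2}x^\pm_{j,m+l};$$ $$[x^+_{i,m},x^-_{j,l}]=\delta_{ij}\,\frac{q^{(m-l)c/2}\varphi^+_{i,m+l}-q^{-(m-l)c/2}\varphi^-_{i,m+l}}{q_i-q_i^{-1}}\ \text{ if } d_j\mid l,\ \text{ and } 0 \text{ otherwise};$$ $$x^\pm_{i,m+d_{ij}}x^\pm_{j,l}-q_i^{\pm A_{ij}}x^\pm_{j,l}x^\pm_{i,m+d_{ij}}=q_i^{\pm A_{ij}}x^\pm_{i,m}x^\pm_{j,l+d_{ij}}-x^\pm_{j,l+d_{ij}}x^\pm_{i,m};$$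 for $i\ne j$ with $A_{ij}\in\{0,-1\}$ and $r=1-A_{ij}$, $$\sum_{\pi\in\mathfrak S_r}\sum_{l=0}^r(-1)^l{r\brack l}_{q_i}x^\pm_{i,s_{\pi(1)}}\cdots x^\pm_{i,s_{\pi(l)}}x^\pm_{j,m}x^\pm_{i,s_{\pi(l+1)}}\cdots x^\pm_{i,s_{\pi(r)}}=0;$$ and for $A_{ij}=-2$, with $T^\pm_{ij}(a,b;s)=x^\pm_{j,s}x^\pm_{i,a}x^\pm_{i,b}-[2]_{q^2}x^\pm_{i,a}x^\pm_{j,s}x^\pm_{i,b}+x^\pm_{i,a}x^\pm_{i,b}x^\pm_{j,s}$, $$\sum_{\pi\in\mathfrak S_2}\big(q\,T^\pm_{ij}(r_{\pi(1)}\pm1,r_{\pi(2)};s)+q^{-1}T^\pm_{ij}(r_{\pi(1)},r_{\pi(2)}\pm1;s)\big)=0.$$ Here $\varphi^\pm_i(u)=\sum_{m\ge0}\varphi^\pm_{i,\pm m}u^{\mp m}=k_i^{\pm1}\exp\big(\pm(q_i-q_i^{-1})\sum_{s\ge1}a_{i,\pm s}u^{\mp s}\big)$ and $\varphi^+_{i,-m}=\varphi^-_{i,m}=0$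 for $m>0$. Put $x^\pm_i(u)=\sum_{m\in\mathbb Z}x^\pm_{i,m}u^{-m}$. **The extended algebra $U^{\rm ext}_q(A^{(2)}_{2n-1})$** is the unital associative algebra generated by $X^\pm_{i,k}$ ($1\le i\le n$, $k\in\mathbb Z$), $h^\pm_{j,\pm m}$ ($1\le j\le n+1$, $m\ge0$) and an invertible central element $q^{c/2}$. Put $X^\pm_i(u)=\sum_kX^\pm_{i,k}u^{-k}$, $h^\pm_j(u)=\sum_{m\ge0}h^\pm_{j,\pm m}u^{\pm m}$, $\xi=-q^{-2n}$ and let $$f(u)=\xi q^{-2}\prod_{r\ge0}\frac{(1-u\xi^{2r})(1-uq^{-2}\xi^{2r+1})(1-uq^2\xi^{2r+1})(1-u\xi^{2r+2})}{(1-u\xi^{2r+1})^2(1-uq^2\xi^{2r+2})(1-uq^{-2}\xi^{2r})},$$ a power series in $u$ over $\mathbb C(q)$. The relations are: $h^+_{j,0}h^-_{j,0}=h^-_{j,0}h^+_{j,0}=1$; $h^+_{n,0}h^+_{n+1,0}=1$; $X^\pm_{n,2k+1}=0$; $h^\pm_n(u)^{-1}h^\pm_{n+1}(u)$ contains only even powers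 of $u$; $h^\pm_i(u)h^\pm_j(v)=h^\pm_j(v)h^\pm_i(u)$; $$f\big((u_+/v_-)^{\pm1}\big)\rho_{ij}(u_\pm/v_\mp)\,h^\pm_i(u)h^\mp_j(v)=f\big((u_- /v_+)^{\pm1}\big)\rho_{ij}(u_\mp/v_\pm)\,h^\mp_j(v)h^\pm_i(u)\qquad(i\le j),$$ where $\rho_{ii}=1$, $\rho_{ij}(x)=\frac{x-1}{qx-q^{-1}}$ for $i<j$, $i\ne n$, and $\rho_{n,n+1}(x)=\frac{x^2-1}{q^2x^2-q^{-2}}$ (expanded in powers of $(u/v)^{\pm1}$); $$h^\pm_i(u)X^+_j(v)h^\pm_i(u)^{-1}=g_{ij}(u/v_\pm)X^+_j(v),\qquad h^\pm_i(u)^{-1}X^-_j(v)h^\pm_i(u)=g_{ij}(u/v_\mp)X^-_j(v),$$ where, with $e=(\epsilon_i,\alpha_j)$, $g_{ij}(x)=\frac{x-1}{q^{e}x-q^{-e}}$ for $i\le n$, $j<n$; $g_{in}(x)=\frac{x^2-1}{q^{e}x^2-q^{-e}}$ for $i\le n$; $g_{n+1,n}(x)=\frac{x^2-1}{q^{-2}x^2-q^2}$;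 $g_{n+1,n-1}(x)=\frac{q^{-1}x+q}{x+1}$; $g_{n+1,j}=1$ for $j\le n-2$ (expanded in powers of $(u/v)^{\pm1}$); $$(u^D-q^{\pm(\alpha_i,\alpha_j)}v^D)X^\pm_i(uq^i)X^\pm_j(vq^j)=(q^{\pm(\alpha_i,\alpha_j)}u^D-v^D)X^\pm_j(vq^j)X^\pm_i(uq^i),$$ with $D=1$ for $i,j<n$ and $D=2$ for $j=n$, $1\le i\le n$; $$[X^+_i(u),X^-_j(v)]=\delta_{ij}(q_i-q_i^{-1})\Big(\delta\big(\tfrac{uq^{-c}}v\big)h^-_i(v_+)^{-1}h^-_{i+1}(v_+)-\delta\big(\tfrac{uq^{c}}v\big)h^+_i(u_+)^{-1}h^+_{i+1}(u_+)\Big)\quad(j\ne n),$$ $$[X^+_i(u),X^-_n(v)]=\delta_{in}(q_n-q_n^{-1})\Big(\delta\big((\tfrac{uq^{-c}}v)^2\big)q^{c}h^-_n(v_+)^{-1}h^-_{n+1}(v_+)-\delta\big((\tfrac{uq^{c}}v)^2\big)q^{-c}h^+_n(u_+)^{-1}h^+_{n+1}(u_+)\Big);$$ for $i\ne j$ with $A_{ij}\in\{0,-1\}$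 and $r=1-A_{ij}$, the Serre relation $\sum_{\pi\in\mathfrak S_r}\sum_{l=0}^r(-1)^l{r\brack l}_{q_i}X^\pm_i(u_{\pi(1)})\cdots X^\pm_i(u_{\pi(l)})X^\pm_j(v)X^\pm_i(u_{\pi(l+1)})\cdots X^\pm_i(u_{\pi(r)})=0$; and for $(i,j)=(n-1,n)$ (where $A_{ij}=-2$) $$\sum_{\pi\in\mathfrak S_2}\pi\Big((q^{\pm2}u_1+u_2)\big(X^\pm_n(v)X^\pm_{n-1}(u_1)X^\pm_{n-1}(u_2)-[2]_{q^2}X^\pm_{n-1}(u_1)X^\pm_n(v)X^\pm_{n-1}(u_2)+X^\pm_{n-1}(u_1)X^\pm_{n-1}(u_2)X^\pm_n(v)\big)\Big)=0.$$ **Proposition.** The assignments $q^{c/2}\mapsto q^{c/2}$, $k_i\mapsto h^+_{i,0}(h^+_{i+1,0})^{-1}$ $(1\le i\le n-1)$, $k_n\mapsto q^c(h^+_{n,0})^2$, $$x^\pm_i(u)\mapsto(q_i-q_i^{-1})^{-1}X^\pm_i(uq^i)\quad(1\le i\le n),\qquad \varphi^\pm_i(u)\mapsto\begin{cases}h^\mp_{i+1}(uq^i)\,h^\mp_i(uq^i)^{-1},&1\le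 i\le n-1,\\ q^{\pm c}\,h^\mp_{n+1}(uq^n)\,h^\mp_n(uq^n)^{-1},&i=n,\end{cases}$$ define a (unique) homomorphism of $\mathbb C(q)$-algebras $\varsigma:U_q(A^{(2)}_{2n-1})\to U^{\rm ext}_q(A^{(2)}_{2n-1})$, and $\varsigma$ is injective. -/

import Mathlib

open scoped PowerSeries

namespace TwistedAffine

noncomputable section

/-! ### Ground field and `q`-numbers -/

/-- The ground field `ℂ(q)`. -/
abbrev Kq : Type := RatFunc ℂ

/-- The indeterminate `q`. -/
def q : Kq := RatFunc.X

/-- `[k]_t = (t^k - t^{-k}) / (t - t^{-1})`. -/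
def qnum (t : Kq) (k : ℤ) : Kq := (t ^ k - t ^ (-k)) / (t - t⁻¹)

/-- `[r]_t!`. -/
def qfact (t : Kq) (r : ℕ) : Kq := ∏ s ∈ Finset.Icc 1 r, qnum t s

/-- The Gaussian binomial coefficient `[r choose l]_t` (for `l ≤ r`). -/
def qbinom (t : Kq) (r l : ℕ) : Kq := qfact t r / (qfact t l * qfact t (r - l))

/-! ### Root data

The nodes `1, …, n` are the elements of `Fin n`; the element `i` has label `i.val + 1`.
In an orthonormal basis `ε_1, …, ε_n` the simple roots are
  `α_i = ε_i - ε_{i+1}` for `i < n` and `α_n = 2 ε_n`. -/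

/-- The node with label `n`. -/
abbrev IsLast {n : ℕ} (i : Fin n) : Prop := i.val + 1 = n

/-- `d_i = (α_i|α_i) / 2`, that is `1, …, 1, 2`. -/
def d {n : ℕ} (i : Fin n) : ℕ := if IsLast i then 2 else 1

/-- `d_{ij} = max (d_i, d_j)`. -/
def dd {n : ℕ} (i j : Fin n) : ℕ := max (d i) (d j)

/-- The Cartan matrix of type `C_n`: `A_{ij} = 2 (α_i|α_j) / (α_i|α_i)`. -/
def cartan {n : ℕ} (i j : Fin n) : ℤ :=
  if i = j then 2
  else if i.val + 1 = j.val ∨ j.val + 1 = i.val then (if IsLast j then -2 else -1)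
  else 0

/-- The form `(α_i|α_j) = d_i A_{ij}`. -/
def form {n : ℕ} (i j : Fin n) : ℤ := (d i : ℤ) * cartan i j

/-- `(ε_i, α_j)`, the coordinates of the simple roots. -/
def epsRoot {n : ℕ} (i j : Fin n) : ℤ :=
  if i = j then (d j : ℤ) else if i.val = j.val + 1 then -1 else 0

/-- `q_i = q^{d_i}`. -/
def qi {n : ℕ} (i : Fin n) : Kq := q ^ d i

/-! ### Formal series -/

section Series

variable {A : Type*} [Ring A]

/-- `g^z` for an element `g` with (formal) inverse `g'`. -/
def zpw (g g' : A) (z : ℤ) : A := if 0 ≤ z then g ^ z.toNat else g' ^ (-z).toNat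

/-- The series `T(c t)` in the variable `t`, for a scalar series `T` and an element `c`. -/
def scaled [Algebra Kq A] (T : Kq⟦X⟧) (c : A) : A⟦X⟧ :=
  PowerSeries.mk fun k => PowerSeries.coeff k T • c ^ k

/-- The exponential `∑_N S^N / N!` of a series `S` without constant term. -/
def expSeries [Algebra Kq A] (S : A⟦X⟧) : A⟦X⟧ :=
  PowerSeries.mk fun m =>
    ∑ N ∈ Finset.range (m + 1), ((N.factorial : Kq)⁻¹) • PowerSeries.coeff m (S ^ N)

/-- Coefficients of the inverse of a series with coefficients `f`, where `c` is the inverse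
of `f 0`. -/
def invCoeff (c : A) (f : ℕ → A) : ℕ → A
  | 0 => c
  | m + 1 => -(c * ∑ k : Fin (m + 1), f (k.val + 1) * invCoeff c f (m - k.val))
  decreasing_by omega

/-- The inverse of the series `F`, where `c` is the inverse of its constant term. -/
def invSeries (c : A) (F : A⟦X⟧) : A⟦X⟧ :=
  PowerSeries.mk (invCoeff c fun m => PowerSeries.coeff m F)

/-- The coefficient of `t^a t'^b` in `S(t t') F(t) G(t')`. -/
def crossCoeff (S F G : A⟦X⟧) (a b : ℕ) : A :=
  ∑ k ∈ Finset.range (min a b + 1),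
    PowerSeries.coeff k S * (PowerSeries.coeff (a - k) F * PowerSeries.coeff (b - k) G)

/-- The coefficient of `t^a t'^b` in `S(t t') G(t') F(t)`. -/
def crossCoeff' (S F G : A⟦X⟧) (a b : ℕ) : A :=
  ∑ k ∈ Finset.range (min a b + 1),
    PowerSeries.coeff k S * (PowerSeries.coeff (b - k) G * PowerSeries.coeff (a - k) F)

theorem mul_invSeries (c : A) (F : A⟦X⟧) (hc : PowerSeries.coeff 0 F * c = 1) :
    F * invSeries c F = 1 := by
  ext m
  rw [PowerSeries.coeff_mul, PowerSeries.coeff_one]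
  cases m with
  | zero => simp [invSeries, invCoeff, ← hc]
  | succ m =>
    rw [Finset.Nat.sum_antidiagonal_succ, if_neg (Nat.succ_ne_zero m)]
    have h1 : PowerSeries.coeff (m + 1) (invSeries c F) =
        -(c * ∑ k : Fin (m + 1), PowerSeries.coeff (k.val + 1) F *
          PowerSeries.coeff (m - k.val) (invSeries c F)) := by
      simp only [invSeries, PowerSeries.coeff_mk]
      rw [invCoeff]
    rw [h1, mul_neg, ← mul_assoc, hc, one_mul, Finset.Nat.sum_antidiagonal_eq_sum_range_succ_mk,
      Finset.sum_range]
    exact neg_add_cancel _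

end Series

/-- The expansion of the rational function `(α x^m + β) / (γ x^m + δ)` as a power series:
in `x` for `s = 1`, in `x⁻¹` for `s = -1`. -/
def ratExp (s : ℤˣ) (m : ℕ) (α β γ δ : Kq) : Kq⟦X⟧ :=
  if s = 1 then
    (PowerSeries.C α * PowerSeries.X ^ m + PowerSeries.C β) *
      (PowerSeries.C γ * PowerSeries.X ^ m + PowerSeries.C δ)⁻¹
  else
    (PowerSeries.C α + PowerSeries.C β * PowerSeries.X ^ m) *
      (PowerSeries.C γ + PowerSeries.C δ * PowerSeries.X ^ m)⁻¹

/-- The formal infinite product `∏_{r ≥ 0} (1 - a p^r u)` as a power series in `u`, for `p` not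
a root of unity: the power series `F` with `F(0) = 1` and `F(u) = (1 - a u) F(p u)`. -/
def infProd (p a : Kq) : Kq⟦X⟧ :=
  PowerSeries.mk fun k => ∏ j ∈ Finset.range k, (-(a * p ^ j) / (1 - p ^ (j + 1)))

theorem infProd_zero (p a : Kq) : PowerSeries.constantCoeff (infProd p a) = 1 := by
  simp [infProd, ← PowerSeries.coeff_zero_eq_constantCoeff_apply]

theorem infProd_spec (p a : Kq) (hp : ∀ j : ℕ, p ^ (j + 1) ≠ 1) :
    infProd p a =
      (1 - PowerSeries.C a * PowerSeries.X) * PowerSeries.rescale p (infProd p a) := by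
  ext k
  rw [sub_mul, one_mul, map_sub, mul_assoc, PowerSeries.coeff_C_mul]
  cases k with
  | zero => simp [infProd]
  | succ k =>
    rw [PowerSeries.coeff_succ_X_mul, PowerSeries.coeff_rescale, PowerSeries.coeff_rescale]
    simp only [infProd, PowerSeries.coeff_mk, Finset.prod_range_succ]
    have h : (1 - p ^ (k + 1)) ≠ 0 := sub_ne_zero.mpr (hp k).symm
    field_simp
    ring

/-- `ξ = -q^{-2n}`. -/
def xi (n : ℕ) : Kq := -q ^ (-(2 * n : ℤ))

/-- The series
  `f(u) = ξ q^{-2} ∏_{r ≥ 0} (1 - u ξ^{2r}) (1 - u q^{-2} ξ^{2r+1}) (1 - u q^2 ξ^{2r+1})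
  (1 - u ξ^{2r+2}) / ((1 - u ξ^{2r+1})^2 (1 - u q^2 ξ^{2r+2}) (1 - u q^{-2} ξ^{2r}))`. -/
def fSer (n : ℕ) : Kq⟦X⟧ :=
  let ξ := xi n
  let P : Kq → Kq⟦X⟧ := infProd (ξ ^ 2)
  PowerSeries.C (ξ * q ^ (-2 : ℤ)) *
    (P 1 * P (q ^ (-2 : ℤ) * ξ) * P (q ^ 2 * ξ) * P (ξ ^ 2)) *
    (P ξ ^ 2 * P (q ^ 2 * ξ ^ 2) * P (q ^ (-2 : ℤ)))⁻¹

/-- The quantum Serre expression for currents with coefficients `y` (the current `i`) and an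
element `z` (a coefficient of the current `j`):
  `∑_π ∑_l (-1)^l [r choose l]_t y_{m_{π(1)}} ⋯ y_{m_{π(l)}} z y_{m_{π(l+1)}} ⋯ y_{m_{π(r)}}`. -/
def serre {A : Type*} [Ring A] [Algebra Kq A] (t : Kq) (y : ℤ → A) (z : A) {r : ℕ}
    (m : Fin r → ℤ) : A :=
  ∑ π : Equiv.Perm (Fin r), ∑ l ∈ Finset.range (r + 1),
    ((-1 : Kq) ^ l * qbinom t r l) •
      (((List.ofFn fun e => y (m (π e))).take l).prod * z *
        ((List.ofFn fun e => y (m (π e))).drop l).prod)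

/-- `z y_a y_b - [2]_{q^2} y_a z y_b + y_a y_b z`. -/
def serreTwo {A : Type*} [Ring A] [Algebra Kq A] (y : ℤ → A) (z : A) (a b : ℤ) : A :=
  z * y a * y b - qnum (q ^ 2) 2 • (y a * z * y b) + y a * y b * z

/-! ### The quantum affine algebra `U_q(A^{(2)}_{2n-1})` in the Drinfeld realization

A sign `±` is an element of `ℤˣ`. -/

/-- Generators `x^±_{i,m}`, `a_{i,l}` (`l ≠ 0`), `k_i^{±1}`, `q^{±c/2}`. -/
inductive DrGen (n : ℕ) : Type
  | x (s : ℤˣ) (i : Fin n) (m : ℤ)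
  | a (i : Fin n) (l : {l : ℤ // l ≠ 0})
  | k (i : Fin n)
  | kInv (i : Fin n)
  | qc
  | qcInv

namespace Dr

/-- The free algebra on the generators. -/
abbrev Free (n : ℕ) : Type := FreeAlgebra Kq (DrGen n)

variable {n : ℕ}

def x (s : ℤˣ) (i : Fin n) (m : ℤ) : Free n := FreeAlgebra.ι Kq (DrGen.x s i m)

def a (i : Fin n) (l : {l : ℤ // l ≠ 0}) : Free n := FreeAlgebra.ι Kq (DrGen.a i l)

def k (i : Fin n) : Free n := FreeAlgebra.ι Kq (DrGen.k i)

def kInv (i : Fin n) : Free n := FreeAlgebra.ι Kq (DrGen.kInv i)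

/-- `q^{zc/2}`. -/
def qcPow (z : ℤ) : Free n :=
  zpw (FreeAlgebra.ι Kq DrGen.qc) (FreeAlgebra.ι Kq DrGen.qcInv) z

/-- The element `a_{i, s r}` for `r ≥ 1` (and `0` for `r = 0`). -/
def aPart (s : ℤˣ) (i : Fin n) (r : ℕ) : Free n :=
  if h : r = 0 then 0
  else a i ⟨(s : ℤ) * r, mul_ne_zero s.ne_zero (Int.natCast_ne_zero.mpr h)⟩

/-- The coefficient of `u^{-s m}` (`m ≥ 0`) of
  `φ^s_i(u) = k_i^{s} exp (s (q_i - q_i^{-1}) ∑_{r ≥ 1} a_{i, s r} u^{-s r})`. -/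
def phi (s : ℤˣ) (i : Fin n) (m : ℕ) : Free n :=
  zpw (k i) (kInv i) s *
    PowerSeries.coeff m (expSeries (PowerSeries.mk fun r =>
      (((s : ℤ) : Kq) * (qi i - (qi i)⁻¹)) • aPart s i r))

/-- The element `φ^s_{i,m}` for all `m ∈ ℤ`: it vanishes unless `s m ≥ 0`. -/
def phiZ (s : ℤˣ) (i : Fin n) (m : ℤ) : Free n :=
  if 0 ≤ (s : ℤ) * m then phi s i ((s : ℤ) * m).toNat else 0

/-- The scalar `d_{ij} [m A_{ij} / d_{ij}]_{q_i} / m` if `d_{ij}` divides `m`, and `0`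
otherwise. -/
def heis (i j : Fin n) (m : ℤ) : Kq :=
  if (dd i j : ℤ) ∣ m then (dd i j : Kq) * qnum (qi i) (m * cartan i j / dd i j) / (m : Kq)
  else 0

/-- The defining relations. -/
inductive Rel (n : ℕ) : Free n → Free n → Prop
  | qc_mul : Rel n (FreeAlgebra.ι Kq DrGen.qc * FreeAlgebra.ι Kq DrGen.qcInv) 1
  | qcInv_mul : Rel n (FreeAlgebra.ι Kq DrGen.qcInv * FreeAlgebra.ι Kq DrGen.qc) 1
  | qc_central (g : DrGen n) :
      Rel n (FreeAlgebra.ι Kq DrGen.qc * FreeAlgebra.ι Kq g)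
        (FreeAlgebra.ι Kq g * FreeAlgebra.ι Kq DrGen.qc)
  | x_odd (s : ℤˣ) (i : Fin n) (hi : IsLast i) (m : ℤ) : Rel n (x s i (2 * m + 1)) 0
  | a_odd (i : Fin n) (hi : IsLast i) (l : {l : ℤ // l ≠ 0}) (hl : Odd l.val) : Rel n (a i l) 0
  | k_mul (i : Fin n) : Rel n (k i * kInv i) 1
  | kInv_mul (i : Fin n) : Rel n (kInv i * k i) 1
  | k_k (i j : Fin n) : Rel n (k i * k j) (k j * k i)
  | k_a (i j : Fin n) (l : {l : ℤ // l ≠ 0}) : Rel n (k i * a j l) (a j l * k i)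
  | k_x (s : ℤˣ) (i j : Fin n) (m : ℤ) :
      Rel n (k i * x s j m * kInv i) (qi i ^ ((s : ℤ) * cartan i j) • x s j m)
  | a_a (i j : Fin n) (m l : {l : ℤ // l ≠ 0}) :
      Rel n (a i m * a j l - a j l * a i m)
        (if m.val = -l.val then
          (heis i j m / (qi j - (qi j)⁻¹)) • (qcPow (2 * m.val) - qcPow (-(2 * m.val)))
        else 0)
  | a_x (s : ℤˣ) (i j : Fin n) (m : {l : ℤ // l ≠ 0}) (l : ℤ) :
      Rel n (a i m * x s j l - x s j l * a i m)
        ((((s : ℤ) : Kq) * heis i j m) • (qcPow (-(s : ℤ) * |m.val|) * x s j (m.val + l)))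
  | x_x (i j : Fin n) (m l : ℤ) :
      Rel n (x 1 i m * x (-1) j l - x (-1) j l * x 1 i m)
        (if i = j ∧ (d j : ℤ) ∣ l then
          (qi i - (qi i)⁻¹)⁻¹ •
            (qcPow (m - l) * phiZ 1 i (m + l) - qcPow (-(m - l)) * phiZ (-1) i (m + l))
        else 0)
  | quad (s : ℤˣ) (i j : Fin n) (m l : ℤ) :
      Rel n
        (x s i (m + dd i j) * x s j l -
          qi i ^ ((s : ℤ) * cartan i j) • (x s j l * x s i (m + dd i j)))
        (qi i ^ ((s : ℤ) * cartan i j) • (x s i m * x s j (l + dd i j)) -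
          x s j (l + dd i j) * x s i m)
  | serre (s : ℤˣ) (i j : Fin n) (hij : i ≠ j) (hA : cartan i j = 0 ∨ cartan i j = -1)
      (m : Fin (1 - cartan i j).toNat → ℤ) (l : ℤ) :
      Rel n (TwistedAffine.serre (qi i) (x s i) (x s j l) m) 0
  | serre_two (s : ℤˣ) (i j : Fin n) (hA : cartan i j = -2) (m : Fin 2 → ℤ) (l : ℤ) :
      Rel n
        (∑ π : Equiv.Perm (Fin 2),
          (q • serreTwo (x s i) (x s j l) (m (π 0) + s) (m (π 1)) +
            q⁻¹ • serreTwo (x s i) (x s j l) (m (π 0)) (m (π 1) + s))) 0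

end Dr

/-- The quantum affine algebra `U_q(A^{(2)}_{2n-1})`. -/
abbrev UqA (n : ℕ) : Type := RingQuot (Dr.Rel n)

/-- The quotient map from the free algebra. -/
def UqA.mk (n : ℕ) : Dr.Free n →ₐ[Kq] UqA n := RingQuot.mkAlgHom Kq (Dr.Rel n)

/-! ### The extended quantum affine algebra -/

/-- Generators `X^±_{i,k}`, `h^±_{j,±m}` (`m ≥ 0`), `q^{±c/2}`. The index `j ∈ {1, …, n+1}` is
an element of `Fin (n + 1)`, with label `j.val + 1`. -/
inductive ExtGen (n : ℕ) : Type
  | X (s : ℤˣ) (i : Fin n) (k : ℤ)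
  | h (s : ℤˣ) (j : Fin (n + 1)) (m : ℕ)
  | qc
  | qcInv

namespace Ext

/-- The free algebra on the generators. -/
abbrev Free (n : ℕ) : Type := FreeAlgebra Kq (ExtGen n)

variable {n : ℕ}

/-- `X^s_{i,k}`, the coefficient of `u^{-k}` in `X^s_i(u)`. -/
def X (s : ℤˣ) (i : Fin n) (k : ℤ) : Free n := FreeAlgebra.ι Kq (ExtGen.X s i k)

/-- `h^s_{j, s m}`, the coefficient of `u^{s m}` in `h^s_j(u)`. -/
def h (s : ℤˣ) (j : Fin (n + 1)) (m : ℕ) : Free n := FreeAlgebra.ι Kq (ExtGen.h s j m)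

/-- `q^{zc/2}`. -/
def qcPow (z : ℤ) : Free n :=
  zpw (FreeAlgebra.ι Kq ExtGen.qc) (FreeAlgebra.ι Kq ExtGen.qcInv) z

/-- `h^s_j(u)` as a power series in `u^{s}`. -/
def hSer (s : ℤˣ) (j : Fin (n + 1)) : (Free n)⟦X⟧ := PowerSeries.mk fun m => h s j m

/-- The series `h^s_i(u)^{-1} h^s_{i+1}(u)` in `u^{s}`. The inverse of `h^s_{i,0}` is
  `h^{-s}_{i,0}`. -/
def psiSer (s : ℤˣ) (i : Fin n) : (Free n)⟦X⟧ :=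
  invSeries (h (-s) i.castSucc 0) (hSer s i.castSucc) * hSer s i.succ

/-- The coefficient of `u^m` in `h^s_i(u)^{-1} h^s_{i+1}(u)`, for `m ∈ ℤ`. -/
def psiZ (s : ℤˣ) (i : Fin n) (m : ℤ) : Free n :=
  if 0 ≤ (s : ℤ) * m then PowerSeries.coeff ((s : ℤ) * m).toNat (psiSer s i) else 0

/-- The coefficient of `u^{-m}` in `X^s_i(u q^i)`. -/
def Xq (s : ℤˣ) (i : Fin n) (m : ℤ) : Free n := q ^ (-((i.val + 1 : ℤ) * m)) • X s i m

/-- The rational function of `x` in the relation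
  `h^±_i(u) X^+_j(v) h^±_i(u)^{-1} = g_{ij}(u / v_±) X^+_j(v)`, expanded in `x^{s}`. Here `j` is a
node and `i ∈ {1, …, n+1}`:
  `g_{ij}(x) = (x - 1) / (q^{(ε_i,α_j)} x - q^{-(ε_i,α_j)})` for `i ≤ n`, `j < n`;
  `g_{in}(x) = (x^2 - 1) / (q^{(ε_i,α_n)} x^2 - q^{-(ε_i,α_n)})` for `i ≤ n`;
  `g_{n+1,n}(x) = (x^2 - 1) / (q^{-2} x^2 - q^2)`;
  `g_{n+1,n-1}(x) = (q^{-1} x + q) / (x + 1)`; and `g_{n+1,j} = 1` for `j ≤ n - 2`. -/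
def gSer (s : ℤˣ) (i : Fin (n + 1)) (j : Fin n) : Kq⟦X⟧ :=
  if hi : i.val < n then
    ratExp s (d j) 1 (-1) (q ^ epsRoot ⟨i.val, hi⟩ j) (-q ^ (-epsRoot ⟨i.val, hi⟩ j))
  else if j.val + 1 = n then ratExp s 2 1 (-1) (q ^ (-2 : ℤ)) (-q ^ 2)
  else if j.val + 2 = n then ratExp s 1 q⁻¹ q 1 1
  else 1

/-- The relation
  `f((u_+ / v_-)^{±1}) ρ(u_± / v_∓) h^±_i(u) h^∓_j(v) =
    f((u_- / v_+)^{±1}) ρ(u_∓ / v_±) h^∓_j(v) h^±_i(u)`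
with `u_± = u q^{±c/2}`, in terms of coefficients of `u^{s a} v^{-s b}` (`s` is the upper sign).
  `ρ s` is the expansion of the rational function `ρ(x)` in `x^{s}`. -/
def hhLeft (ρ : ℤˣ → Kq⟦X⟧) (s : ℤˣ) (i j : Fin (n + 1)) (a b : ℕ) : Free n :=
  crossCoeff (scaled (fSer n) (qcPow (2 * (s : ℤ))) * scaled (ρ s) (qcPow 2))
    (hSer s i) (hSer (-s) j) a b

/-- The right-hand side of the relation described at `hhLeft`. -/
def hhRight (ρ : ℤˣ → Kq⟦X⟧) (s : ℤˣ) (i j : Fin (n + 1)) (a b : ℕ) : Free n :=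
  crossCoeff' (scaled (fSer n) (qcPow (-(2 * (s : ℤ)))) * scaled (ρ s) (qcPow (-2)))
    (hSer s i) (hSer (-s) j) a b

/-- The defining relations, written for the coefficients of the generating series. -/
inductive Rel (n : ℕ) : Free n → Free n → Prop
  | qc_mul : Rel n (FreeAlgebra.ι Kq ExtGen.qc * FreeAlgebra.ι Kq ExtGen.qcInv) 1
  | qcInv_mul : Rel n (FreeAlgebra.ι Kq ExtGen.qcInv * FreeAlgebra.ι Kq ExtGen.qc) 1
  | qc_central (g : ExtGen n) :
      Rel n (FreeAlgebra.ι Kq ExtGen.qc * FreeAlgebra.ι Kq g)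
        (FreeAlgebra.ι Kq g * FreeAlgebra.ι Kq ExtGen.qc)
  | h_zero (s : ℤˣ) (j : Fin (n + 1)) : Rel n (h s j 0 * h (-s) j 0) 1
  | h_last (i : Fin n) (hi : IsLast i) : Rel n (h 1 i.castSucc 0 * h 1 i.succ 0) 1
  | X_odd (s : ℤˣ) (i : Fin n) (hi : IsLast i) (m : ℤ) : Rel n (X s i (2 * m + 1)) 0
  | psi_odd (s : ℤˣ) (i : Fin n) (hi : IsLast i) (m : ℕ) :
      Rel n (PowerSeries.coeff (2 * m + 1) (psiSer s i)) 0
  | h_h (s : ℤˣ) (i j : Fin (n + 1)) (a b : ℕ) : Rel n (h s i a * h s j b) (h s j b * h s i a)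
  | h_h_eq (s : ℤˣ) (i : Fin (n + 1)) (a b : ℕ) :
      Rel n (hhLeft (fun _ => 1) s i i a b) (hhRight (fun _ => 1) s i i a b)
  /-- `ρ(x) = (x - 1) / (q x - q^{-1})` -/
  | h_h_lt (s : ℤˣ) (i j : Fin (n + 1)) (hij : i < j) (hi : i.val + 1 ≠ n) (a b : ℕ) :
      Rel n (hhLeft (fun s => ratExp s 1 1 (-1) q (-q⁻¹)) s i j a b)
        (hhRight (fun s => ratExp s 1 1 (-1) q (-q⁻¹)) s i j a b)
  /-- `ρ(x) = (x^2 - 1) / (q^2 x^2 - q^{-2})` -/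
  | h_h_last (s : ℤˣ) (i : Fin n) (hi : IsLast i) (a b : ℕ) :
      Rel n
        (hhLeft (fun s => ratExp s 2 1 (-1) (q ^ 2) (-q ^ (-2 : ℤ))) s i.castSucc i.succ a b)
        (hhRight (fun s => ratExp s 2 1 (-1) (q ^ 2) (-q ^ (-2 : ℤ))) s i.castSucc i.succ a b)
  /-- `h^±_i(u) X^+_j(v) = g_{ij}(u / v_±) X^+_j(v) h^±_i(u)` at `u^{s a} v^{-l}` -/
  | h_Xp (s : ℤˣ) (i : Fin (n + 1)) (j : Fin n) (a : ℕ) (l : ℤ) :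
      Rel n (h s i a * X 1 j l)
        (∑ k ∈ Finset.range (a + 1),
          PowerSeries.coeff k (scaled (gSer s i j) (qcPow (-1))) *
            (X 1 j (l - (s : ℤ) * k) * h s i (a - k)))
  /-- `X^-_j(v) h^±_i(u) = g_{ij}(u / v_∓) h^±_i(u) X^-_j(v)` at `u^{s a} v^{-l}` -/
  | h_Xm (s : ℤˣ) (i : Fin (n + 1)) (j : Fin n) (a : ℕ) (l : ℤ) :
      Rel n (X (-1) j l * h s i a)
        (∑ k ∈ Finset.range (a + 1),
          PowerSeries.coeff k (scaled (gSer s i j) (qcPow 1)) *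
            (h s i (a - k) * X (-1) j (l - (s : ℤ) * k)))
  /-- `(u - p v) X_i(u q^i) X_j(v q^j) = (p u - v) X_j(v q^j) X_i(u q^i)`, `p = q^{±(α_i,α_j)}` -/
  | quad (s : ℤˣ) (i j : Fin n) (hi : ¬ IsLast i) (hj : ¬ IsLast j) (m l : ℤ) :
      Rel n
        (Xq s i (m + 1) * Xq s j l - q ^ ((s : ℤ) * form i j) • (Xq s i m * Xq s j (l + 1)))
        (q ^ ((s : ℤ) * form i j) • (Xq s j l * Xq s i (m + 1)) - Xq s j (l + 1) * Xq s i m)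
  /-- the same with `u^2`, `v^2` in place of `u`, `v` in the two factors, for `j = n` -/
  | quad_last (s : ℤˣ) (i j : Fin n) (hj : IsLast j) (m l : ℤ) :
      Rel n
        (Xq s i (m + 2) * Xq s j l - q ^ ((s : ℤ) * form i j) • (Xq s i m * Xq s j (l + 2)))
        (q ^ ((s : ℤ) * form i j) • (Xq s j l * Xq s i (m + 2)) - Xq s j (l + 2) * Xq s i m)
  /-- `[X^+_i(u), X^-_j(v)] = δ_{ij} (q_i - q_i^{-1}) (δ(u q^{-c}/v) h^-_i(v_+)^{-1} h^-_{i+1}(v_+)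
        - δ(u q^c/v) h^+_i(u_+)^{-1} h^+_{i+1}(u_+))` for `j ≠ n`, at `u^{-m} v^{-l}` -/
  | X_X (i j : Fin n) (hj : ¬ IsLast j) (m l : ℤ) :
      Rel n (X 1 i m * X (-1) j l - X (-1) j l * X 1 i m)
        (if i = j then
          (qi i - (qi i)⁻¹) •
            (qcPow (m - l) * psiZ (-1) i (-(m + l)) - qcPow (l - m) * psiZ 1 i (-(m + l)))
        else 0)
  /-- `[X^+_i(u), X^-_n(v)] = δ_{in} (q_n - q_n^{-1})
        (δ((u q^{-c}/v)^2) q^c h^-_i(v_+)^{-1} h^-_{i+1}(v_+)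
        - δ((u q^c/v)^2) q^{-c} h^+_i(u_+)^{-1} h^+_{i+1}(u_+))`, at `u^{-m} v^{-l}` -/
  | X_X_last (i j : Fin n) (hj : IsLast j) (m l : ℤ) :
      Rel n (X 1 i m * X (-1) j l - X (-1) j l * X 1 i m)
        (if i = j then
          (qi j - (qi j)⁻¹) •
            ((if Even m then qcPow (m - l + 2) * psiZ (-1) i (-(m + l)) else 0) -
              (if Even l then qcPow (l - m - 2) * psiZ 1 i (-(m + l)) else 0))
        else 0)
  | serre (s : ℤˣ) (i j : Fin n) (hij : i ≠ j) (hA : cartan i j = 0 ∨ cartan i j = -1)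
      (m : Fin (1 - cartan i j).toNat → ℤ) (l : ℤ) :
      Rel n (TwistedAffine.serre (qi i) (X s i) (X s j l) m) 0
  /-- the symmetrization of `(q^{±2} u_1 + u_2) (X_j(v) X_i(u_1) X_i(u_2) - [2]_{q^2} X_i(u_1)
        X_j(v) X_i(u_2) + X_i(u_1) X_i(u_2) X_j(v))` at `u_1^{-m_1} u_2^{-m_2} v^{-l}` -/
  | serre_two (s : ℤˣ) (i j : Fin n) (hA : cartan i j = -2) (m : Fin 2 → ℤ) (l : ℤ) :
      Rel n
        (∑ π : Equiv.Perm (Fin 2),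
          (q ^ (2 * (s : ℤ)) • serreTwo (X s i) (X s j l) (m (π 0) + 1) (m (π 1)) +
            serreTwo (X s i) (X s j l) (m (π 0)) (m (π 1) + 1))) 0

end Ext

/-- The extended quantum affine algebra `U_q^{ext}(A^{(2)}_{2n-1})`. -/
abbrev UqExt (n : ℕ) : Type := RingQuot (Ext.Rel n)

/-- The quotient map from the free algebra. -/
def UqExt.mk (n : ℕ) : Ext.Free n →ₐ[Kq] UqExt n := RingQuot.mkAlgHom Kq (Ext.Rel n)

/-- The image of `h^s_{j, s m}` in the extended algebra. -/
def UqExt.h {n : ℕ} (s : ℤˣ) (j : Fin (n + 1)) (m : ℕ) : UqExt n := UqExt.mk n (Ext.h s j m)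

/-- The series `h^s_j(u)` over the extended algebra, as a power series in `u^{s}`. -/
def UqExt.hSer {n : ℕ} (s : ℤˣ) (j : Fin (n + 1)) : (UqExt n)⟦X⟧ :=
  PowerSeries.mk fun m => UqExt.h s j m

/-- The inverse series `h^s_j(u)^{-1}`. -/
def UqExt.hInvSer {n : ℕ} (s : ℤˣ) (j : Fin (n + 1)) : (UqExt n)⟦X⟧ :=
  invSeries (UqExt.h (-s) j 0) (UqExt.hSer s j)

theorem UqExt.hSer_mul_hInvSer {n : ℕ} (s : ℤˣ) (j : Fin (n + 1)) :
    UqExt.hSer s j * UqExt.hInvSer s j = 1 := by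
  apply mul_invSeries
  have := RingQuot.mkAlgHom_rel Kq (Ext.Rel.h_zero (n := n) s j)
  simpa [UqExt.hSer, UqExt.h, UqExt.mk] using this

/-- `ς` has the prescribed values: `q^{c/2} ↦ q^{c/2}`,
  `k_i ↦ h^+_{i,0} (h^+_{i+1,0})^{-1}` for `i < n`, `k_n ↦ q^c (h^+_{n,0})^2`,
  `x^±_i(u) ↦ (q_i - q_i^{-1})^{-1} X^±_i(u q^i)`,
  `φ^±_i(u) ↦ h^∓_{i+1}(u q^i) h^∓_i(u q^i)^{-1}` for `i < n`, and
  `φ^±_n(u) ↦ q^{±c} h^∓_{n+1}(u q^n) h^∓_n(u q^n)^{-1}`. -/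
structure IsCurrentMap (n : ℕ) (ς : UqA n →ₐ[Kq] UqExt n) : Prop where
  map_qc : ς (UqA.mk n (Dr.qcPow 1)) = UqExt.mk n (Ext.qcPow 1)
  map_k : ∀ i : Fin n, ¬ IsLast i →
    ς (UqA.mk n (Dr.k i)) = UqExt.h 1 i.castSucc 0 * UqExt.h (-1) i.succ 0
  map_k_last : ∀ i : Fin n, IsLast i →
    ς (UqA.mk n (Dr.k i)) = UqExt.mk n (Ext.qcPow 2) * UqExt.h 1 i.castSucc 0 ^ 2
  map_x : ∀ (s : ℤˣ) (i : Fin n) (m : ℤ),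
    ς (UqA.mk n (Dr.x s i m)) =
      (qi i - (qi i)⁻¹)⁻¹ • q ^ (-((i.val + 1 : ℤ) * m)) • UqExt.mk n (Ext.X s i m)
  map_phi : ∀ (s : ℤˣ) (i : Fin n), ¬ IsLast i → ∀ m : ℕ,
    ς (UqA.mk n (Dr.phi s i m)) =
      q ^ (-((s : ℤ) * (i.val + 1 : ℤ) * m)) •
        PowerSeries.coeff m (UqExt.hSer (-s) i.succ * UqExt.hInvSer (-s) i.castSucc)
  map_phi_last : ∀ (s : ℤˣ) (i : Fin n), IsLast i → ∀ m : ℕ,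
    ς (UqA.mk n (Dr.phi s i m)) =
      q ^ (-((s : ℤ) * (i.val + 1 : ℤ) * m)) •
        (UqExt.mk n (Ext.qcPow (2 * (s : ℤ))) *
          PowerSeries.coeff m (UqExt.hSer (-s) i.succ * UqExt.hInvSer (-s) i.castSucc))

end

end TwistedAffine

/-! All relations that involve the series h^±_j(u) are rewritten in terms of logarithmic
derivatives. Let D = t d/dt. A series E with invertible constant term satisfies D E = S E for some S
with S_0 = 0, and in characteristic zero E is recovered recursively from S and its constant term
(`eulerD_unique`). No logarithm of a noncommutative series is needed.

Under this dictionary a relation E(t) y = G(t) y E(t) with a current y becomes [S_r, y_j] = P_r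
y_{j+r}, where P is the logarithmic derivative of the central series G (`commutator_of_conj`,
`conj_of_commutator`). The relations between h^±_i(u) and h^∓_j(v) become Heisenberg relations
(`heisComm_of_cross`, `cross_of_heisComm`). The infinite product f enters only through the closed
form `fLog` of its logarithmic derivative.

Existence. Let L_i be the logarithmic derivative of h_i. The differences L_{i+1} - L_i behave as the
generators a_{i,r} up to normalization: the structure constants `pij` of the h's among themselves
have the constants `gam` of the h's with the currents as consecutive differences (`pij_sub`), and
the differences of `gam` are Drinfeld's constants (`heis_eq`). The remaining relations match after
rescaling the currents; at the last node the discrepancies are settled by the vanishing of odd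
modes. Uniqueness holds because the coefficients of φ^±_i(u) determine the a_{i,l} (`Dr.hom_ext`).

Injectivity. One would like to map the extended algebra back. Modulo constant terms, the differences
L_{i+1} - L_i are prescribed, so only L_1 is missing. It is taken to be the combination of the node
generators with the commutators required of L_1; this is a linear system with the explicit solution
`weight` (`sum_weight_gam_left`, `sum_weight_gam_right`), and the division is possible because
q^{∓2nr} + (-1)^r never vanishes (`xi_denom_ne_zero`). The series h_i are then exponentials of these
combinations.

The constant terms are the only obstruction: k_n = q^c (h^+_{n,0})^2 requires a square root of k_n.
It is adjoined by passing to two by two matrices. The algebra is embedded as diag(b, τ(b)), with τ a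
grading automorphism, and K is the matrix with rows (0, k_n) and (1, 0). Then K^2 is the image of
k_n, and K commutes with the currents up to half the exponent of k_n. The composite of ς with the
resulting homomorphism to matrices is b ↦ diag(b, τ(b)), which is injective. -/

namespace TwistedAffine
noncomputable section

/-! ### Euler derivation on power series over a noncommutative algebra -/

section Euler

variable {A : Type*} [Ring A]

/-- The derivation `t d/dt`. -/
def eulerD (F : A⟦X⟧) : A⟦X⟧ := PowerSeries.mk fun m => m • PowerSeries.coeff m F

@[simp] theorem coeff_eulerD (F : A⟦X⟧) (m : ℕ) :
    PowerSeries.coeff m (eulerD F) = m • PowerSeries.coeff m F := by simp [eulerD]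

theorem eulerD_mul (F G : A⟦X⟧) : eulerD (F * G) = eulerD F * G + F * eulerD G := by
  ext m
  simp only [coeff_eulerD, PowerSeries.coeff_mul, map_add, Finset.smul_sum,
    ← Finset.sum_add_distrib]
  refine Finset.sum_congr rfl fun p hp => ?_
  rw [← Finset.HasAntidiagonal.mem_antidiagonal.mp hp, add_smul, smul_mul_assoc, mul_smul_comm]

@[simp] theorem eulerD_C (a : A) : eulerD (PowerSeries.C a) = 0 := by
  ext m
  rcases m with - | m <;> simp [PowerSeries.coeff_C]

@[simp] theorem eulerD_zero : eulerD (0 : A⟦X⟧) = 0 := by ext; simp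

@[simp] theorem eulerD_one : eulerD (1 : A⟦X⟧) = 0 := by
  rw [← map_one PowerSeries.C, eulerD_C]

theorem eulerD_sub (F G : A⟦X⟧) : eulerD (F - G) = eulerD F - eulerD G := by
  ext; simp [smul_sub]

/-- The coefficients of `F` commute with those of `G`. -/
def CoeffCommute (F G : A⟦X⟧) : Prop :=
  ∀ a b, Commute (PowerSeries.coeff a F) (PowerSeries.coeff b G)

theorem CoeffCommute.symm {F G : A⟦X⟧} (h : CoeffCommute F G) : CoeffCommute G F :=
  fun a b => (h b a).symm

theorem commute_C_iff {a : A} {G : A⟦X⟧} :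
    Commute (PowerSeries.C a) G ↔ ∀ b, Commute a (PowerSeries.coeff b G) := by
  simp only [Commute, SemiconjBy, PowerSeries.ext_iff, PowerSeries.coeff_C_mul,
    PowerSeries.coeff_mul_C]

theorem CoeffCommute.commute {F G : A⟦X⟧} (h : CoeffCommute F G) : Commute F G := by
  ext m
  rw [PowerSeries.coeff_mul, PowerSeries.coeff_mul, ← Finset.Nat.sum_antidiagonal_swap]
  exact Finset.sum_congr rfl fun p _ => h _ _

theorem CoeffCommute.mul_right {F G H : A⟦X⟧} (h : CoeffCommute F G) (h' : CoeffCommute F H) :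
    CoeffCommute F (G * H) := fun a =>
  commute_C_iff.mp ((commute_C_iff.mpr (h a)).mul_right (commute_C_iff.mpr (h' a)))

theorem CoeffCommute.eulerD_right {F G : A⟦X⟧} (h : CoeffCommute F G) :
    CoeffCommute F (eulerD G) := fun a b => by
  rw [coeff_eulerD]; exact (h a b).smul_right b

theorem CoeffCommute.inv_right {F G G' : A⟦X⟧} (h : CoeffCommute F G) (h1 : G * G' = 1)
    (h2 : G' * G = 1) : CoeffCommute F G' := fun a => by
  rw [← commute_C_iff]
  have := commute_C_iff.mpr (h a)
  exact Commute.units_inv_right (u := ⟨G, G', h1, h2⟩) this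

/-- The coefficients of `F` are central. -/
def CentralSeries (F : A⟦X⟧) : Prop := ∀ k a, Commute (PowerSeries.coeff k F) a

theorem CentralSeries.commute {F : A⟦X⟧} (h : CentralSeries F) (G : A⟦X⟧) : Commute F G :=
  CoeffCommute.commute fun a _ => h a _

theorem CentralSeries.mul {F G : A⟦X⟧} (h : CentralSeries F) (h' : CentralSeries G) :
    CentralSeries (F * G) := fun k a => by
  rw [PowerSeries.coeff_mul]
  exact Commute.sum_left _ _ _ fun p _ => (h _ a).mul_left (h' _ a)

theorem CentralSeries.add {F G : A⟦X⟧} (h : CentralSeries F) (h' : CentralSeries G) :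
    CentralSeries (F + G) := fun k a => by
  rw [map_add]; exact (h _ a).add_left (h' _ a)

theorem CentralSeries.sub {F G : A⟦X⟧} (h : CentralSeries F) (h' : CentralSeries G) :
    CentralSeries (F - G) := fun k a => by
  rw [map_sub]; exact (h _ a).sub_left (h' _ a)

theorem CentralSeries.inv {F F' : A⟦X⟧} (h : CentralSeries F) (h1 : F * F' = 1)
    (h2 : F' * F = 1) : CentralSeries F' := fun k a => by
  have : CoeffCommute (PowerSeries.C a) F := fun i j => (h j _).symm
  simpa using (this.inv_right h1 h2 0 k).symm

/-- `mul_invSeries` applied twice: the right inverse of F has a right inverse in turn, and that one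
must be F. -/
theorem invSeries_mul (c : A) (F : A⟦X⟧) (hc : PowerSeries.coeff 0 F * c = 1)
    (hc' : c * PowerSeries.coeff 0 F = 1) : invSeries c F * F = 1 := by
  have h0 : PowerSeries.coeff 0 (invSeries c F) = c := by simp [invSeries, invCoeff]
  have h1 := mul_invSeries c F hc
  have h2 := mul_invSeries (PowerSeries.coeff 0 F) (invSeries c F) (by rw [h0, hc'])
  rwa [← left_inv_eq_right_inv h1 h2] at h2

/-- If `D E = S E`, `D E' = S' E'`, and the coefficients commute, then
`D (E E') = (S + S') E E'`. -/
theorem eulerD_mul_of_eq {E E' S S' : A⟦X⟧} (h : eulerD E = S * E) (h' : eulerD E' = S' * E')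
    (hc : Commute E S') : eulerD (E * E') = (S + S') * (E * E') := by
  rw [eulerD_mul, h, h', add_mul, mul_assoc, ← mul_assoc E, hc.eq, mul_assoc]

/-- Differentiate E E' = 1 and cancel E on the left. Commutation of E' with S is needed only to
return S to the left. -/
theorem eulerD_inv_of_eq {E E' S : A⟦X⟧} (h : eulerD E = S * E) (h1 : E * E' = 1)
    (h2 : E' * E = 1) (hc : Commute E' S) : eulerD E' = -S * E' := by
  have h3 := congrArg eulerD h1
  rw [eulerD_mul, h, eulerD_one, mul_assoc, h1, mul_one] at h3
  have h4 : E' * (S + E * eulerD E') = 0 := by rw [h3, mul_zero]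
  rw [mul_add, ← mul_assoc, h2, one_mul, hc.eq] at h4
  rw [neg_mul]
  exact eq_neg_of_add_eq_zero_right h4

theorem eulerD_pow {S : A⟦X⟧} (hc : Commute S (eulerD S)) (N : ℕ) :
    eulerD (S ^ (N + 1)) = (N + 1) • (eulerD S * S ^ N) := by
  induction N with
  | zero => simp
  | succ N ih =>
    rw [pow_succ, eulerD_mul, ih, ((hc.pow_left (N + 1)).eq), smul_mul_assoc, mul_assoc,
      ← pow_succ, ← succ_nsmul]

theorem coeff_pow_eq_zero {S : A⟦X⟧} (hS : PowerSeries.coeff 0 S = 0) {N m : ℕ} (h : m < N) :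
    PowerSeries.coeff m (S ^ N) = 0 := by
  induction N generalizing m with
  | zero => omega
  | succ N ih =>
    rw [pow_succ', PowerSeries.coeff_mul]
    refine Finset.sum_eq_zero fun p hp => ?_
    have hp' := Finset.HasAntidiagonal.mem_antidiagonal.mp hp
    rcases Nat.eq_zero_or_pos p.1 with h1 | h1
    · rw [h1, hS, zero_mul]
    · rw [ih (by omega), mul_zero]

end Euler

/-! ### Exponentials as solutions of first-order equations -/

section Exp

variable {A : Type*} [Ring A] [Algebra Kq A]

/-- Characteristic zero enters here: it lets a coefficient be recovered from its image under D. -/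
theorem nsmul_cancel {m : ℕ} (hm : m ≠ 0) {a b : A} (h : m • a = m • b) : a = b := by
  have h' : ((m : Kq)) • a = (m : Kq) • b := by simpa [Nat.cast_smul_eq_nsmul] using h
  exact smul_right_injective A (Nat.cast_ne_zero.mpr hm) h'

/-- As S_0 = 0, the equation reads m Y_m = ∑ S_a Y_{m-a} over a ≥ 1, a recursion with Y_0 as its
only free datum. Identities between exponentials are proved below by comparing first-order equations
and constant terms. -/
theorem eulerD_unique {S Y Z : A⟦X⟧} (hS : PowerSeries.coeff 0 S = 0) (hY : eulerD Y = S * Y)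
    (hZ : eulerD Z = S * Z) (h0 : PowerSeries.coeff 0 Y = PowerSeries.coeff 0 Z) : Y = Z := by
  ext m
  induction m using Nat.strong_induction_on with
  | _ m ih =>
    rcases Nat.eq_zero_or_pos m with rfl | hm
    · exact h0
    · apply nsmul_cancel hm.ne'
      rw [← coeff_eulerD, ← coeff_eulerD, hY, hZ, PowerSeries.coeff_mul, PowerSeries.coeff_mul]
      refine Finset.sum_congr rfl fun p hp => ?_
      have hp' := Finset.HasAntidiagonal.mem_antidiagonal.mp hp
      rcases Nat.eq_zero_or_pos p.1 with h | h
      · rw [h, hS, zero_mul, zero_mul]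
      · rw [ih p.2 (by omega)]

/-- S^N starts in degree N, so the truncation order of the exponential is immaterial once it is at
least m. A common order for all coefficients is what allows the sums in `eulerD_expSeries` to be
interchanged. -/
theorem coeff_expSeries {S : A⟦X⟧} (hS : PowerSeries.coeff 0 S = 0) {M m : ℕ} (h : m ≤ M) :
    PowerSeries.coeff m (expSeries S) =
      ∑ N ∈ Finset.range (M + 1), ((N.factorial : Kq)⁻¹) • PowerSeries.coeff m (S ^ N) := by
  rw [expSeries, PowerSeries.coeff_mk]
  refine Finset.sum_subset (Finset.range_mono (by omega)) fun N _ hN => ?_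
  rw [coeff_pow_eq_zero hS (by simpa using hN), smul_zero]

theorem eulerD_expSeries {S : A⟦X⟧} (hS : PowerSeries.coeff 0 S = 0)
    (hc : Commute S (eulerD S)) : eulerD (expSeries S) = eulerD S * expSeries S := by
  ext m
  rw [coeff_eulerD, coeff_expSeries hS (Nat.le_succ m), Finset.smul_sum, Finset.sum_range_succ',
    PowerSeries.coeff_mul]
  have h1 : ∀ p ∈ Finset.HasAntidiagonal.antidiagonal m, PowerSeries.coeff p.1 (eulerD S) *
      PowerSeries.coeff p.2 (expSeries S) = ∑ N ∈ Finset.range (m + 1),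
        ((N.factorial : Kq)⁻¹) • (PowerSeries.coeff p.1 (eulerD S) *
          PowerSeries.coeff p.2 (S ^ N)) := fun p hp => by
    rw [coeff_expSeries hS (M := m) (by have := Finset.HasAntidiagonal.mem_antidiagonal.mp hp; omega),
      Finset.mul_sum]
    simp only [mul_smul_comm]
  rw [Finset.sum_congr rfl h1, Finset.sum_comm]
  have h2 : m • ((Nat.factorial 0 : Kq)⁻¹ • PowerSeries.coeff m (S ^ 0)) = 0 := by
    rcases m with - | m <;> simp [PowerSeries.coeff_one]
  rw [h2, add_zero]
  refine Finset.sum_congr rfl fun N _ => ?_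
  rw [← Finset.smul_sum, ← PowerSeries.coeff_mul, smul_comm, ← coeff_eulerD, eulerD_pow hc, map_nsmul, ← Nat.cast_smul_eq_nsmul Kq, smul_smul,
    Nat.factorial_succ]
  congr 1
  have : ((N + 1 : ℕ) : Kq) ≠ 0 := Nat.cast_ne_zero.mpr (Nat.succ_ne_zero N)
  push_cast at this ⊢
  rw [mul_inv, mul_comm (_)⁻¹, mul_assoc, inv_mul_cancel₀ this, mul_one]

theorem coeff_zero_expSeries (S : A⟦X⟧) : PowerSeries.coeff 0 (expSeries S) = 1 := by
  simp [expSeries]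

end Exp

/-! ### Commutation relations of exponentials with currents -/

section Conj

variable {A : Type*} [Ring A]

/-- The series `∑_k G_k y_{j+k} t^k`. -/
def shiftSeries (G : A⟦X⟧) (y : ℕ → A) (j : ℕ) : A⟦X⟧ :=
  PowerSeries.mk fun k => PowerSeries.coeff k G * y (j + k)

/-- For the twisted current y(t) = ∑ G_k y_{j+k} t^k, the defect [S, y(t)] - D y(t) is the
convolution of G with the defects [S_r, y_i] - P_r y_{i+r}. This convolution is triangular, so it
serves both directions of the dictionary. -/
theorem coeff_commutator_shiftSeries {G S P : A⟦X⟧} (hG : CentralSeries G)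
    (hD : eulerD G = P * G) (hP : CentralSeries P) (y : ℕ → A) (j m : ℕ) :
    PowerSeries.coeff m (S * shiftSeries G y j - shiftSeries G y j * S
        - eulerD (shiftSeries G y j)) =
      ∑ p ∈ Finset.HasAntidiagonal.antidiagonal m, PowerSeries.coeff p.1 G *
        (PowerSeries.coeff p.2 S * y (j + p.1) - y (j + p.1) * PowerSeries.coeff p.2 S
          - PowerSeries.coeff p.2 P * y (j + p.1 + p.2)) := by
  have h3 : PowerSeries.coeff m (eulerD (shiftSeries G y j)) =
      ∑ p ∈ Finset.HasAntidiagonal.antidiagonal m, PowerSeries.coeff p.1 G *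
        (PowerSeries.coeff p.2 P * y (j + p.1 + p.2)) := by
    rw [coeff_eulerD, shiftSeries, PowerSeries.coeff_mk, ← smul_mul_assoc, ← coeff_eulerD, hD,
      (hP.commute G).eq, PowerSeries.coeff_mul, Finset.sum_mul]
    refine Finset.sum_congr rfl fun p hp => ?_
    rw [add_assoc, Finset.HasAntidiagonal.mem_antidiagonal.mp hp, mul_assoc]
  rw [map_sub, map_sub, h3, PowerSeries.coeff_mul, PowerSeries.coeff_mul,
    ← Finset.Nat.sum_antidiagonal_swap, ← Finset.sum_sub_distrib, ← Finset.sum_sub_distrib]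
  refine Finset.sum_congr rfl fun p _ => ?_
  simp only [shiftSeries, PowerSeries.coeff_mk, Prod.fst_swap, Prod.snd_swap]
  rw [← mul_assoc, ← (hG p.1 _).eq]
  noncomm_ring

/-- Apply D to E y_j = y(t) E and cancel E on the right: the twisted current satisfies D y(t) = [S,
y(t)]. What remains is a triangular system for the defects with the unit G_0 on the diagonal. -/
theorem commutator_of_conj {E E' S G P : A⟦X⟧} (hE : eulerD E = S * E) (hEE' : E * E' = 1)
    (hG : CentralSeries G) (hD : eulerD G = P * G) (hP : CentralSeries P)
    (hu : IsUnit (PowerSeries.coeff 0 G)) (y : ℕ → A)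
    (h : ∀ j, E * PowerSeries.C (y j) = shiftSeries G y j * E) (r j : ℕ) :
    PowerSeries.coeff r S * y j - y j * PowerSeries.coeff r S =
      PowerSeries.coeff r P * y (j + r) := by
  have key : ∀ j, S * shiftSeries G y j - shiftSeries G y j * S
      - eulerD (shiftSeries G y j) = 0 := fun j => by
    have h1 := congrArg eulerD (h j)
    rw [eulerD_mul, eulerD_mul, hE, eulerD_C, mul_zero, add_zero, mul_assoc, h j] at h1
    have h2 : (S * shiftSeries G y j - shiftSeries G y j * S
      - eulerD (shiftSeries G y j)) * E = 0 := by
      rw [sub_mul, sub_mul, mul_assoc, h1, mul_assoc]; abel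
    calc _ = (S * shiftSeries G y j - shiftSeries G y j * S
      - eulerD (shiftSeries G y j)) * E * E' := by rw [mul_assoc, hEE', mul_one]
      _ = 0 := by rw [h2, zero_mul]
  rw [← sub_eq_zero]
  -- The lower terms of the convolution have smaller r but a larger base index j + p.1, so all j are
  -- treated together.
  induction r using Nat.strong_induction_on generalizing j with
  | _ r ih =>
    have h1 := congrArg (PowerSeries.coeff r) (key j)
    rw [coeff_commutator_shiftSeries hG hD hP, map_zero,
      Finset.sum_eq_single (0, r)] at h1
    · simpa using hu.mul_right_eq_zero.mp h1
    · intro p hp hne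
      have hp' := Finset.HasAntidiagonal.mem_antidiagonal.mp hp
      rw [ih p.2, mul_zero]
      rcases Nat.eq_zero_or_pos p.1 with h0 | h0
      · exact absurd (Prod.ext h0 (by simp; omega)) hne
      · omega
    · intro hne
      simp at hne

/-- Both sides solve D Y = S Y, and `h0` matches their constant terms. -/
theorem conj_of_commutator [Algebra Kq A] {E S G P : A⟦X⟧} (hE : eulerD E = S * E)
    (hS : PowerSeries.coeff 0 S = 0)
    (hG : CentralSeries G) (hD : eulerD G = P * G) (hP : CentralSeries P) (y : ℕ → A)
    (h0 : ∀ j, PowerSeries.coeff 0 E * y j = PowerSeries.coeff 0 G * y j * PowerSeries.coeff 0 E)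
    (h : ∀ r j, PowerSeries.coeff r S * y j - y j * PowerSeries.coeff r S =
      PowerSeries.coeff r P * y (j + r)) (j : ℕ) :
    E * PowerSeries.C (y j) = shiftSeries G y j * E := by
  have key : S * shiftSeries G y j - shiftSeries G y j * S
      - eulerD (shiftSeries G y j) = 0 := by
    ext m
    rw [coeff_commutator_shiftSeries hG hD hP, map_zero]
    refine Finset.sum_eq_zero fun p _ => ?_
    rw [h, sub_self, mul_zero]
  refine eulerD_unique hS ?_ ?_ ?_
  · rw [eulerD_mul, hE, eulerD_C, mul_zero, add_zero, mul_assoc]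
  · rw [eulerD_mul, hE, ← sub_eq_zero, ← neg_eq_zero]
    calc _ = (S * shiftSeries G y j - shiftSeries G y j * S
      - eulerD (shiftSeries G y j)) * E := by noncomm_ring
      _ = 0 := by rw [key, zero_mul]
  · rw [PowerSeries.coeff_mul_C]
    simpa [shiftSeries, PowerSeries.coeff_mul] using h0 j

theorem coeff_shiftSeries_mul (G E : A⟦X⟧) (y : ℕ → A) (j a : ℕ) :
    PowerSeries.coeff a (shiftSeries G y j * E) =
      ∑ k ∈ Finset.range (a + 1),
        PowerSeries.coeff k G * (y (j + k) * PowerSeries.coeff (a - k) E) := by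
  rw [PowerSeries.coeff_mul, Finset.Nat.sum_antidiagonal_eq_sum_range_succ_mk]
  simp [shiftSeries, mul_assoc]

theorem coeff_mul_shiftSeries {G : A⟦X⟧} (hG : CentralSeries G) (E : A⟦X⟧) (y : ℕ → A)
    (j a : ℕ) :
    PowerSeries.coeff a (E * shiftSeries G y j) =
      ∑ k ∈ Finset.range (a + 1),
        PowerSeries.coeff k G * (PowerSeries.coeff (a - k) E * y (j + k)) := by
  rw [PowerSeries.coeff_mul, ← Finset.Nat.sum_antidiagonal_swap,
    Finset.Nat.sum_antidiagonal_eq_sum_range_succ_mk]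
  refine Finset.sum_congr rfl fun k _ => ?_
  simp only [shiftSeries, PowerSeries.coeff_mk, Prod.fst_swap, Prod.snd_swap]
  rw [← mul_assoc, ← (hG k _).eq, mul_assoc]

/-! ### Commutation relations of two exponentials -/

theorem commutator_eulerD (s : A) (F : A⟦X⟧) :
    eulerD (PowerSeries.C s * F - F * PowerSeries.C s) =
      PowerSeries.C s * eulerD F - eulerD F * PowerSeries.C s := by
  rw [eulerD_sub, eulerD_mul, eulerD_mul, eulerD_C, zero_mul, zero_add, mul_zero, add_zero]

theorem eulerD_monomial (r : ℕ) (a : A) :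
    eulerD (PowerSeries.monomial r a) = r • PowerSeries.monomial r a := by
  ext m
  rw [coeff_eulerD, map_nsmul, PowerSeries.coeff_monomial]
  split_ifs with h
  · rw [h]
  · simp

theorem centralSeries_monomial (r : ℕ) {c : A} (hc : ∀ a, Commute c a) :
    CentralSeries (PowerSeries.monomial r c) := fun k a => by
  rw [PowerSeries.coeff_monomial]
  split_ifs
  · exact hc a
  · exact Commute.zero_left a

/-- The commutator with a constant series commutes with D. Differentiating the hypothesis therefore
leaves [s, S] E on one side and D(c t^r) E on the other, and E is cancelled. -/
theorem commutator_log_of_exp {E E' S : A⟦X⟧} (hE : eulerD E = S * E) (hEE' : E * E' = 1)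
    (s c : A) (hc : ∀ a, Commute c a) (r : ℕ)
    (h : PowerSeries.C s * E - E * PowerSeries.C s = PowerSeries.monomial r c * E) :
    PowerSeries.C s * S - S * PowerSeries.C s = r • PowerSeries.monomial r c := by
  have hm := (centralSeries_monomial r hc).commute S
  have h1 := congrArg eulerD h
  rw [commutator_eulerD, eulerD_mul, eulerD_monomial, hE] at h1
  have h2 : (PowerSeries.C s * S - S * PowerSeries.C s - r • PowerSeries.monomial r c) * E = 0 := by
    calc _ = PowerSeries.C s * (S * E) - S * E * PowerSeries.C s
          - S * (PowerSeries.C s * E - E * PowerSeries.C s)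
          - r • PowerSeries.monomial r c * E := by noncomm_ring
      _ = 0 := by rw [h1, h, ← mul_assoc S, ← mul_assoc _ S E, hm.eq]; abel
  rw [← sub_eq_zero]
  calc _ = (PowerSeries.C s * S - S * PowerSeries.C s - r • PowerSeries.monomial r c) * E * E' := by
        rw [mul_assoc, hEE', mul_one]
    _ = 0 := by rw [h2, zero_mul]

/-- The difference of the two sides solves D Y = S Y and has zero constant term; for r = 0 this last
point is where `hr` is needed. -/
theorem commutator_exp_of_log [Algebra Kq A] {E S : A⟦X⟧} (hE : eulerD E = S * E)
    (hS : PowerSeries.coeff 0 S = 0) (s c : A) (hc : ∀ a, Commute c a) (r : ℕ)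
    (hr : r = 0 → c = 0) (h0 : Commute s (PowerSeries.coeff 0 E))
    (h : PowerSeries.C s * S - S * PowerSeries.C s = r • PowerSeries.monomial r c) :
    PowerSeries.C s * E - E * PowerSeries.C s = PowerSeries.monomial r c * E := by
  have hm := (centralSeries_monomial r hc).commute S
  rw [← sub_eq_zero]
  refine eulerD_unique hS ?_ (by simp) ?_
  · rw [eulerD_sub, commutator_eulerD, eulerD_mul, eulerD_monomial, hE, ← h, ← mul_assoc (PowerSeries.monomial r c) S E,
      hm.eq]
    simp only [sub_mul, mul_sub, mul_assoc]
    abel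
  · rw [map_sub, map_sub, PowerSeries.coeff_C_mul, PowerSeries.coeff_mul_C, h0.eq, sub_self,
      PowerSeries.coeff_mul]
    rcases Nat.eq_zero_or_pos r with h | h
    · simp [hr h]
    · simp [PowerSeries.coeff_monomial, h.ne]

/-- The diagonal series `∑_k F_{d + k} G_{d' + k} t^k`. -/
def diagSeries (F G : A⟦X⟧) (d d' : ℕ) : A⟦X⟧ :=
  PowerSeries.mk fun k => PowerSeries.coeff (d + k) F * PowerSeries.coeff (d' + k) G

/-- Multiplication by S(t t') preserves the difference of the two exponents, so along each diagonal
the product in two variables is a product of series in one variable. One of the offsets vanishes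
because a diagonal starts on the boundary of the quadrant. -/
theorem crossCoeff_eq (S F G : A⟦X⟧) {d d' : ℕ} (hd : d = 0 ∨ d' = 0) (m : ℕ) :
    crossCoeff S F G (d + m) (d' + m) = PowerSeries.coeff m (S * diagSeries F G d d') := by
  have hm : min (d + m) (d' + m) = m := by omega
  rw [crossCoeff, hm, PowerSeries.coeff_mul, Finset.Nat.sum_antidiagonal_eq_sum_range_succ_mk]
  refine Finset.sum_congr rfl fun k hk => ?_
  have hk' : k ≤ m := by simpa [Nat.lt_succ_iff] using hk
  simp only [diagSeries, PowerSeries.coeff_mk]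
  rw [Nat.add_sub_assoc hk', Nat.add_sub_assoc hk']

theorem crossCoeff'_eq (S F G : A⟦X⟧) (a b : ℕ) :
    crossCoeff' S F G a b = crossCoeff S G F b a := by
  rw [crossCoeff, crossCoeff', min_comm]

/-- `E'_{b-j}`, with `0` for `j > b`. -/
def revCoeff (F : A⟦X⟧) (b j : ℕ) : A := if j ≤ b then PowerSeries.coeff (b - j) F else 0

theorem exists_diag (a b : ℕ) : ∃ d d' m, (d = 0 ∨ d' = 0) ∧ a = d + m ∧ b = d' + m :=
  ⟨a - min a b, b - min a b, min a b, by omega, by omega, by omega⟩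

/-- The sequence F_b, F_{b-1}, …, F_0, 0, 0, … plays the role of a current. Read at a fixed b and
divided by T, the relation in two variables says that E conjugates this current with twisting series
T' R, so the results on currents apply to it. -/
theorem cross_iff_conj {E F T T' R : A⟦X⟧} (h1 : T * T' = 1) (h2 : T' * T = 1) :
    (∀ a b, crossCoeff T E F a b = crossCoeff' R E F a b) ↔
      ∀ b, E * PowerSeries.C (PowerSeries.coeff b F) =
        shiftSeries (T' * R) (revCoeff F b) 0 * E := by
  have hA : ∀ a b, PowerSeries.coeff a (shiftSeries (T' * R) (revCoeff F b) 0 * E) =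
      crossCoeff (T' * R) F E b a := fun a b => by
    rw [coeff_shiftSeries_mul, crossCoeff]
    symm
    refine Finset.sum_subset_zero_on_sdiff (Finset.range_mono (by omega)) ?_ ?_
    · intro k hk
      simp only [Finset.mem_sdiff, Finset.mem_range] at hk
      rw [revCoeff, if_neg (by omega), zero_mul, mul_zero]
    · intro k hk
      simp only [Finset.mem_range] at hk
      rw [revCoeff, if_pos (by omega), zero_add]
  -- Along diagonals T is an ordinary left factor and can be moved to the other side.
  have hB : (∀ a b, crossCoeff T E F a b = crossCoeff' R E F a b) ↔
      ∀ d d', (d = 0 ∨ d' = 0) → T * diagSeries E F d d' = R * diagSeries F E d' d := by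
    constructor
    · intro h d d' hd
      ext m
      rw [← crossCoeff_eq _ _ _ hd, h, crossCoeff'_eq, crossCoeff_eq _ _ _ hd.symm]
    · intro h a b
      obtain ⟨d, d', m, hd, rfl, rfl⟩ := exists_diag a b
      rw [crossCoeff'_eq, crossCoeff_eq _ _ _ hd, crossCoeff_eq _ _ _ hd.symm, h d d' hd]
  rw [hB]
  constructor
  · intro h b
    ext a
    rw [hA, PowerSeries.coeff_mul_C]
    obtain ⟨d, d', m, hd, rfl, rfl⟩ := exists_diag a b
    rw [crossCoeff_eq _ _ _ hd.symm, mul_assoc, ← h d d' hd, ← mul_assoc, h2, one_mul]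
    simp [diagSeries]
  · intro h d d' hd
    have : diagSeries E F d d' = T' * R * diagSeries F E d' d := by
      ext m
      rw [← crossCoeff_eq _ _ _ hd.symm, ← hA, ← h, PowerSeries.coeff_mul_C]
      simp [diagSeries]
    rw [this, ← mul_assoc, ← mul_assoc, h1, one_mul]

/-- Starting the artificial current at j amounts to replacing b by b - j; hence a relation known at
j = 0 for all b holds for all j (`conj_revCoeff`). -/
theorem shiftSeries_revCoeff (G F : A⟦X⟧) (b j : ℕ) :
    shiftSeries G (revCoeff F b) j =
      if j ≤ b then shiftSeries G (revCoeff F (b - j)) 0 else 0 := by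
  ext k
  split_ifs with h
  · simp only [shiftSeries, PowerSeries.coeff_mk, revCoeff]
    by_cases hk : k ≤ b - j
    · rw [if_pos (by omega), if_pos (by omega)]
      congr 3; omega
    · rw [if_neg (by omega), if_neg (by omega)]
  · simp only [shiftSeries, PowerSeries.coeff_mk, revCoeff]
    rw [if_neg (by omega), mul_zero, map_zero]

theorem conj_revCoeff {E F G : A⟦X⟧}
    (h : ∀ b, E * PowerSeries.C (PowerSeries.coeff b F) =
        shiftSeries G (revCoeff F b) 0 * E) (b j : ℕ) :
    E * PowerSeries.C (revCoeff F b j) = shiftSeries G (revCoeff F b) j * E := by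
  rw [shiftSeries_revCoeff, revCoeff]
  split_ifs
  · exact h _
  · simp

/-- Translation back from the artificial current to F: raising the index of the current by r is
multiplication of F by t^r. -/
theorem commutator_revCoeff_iff (F : A⟦X⟧) (s c : A) (r : ℕ) :
    (∀ b j, s * revCoeff F b j - revCoeff F b j * s = c * revCoeff F b (j + r)) ↔
      PowerSeries.C s * F - F * PowerSeries.C s = PowerSeries.monomial r c * F := by
  have hm : ∀ b, PowerSeries.coeff b (PowerSeries.monomial r c * F) = c * revCoeff F b r := by
    intro b
    rw [PowerSeries.coeff_mul, revCoeff]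
    split_ifs with h
    · rw [Finset.sum_eq_single (r, b - r)]
      · simp
      · intro p hp hne
        have hp' := Finset.HasAntidiagonal.mem_antidiagonal.mp hp
        rw [PowerSeries.coeff_monomial, if_neg, zero_mul]
        intro h; apply hne; ext
        · exact h
        · simp; omega
      · intro hne
        simp only [Finset.HasAntidiagonal.mem_antidiagonal] at hne
        omega
    · rw [mul_zero]
      refine Finset.sum_eq_zero fun p hp => ?_
      have hp' := Finset.HasAntidiagonal.mem_antidiagonal.mp hp
      rw [PowerSeries.coeff_monomial, if_neg (by omega), zero_mul]
  constructor
  · intro h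
    ext b
    have := h b 0
    rw [zero_add] at this
    rw [hm, ← this, map_sub, PowerSeries.coeff_C_mul, PowerSeries.coeff_mul_C]
    simp [revCoeff]
  · intro h b j
    by_cases hj : j ≤ b
    · have := congrArg (PowerSeries.coeff (b - j)) h
      rw [hm, map_sub, PowerSeries.coeff_C_mul, PowerSeries.coeff_mul_C] at this
      simp only [revCoeff, if_pos hj]
      rw [this, revCoeff]
      by_cases hr : r ≤ b - j
      · rw [if_pos hr, if_pos (by omega)]; congr 3; omega
      · rw [if_neg hr, if_neg (by omega)]
    · simp only [revCoeff, if_neg hj, if_neg (show ¬ j + r ≤ b by omega), mul_zero, zero_mul,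
        sub_zero]

/-- The commutators of two families `S_r`, `S'_l`: `[S_r, S'_l] = δ_{rl} r P_r`. -/
def HeisComm (S S' P : A⟦X⟧) : Prop :=
  ∀ r l, PowerSeries.coeff r S * PowerSeries.coeff l S' -
      PowerSeries.coeff l S' * PowerSeries.coeff r S =
    if r = l then r • PowerSeries.coeff r P else 0

theorem heisComm_iff (S S' P : A⟦X⟧) : HeisComm S S' P ↔
    ∀ r, PowerSeries.C (PowerSeries.coeff r S) * S' - S' * PowerSeries.C (PowerSeries.coeff r S) =
      r • PowerSeries.monomial r (PowerSeries.coeff r P) := by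
  refine forall_congr' fun r => ?_
  rw [PowerSeries.ext_iff]
  refine forall_congr' fun l => ?_
  rw [map_sub, PowerSeries.coeff_C_mul, PowerSeries.coeff_mul_C, map_nsmul,
    PowerSeries.coeff_monomial]
  by_cases h : r = l
  · simp [h]
  · simp [h, Ne.symm h]

section

variable {E E' F F' S S' T T' R PL PR : A⟦X⟧}

theorem eulerD_quot (hLD : eulerD T = PL * T) (hRD : eulerD R = PR * R) (hPL : CentralSeries PL)
    (hPR : CentralSeries PR) (h1 : T * T' = 1) (h2 : T' * T = 1) :
    eulerD (T' * R) = (PR - PL) * (T' * R) := by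
  have h3 := eulerD_inv_of_eq hLD h1 h2 (hPL.commute _).symm
  rw [eulerD_mul_of_eq h3 hRD (hPR.commute _).symm]
  congr 1; abel

/-- Two logarithms in succession. With P = PR - PL, the one of E turns the relation into [S_r, F] =
P_r t^r F, and the one of F turns that into [S_r, S'] = r P_r t^r. -/
theorem heisComm_of_cross (hE : eulerD E = S * E) (hEE' : E * E' = 1) (hF : eulerD F = S' * F)
    (hFF' : F * F' = 1) (hT : CentralSeries T) (hR : CentralSeries R)
    (hLD : eulerD T = PL * T) (hRD : eulerD R = PR * R) (hPL : CentralSeries PL)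
    (hPR : CentralSeries PR) (h1 : T * T' = 1) (h2 : T' * T = 1)
    (hu : IsUnit (PowerSeries.coeff 0 (T' * R)))
    (h : ∀ a b, crossCoeff T E F a b = crossCoeff' R E F a b) :
    HeisComm S S' (PR - PL) := by
  have hT' := hT.inv h1 h2
  have hc := conj_revCoeff ((cross_iff_conj h1 h2).mp h)
  have hD := eulerD_quot hLD hRD hPL hPR h1 h2
  rw [heisComm_iff]
  intro r
  refine commutator_log_of_exp hF hFF' _ _ ((hPR.sub hPL) r) r ?_
  rw [← commutator_revCoeff_iff]
  intro b j
  exact commutator_of_conj hE hEE' (hT'.mul hR) hD (hPR.sub hPL) hu _ (hc b) r j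

/-- The two logarithms are undone in the opposite order. Logarithmic derivatives do not see the
constant terms of E and F, so their commutation relations are separate hypotheses. -/
theorem cross_of_heisComm [Algebra Kq A] (hE : eulerD E = S * E) (hS : PowerSeries.coeff 0 S = 0)
    (hF : eulerD F = S' * F) (hS' : PowerSeries.coeff 0 S' = 0)
    (hT : CentralSeries T) (hR : CentralSeries R)
    (hLD : eulerD T = PL * T) (hRD : eulerD R = PR * R) (hPL : CentralSeries PL)
    (hPR : CentralSeries PR) (h1 : T * T' = 1) (h2 : T' * T = 1)
    (hu : PowerSeries.coeff 0 (T' * R) = 1)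
    (hE0 : ∀ b, Commute (PowerSeries.coeff 0 E) (PowerSeries.coeff b F))
    (hF0 : ∀ r, Commute (PowerSeries.coeff r S) (PowerSeries.coeff 0 F))
    (hP0 : PowerSeries.coeff 0 (PR - PL) = 0)
    (h : HeisComm S S' (PR - PL)) (a b : ℕ) : crossCoeff T E F a b = crossCoeff' R E F a b := by
  have hT' := hT.inv h1 h2
  have hD := eulerD_quot hLD hRD hPL hPR h1 h2
  rw [heisComm_iff] at h
  refine (cross_iff_conj h1 h2).mpr (fun b => ?_) a b
  have := conj_of_commutator hE hS (hT'.mul hR) hD (hPR.sub hPL) (revCoeff F b) (fun j => ?_)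
    (fun r => (commutator_revCoeff_iff F _ _ r).mpr (commutator_exp_of_log hF hS' _ _
      ((hPR.sub hPL) r) r (fun hr => by rw [hr, hP0]) (hF0 r) (h r)) b) 0
  · simpa [revCoeff] using this
  · rw [hu, one_mul, revCoeff]
    split_ifs
    · exact hE0 _
    · simp

end

end Conj

/-! ### Scalar identities -/

theorem q_ne_zero : q ≠ 0 := RatFunc.X_ne_zero

theorem q_pow_ne_one {m : ℕ} (hm : m ≠ 0) : q ^ m ≠ 1 := by
  intro h
  have h1 : algebraMap (Polynomial ℂ) (RatFunc ℂ) (Polynomial.X ^ m) =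
      algebraMap (Polynomial ℂ) (RatFunc ℂ) 1 := by
    rw [map_pow, RatFunc.algebraMap_X, map_one]; exact h
  have h2 := congrArg Polynomial.natDegree (RatFunc.algebraMap_injective ℂ h1)
  simp at h2
  exact hm h2

theorem q_zpow_ne_one {m : ℤ} (hm : m ≠ 0) : q ^ m ≠ 1 := by
  intro h
  apply q_pow_ne_one (Int.natAbs_ne_zero.mpr hm)
  rcases Int.natAbs_eq m with h' | h'
  · rw [h'] at h; exact_mod_cast h
  · rw [h', zpow_neg, inv_eq_one] at h; exact_mod_cast h

/-- The logarithmic derivative of `1 - a t^m`. -/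
def linLog (m : ℕ) (a : Kq) : Kq⟦X⟧ :=
  PowerSeries.mk fun r => if m ∣ r ∧ r ≠ 0 then -(m : Kq) * a ^ (r / m) else 0

theorem eulerD_X_pow {A : Type*} [Ring A] (m : ℕ) :
    eulerD (PowerSeries.X ^ m : A⟦X⟧) = m • (PowerSeries.X ^ m : A⟦X⟧) := by
  ext r
  simp only [coeff_eulerD, PowerSeries.coeff_X_pow, map_nsmul]
  split_ifs with h
  · rw [h]
  · simp

/-- `linLog` is a geometric series in a t^m; multiplication by 1 - a t^m telescopes it to its first
term. -/
theorem eulerD_one_sub (m : ℕ) (hm : m ≠ 0) (a : Kq) :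
    eulerD (1 - PowerSeries.C a * PowerSeries.X ^ m) =
      linLog m a * (1 - PowerSeries.C a * PowerSeries.X ^ m) := by
  rw [eulerD_sub, eulerD_one, eulerD_mul, eulerD_C, zero_mul, zero_add, eulerD_X_pow, zero_sub,
    mul_sub, mul_one, mul_comm (PowerSeries.C a), mul_comm (PowerSeries.C a), ← mul_assoc]
  ext r
  simp only [map_neg, map_sub, PowerSeries.coeff_mul_C, map_nsmul, PowerSeries.coeff_mul_X_pow',
    smul_mul_assoc, linLog, PowerSeries.coeff_mk, PowerSeries.coeff_X_pow]
  by_cases hd : m ∣ r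
  · obtain ⟨k, rfl⟩ := hd
    rcases k with - | - | k
    · simp [hm, Ne.symm hm]
    · simp [hm, Nat.div_self (Nat.pos_of_ne_zero hm)]
    · have h1 : m * (k + 1 + 1) ≠ m := by
        intro h; have := Nat.eq_of_mul_eq_mul_left (Nat.pos_of_ne_zero hm) (h.trans (mul_one m).symm)
        omega
      have h2 : m * (k + 1 + 1) - m = m * (k + 1) := by rw [mul_add m (k + 1)]; omega
      have h3 : m ≤ m * (k + 1 + 1) := Nat.le_mul_of_pos_right _ (by omega)
      simp [hm, h1, h2, h3, pow_succ]
      ring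
  · have h1 : r ≠ m := fun h => hd (h ▸ dvd_rfl)
    simp only [hd, h1, if_false, false_and]
    split_ifs with h2 h3
    · exact absurd ((Nat.dvd_sub_iff_left h2 dvd_rfl).mp h3.1) hd
    · simp
    · simp

theorem eulerD_C_mul {A : Type*} [Ring A] (c : A) (F : A⟦X⟧) :
    eulerD (PowerSeries.C c * F) = PowerSeries.C c * eulerD F := by
  rw [eulerD_mul, eulerD_C, zero_mul, zero_add]

theorem eulerD_linear (m : ℕ) (hm : m ≠ 0) (α β : Kq) (hβ : β ≠ 0) :
    eulerD (PowerSeries.C α * PowerSeries.X ^ m + PowerSeries.C β) =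
      linLog m (-α / β) * (PowerSeries.C α * PowerSeries.X ^ m + PowerSeries.C β) := by
  have h : PowerSeries.C α * PowerSeries.X ^ m + PowerSeries.C β =
      PowerSeries.C β * (1 - PowerSeries.C (-α / β) * PowerSeries.X ^ m) := by
    rw [mul_sub, mul_one, ← mul_assoc, ← map_mul, mul_div_cancel₀ _ hβ, map_neg]; ring
  rw [h, eulerD_C_mul, eulerD_one_sub m hm]; ring

theorem constantCoeff_linear (m : ℕ) (hm : m ≠ 0) (α β : Kq) :
    PowerSeries.constantCoeff (PowerSeries.C α * PowerSeries.X ^ m + PowerSeries.C β) = β := by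
  simp [hm]

theorem eulerD_div {F G P R : Kq⟦X⟧} (hF : eulerD F = P * F) (hG : eulerD G = R * G)
    (h0 : PowerSeries.constantCoeff G ≠ 0) : eulerD (F * G⁻¹) = (P - R) * (F * G⁻¹) := by
  have h1 := PowerSeries.mul_inv_cancel G h0
  have h2 := eulerD_inv_of_eq hG h1 (by rw [mul_comm, h1]) (Commute.all _ _)
  rw [eulerD_mul_of_eq hF h2 (Commute.all _ _), sub_eq_add_neg]

theorem inv_neg_div {K : Type*} [Field K] (x y : K) : (-x / y)⁻¹ = -y / x := by
  rw [inv_div, div_neg, neg_div]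

theorem neg_zpow_div {K : Type*} [Field K] {x : K} (hx : x ≠ 0) (e : ℤ) :
    -x ^ e / -x ^ (-e) = x ^ (2 * e) := by
  rw [neg_div_neg_eq, ← zpow_sub₀ hx]; congr 1; ring

theorem neg_one_div_neg_zpow {K : Type*} [Field K] (x : K) (e : ℤ) :
    -1 / -x ^ (-e) = x ^ e := by
  rw [neg_div_neg_eq, zpow_neg, one_div, inv_inv]

/-- Expanding in x⁻¹ instead of x exchanges leading and constant coefficients, which inverts the
ratios -α/β and -γ/δ; hence the exponent s. -/
theorem eulerD_ratExp (s : ℤˣ) (m : ℕ) (hm : m ≠ 0) (α β γ δ : Kq) (hα : α ≠ 0) (hβ : β ≠ 0)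
    (hγ : γ ≠ 0) (hδ : δ ≠ 0) :
    eulerD (ratExp s m α β γ δ) =
      (linLog m ((-α / β) ^ (s : ℤ)) - linLog m ((-γ / δ) ^ (s : ℤ))) * ratExp s m α β γ δ := by
  rcases Int.units_eq_one_or s with rfl | rfl
  · simp only [ratExp, if_true, Units.val_one, zpow_one]
    exact eulerD_div (eulerD_linear m hm α β hβ) (eulerD_linear m hm γ δ hδ)
      (by rwa [constantCoeff_linear m hm])
  · have h1 : ((-1 : ℤˣ) = 1) = False := by decide
    simp only [ratExp, h1, if_false, Units.val_neg, Units.val_one, zpow_neg_one, inv_neg_div]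
    rw [add_comm (PowerSeries.C α), add_comm (PowerSeries.C γ)]
    exact eulerD_div (eulerD_linear m hm β α hα) (eulerD_linear m hm δ γ hγ)
      (by rwa [constantCoeff_linear m hm])

theorem coeff_zero_ratExp (s : ℤˣ) (m : ℕ) (hm : m ≠ 0) (α β γ δ : Kq) :
    PowerSeries.coeff 0 (ratExp s m α β γ δ) = if s = 1 then β / δ else α / γ := by
  rw [ratExp, PowerSeries.coeff_zero_eq_constantCoeff_apply]
  split_ifs
  · rw [map_mul, PowerSeries.constantCoeff_inv, constantCoeff_linear m hm,
      constantCoeff_linear m hm, div_eq_mul_inv]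
  · rw [add_comm (PowerSeries.C α), add_comm (PowerSeries.C γ), map_mul,
      PowerSeries.constantCoeff_inv, constantCoeff_linear m hm,
      constantCoeff_linear m hm, div_eq_mul_inv]

/-- The logarithmic derivative of `(x^m - 1) / (q^e x^m - q^{-e})`. -/
def ratLog (s : ℤˣ) (m : ℕ) (e : ℤ) : Kq⟦X⟧ :=
  PowerSeries.mk fun r => if m ∣ r then (m : Kq) * (q ^ (2 * e * s * (r / m : ℕ)) - 1) else 0

theorem eulerD_ratExp_q (s : ℤˣ) (m : ℕ) (hm : m ≠ 0) (e : ℤ) :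
    eulerD (ratExp s m 1 (-1) (q ^ e) (-q ^ (-e))) =
      ratLog s m e * ratExp s m 1 (-1) (q ^ e) (-q ^ (-e)) := by
  have hq := q_ne_zero
  rw [eulerD_ratExp s m hm _ _ _ _ one_ne_zero (neg_ne_zero.mpr one_ne_zero)
    (zpow_ne_zero _ hq) (neg_ne_zero.mpr (zpow_ne_zero _ hq))]
  congr 1
  ext r
  have h1 : (-1 / -1 : Kq) = 1 := div_self (neg_ne_zero.mpr one_ne_zero)
  rw [h1, neg_zpow_div hq, one_zpow, ← zpow_mul, map_sub, linLog, linLog, ratLog, PowerSeries.coeff_mk, PowerSeries.coeff_mk, PowerSeries.coeff_mk]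
  rcases Nat.eq_zero_or_pos r with rfl | hr
  · simp
  · simp only [hr.ne', ne_eq, not_false_eq_true, and_true]
    split_ifs
    · rw [one_pow, ← zpow_natCast, ← zpow_mul]
      ring
    · ring

theorem coeff_zero_ratExp_q (s : ℤˣ) (m : ℕ) (hm : m ≠ 0) (e : ℤ) :
    PowerSeries.coeff 0 (ratExp s m 1 (-1) (q ^ e) (-q ^ (-e))) = q ^ ((s : ℤ) * e) := by
  rw [coeff_zero_ratExp s m hm]
  rcases Int.units_eq_one_or s with rfl | rfl
  · simpa using neg_one_div_neg_zpow q e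
  · have h1 : ((-1 : ℤˣ) = 1) = False := by decide
    simp [h1]

/-! ### The infinite products -/

theorem eulerD_rescale (p : Kq) (F : Kq⟦X⟧) :
    eulerD (PowerSeries.rescale p F) = PowerSeries.rescale p (eulerD F) := by
  ext m
  simp only [coeff_eulerD, PowerSeries.coeff_rescale, nsmul_eq_mul]
  ring

/-- The logarithmic derivative of `infProd p a`. -/
def infProdLog (p a : Kq) : Kq⟦X⟧ :=
  PowerSeries.mk fun r => if r = 0 then 0 else -a ^ r / (1 - p ^ r)

/-- The product is accessible only through F(t) = (1 - a t) F(p t). Its formal logarithmic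
derivative must satisfy L(t) - L(p t) = -a t / (1 - a t), which `infProdLog` does. -/
theorem eulerD_infProd (p a : Kq) (hp : ∀ j : ℕ, p ^ (j + 1) ≠ 1) :
    eulerD (infProd p a) = infProdLog p a * infProd p a := by
  set F := infProd p a with hF
  set L := infProdLog p a with hL
  set l : Kq⟦X⟧ := PowerSeries.C a * PowerSeries.X with hl
  have hspec : F = (1 - l) * PowerSeries.rescale p F := infProd_spec p a hp
  have hDl : eulerD l = l := by
    rw [hl, eulerD_C_mul, ← pow_one PowerSeries.X, eulerD_X_pow, one_nsmul]
  have hL' : L * (1 - l) = -l + PowerSeries.rescale p L * (1 - l) := by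
    have hne : ∀ j : ℕ, 1 - p ^ (j + 1) ≠ 0 := fun j => sub_ne_zero.mpr (hp j).symm
    rw [hl, mul_sub, mul_sub, mul_one, mul_one, mul_comm (PowerSeries.C a), ← mul_assoc, ← mul_assoc]
    ext r
    rcases r with - | - | r
    · simp only [hL, infProdLog, map_sub, map_add, map_neg, PowerSeries.coeff_mul_C,
        PowerSeries.coeff_zero_mul_X, PowerSeries.coeff_rescale, PowerSeries.coeff_mk,
        PowerSeries.coeff_zero_X, if_true]
      ring
    · have := hne 0
      simp [hL, infProdLog, PowerSeries.coeff_succ_mul_X, PowerSeries.coeff_rescale] at this ⊢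
      field_simp
      ring
    · have h1 := hne r
      have h2 := hne (r + 1)
      simp only [hL, infProdLog, map_sub, map_add, map_neg, PowerSeries.coeff_mul_C,
        PowerSeries.coeff_succ_mul_X, PowerSeries.coeff_rescale, PowerSeries.coeff_mk,
        PowerSeries.coeff_X, Nat.succ_ne_zero, if_false]
      rw [if_neg (by omega)]
      field_simp
      ring
  -- The error D F - L F satisfies the same functional equation as F, but with zero constant term.
  -- Recursively its coefficients are killed by 1 - p^(k+1), which is nonzero.
  have hY : eulerD F - L * F = (1 - l) * PowerSeries.rescale p (eulerD F - L * F) := by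
    have h1 : eulerD F = -l * PowerSeries.rescale p F +
        (1 - l) * PowerSeries.rescale p (eulerD F) := by
      conv_lhs => rw [hspec, eulerD_mul, eulerD_sub, eulerD_one, hDl, zero_sub, eulerD_rescale]
    have h2 : L * F = L * (1 - l) * PowerSeries.rescale p F := by
      conv_lhs => rw [hspec]
      ring
    rw [map_sub, map_mul]
    linear_combination h1 - h2 - PowerSeries.rescale p F * hL'
  have hY0 : PowerSeries.coeff 0 (eulerD F - L * F) = 0 := by
    rw [map_sub, coeff_eulerD, PowerSeries.coeff_mul]
    simp [hL, infProdLog]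
  rw [← sub_eq_zero]
  generalize eulerD F - L * F = Y at hY hY0 ⊢
  ext k
  induction k with
  | zero => rw [hY0, map_zero]
  | succ k ih =>
    have h1 := congrArg (PowerSeries.coeff (k + 1)) hY
    rw [sub_mul, one_mul, map_sub, PowerSeries.coeff_rescale, hl, mul_assoc,
      PowerSeries.coeff_C_mul, PowerSeries.coeff_succ_X_mul, PowerSeries.coeff_rescale, ih] at h1
    have h2 : (1 - p ^ (k + 1)) * PowerSeries.coeff (k + 1) Y = 0 := by
      rw [sub_mul, one_mul, sub_eq_zero]
      simpa using h1
    simpa [sub_ne_zero.mpr (hp k).symm] using h2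

theorem xi_pow (n r : ℕ) : xi n ^ r = (-1) ^ r * (q ^ r) ^ (-(2 * n : ℤ)) := by
  rw [xi, neg_pow, ← zpow_natCast (q ^ _), ← zpow_mul, ← zpow_natCast q, ← zpow_mul,
    mul_comm (r : ℤ)]

theorem xi_sq_pow_ne_one {n : ℕ} (hn : n ≠ 0) (j : ℕ) : (xi n ^ 2) ^ (j + 1) ≠ 1 := by
  rw [← pow_mul, xi_pow, pow_mul (-1 : Kq), neg_one_sq, one_pow, one_mul, ← zpow_natCast q,
    ← zpow_mul]
  exact q_zpow_ne_one (mul_ne_zero (by positivity) (by simpa using hn))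

/-- The logarithmic derivative of `f` at order `r`, in terms of `p = q^r`. -/
def fLog (n : ℕ) (p : Kq) (r : ℕ) : Kq :=
  (p ^ (-2 : ℤ) - 1) * (1 + (-1) ^ r * p ^ (2 - 2 * n : ℤ)) / (1 + (-1) ^ r * p ^ (-(2 * n : ℤ)))

/-- If ξ^r were -1 with r > 0, then ξ^2 would be a root of unity. -/
theorem one_add_xi_ne_zero {n r : ℕ} (hn : n ≠ 0) :
    (1 + (-1) ^ r * (q ^ r) ^ (-(2 * n : ℤ)) : Kq) ≠ 0 := by
  rcases Nat.eq_zero_or_pos r with rfl | hr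
  · simp
  · rw [← xi_pow]
    intro h
    have h1 : xi n ^ r = -1 := by linear_combination h
    apply xi_sq_pow_ne_one hn (r - 1)
    rw [Nat.sub_add_cancel hr, pow_right_comm, h1]; norm_num

theorem eulerD_fSer {n : ℕ} (hn : n ≠ 0) :
    eulerD (fSer n) = PowerSeries.mk (fun r => fLog n (q ^ r) r) * fSer n := by
  have hP := fun a => eulerD_infProd (xi n ^ 2) a (xi_sq_pow_ne_one hn)
  have hc := fun F G : Kq⟦X⟧ => Commute.all F G
  have h0 := infProd_zero (xi n ^ 2)
  have h1 := eulerD_div (eulerD_mul_of_eq (S := 0) (E := PowerSeries.C (xi n * q ^ (-2 : ℤ)))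
    (by rw [eulerD_C, zero_mul]) (eulerD_mul_of_eq (eulerD_mul_of_eq (eulerD_mul_of_eq (hP 1)
    (hP (q ^ (-2 : ℤ) * xi n)) (hc _ _)) (hP (q ^ 2 * xi n)) (hc _ _)) (hP (xi n ^ 2)) (hc _ _))
    (hc _ _)) (eulerD_mul_of_eq (eulerD_mul_of_eq
    (eulerD_mul_of_eq (hP (xi n)) (hP (xi n)) (hc _ _)) (hP (q ^ 2 * xi n ^ 2)) (hc _ _))
    (hP (q ^ (-2 : ℤ))) (hc _ _)) (by simp [h0])
  rw [fSer, sq (infProd _ _), h1]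
  congr 1
  ext r
  simp only [map_add, map_sub, map_zero, infProdLog, PowerSeries.coeff_mk]
  rcases Nat.eq_zero_or_pos r with rfl | hr
  · simp [fLog]
  · simp only [hr.ne', if_false, fLog]
    have hne := one_add_xi_ne_zero (r := r) hn
    have hx1 := xi_sq_pow_ne_one hn (r - 1)
    rw [Nat.sub_add_cancel hr, pow_right_comm] at hx1
    have hq : q ^ r ≠ 0 := pow_ne_zero _ q_ne_zero
    have e1 : (q ^ r) ^ (2 - 2 * n : ℤ) = (q ^ r) ^ 2 * (q ^ r) ^ (-(2 * n : ℤ)) := by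
      rw [sub_eq_add_neg, zpow_add₀ hq]; norm_cast
    rw [e1, mul_left_comm, ← xi_pow]
    rw [← xi_pow] at hne
    have e2 : (q ^ (-2 : ℤ)) ^ r = ((q ^ r) ^ 2)⁻¹ := by
      rw [zpow_neg, inv_pow]; norm_cast; rw [pow_right_comm]
    have e3 : (q ^ r) ^ (-2 : ℤ) = ((q ^ r) ^ 2)⁻¹ := by
      rw [zpow_neg]; norm_cast
    rw [e3]
    simp only [mul_pow, pow_right_comm _ 2 r, e2, one_pow]
    generalize xi n ^ r = x at *
    generalize q ^ r = p at *
    have h2 : (1 - x ^ 2) ≠ 0 := sub_ne_zero.mpr hx1.symm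
    have h3 : (1 - x) ≠ 0 := fun h => h2 (by linear_combination (1 + x) * h)
    -- All factors of f contribute with the denominator 1 - x^2, x = ξ^r. The total numerator
    -- vanishes at x = 1, so only 1 + x remains in `fLog`.
    have h4 : (1 : Kq) - x ^ 2 = (1 - x) * (1 + x) := by ring
    rw [h4]
    field_simp
    ring

/-- Oddness under p ↦ p⁻¹ is what the antisymmetry of commutators demands: reversing a commutator of
h^+ with h^- exchanges the two signs. -/
theorem fLog_inv {n : ℕ} {p : Kq} (hp : p ≠ 0) {r : ℕ}
    (h : (1 + (-1) ^ r * p ^ (-(2 * n : ℤ)) : Kq) ≠ 0) : fLog n p⁻¹ r = -fLog n p r := by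
  have hε : ((-1 : Kq) ^ r) * (-1) ^ r = 1 := by rw [← mul_pow]; simp
  rw [fLog, fLog]
  have e1 : p ^ (2 - 2 * n : ℤ) = p ^ 2 * p ^ (-(2 * n : ℤ)) := by
    rw [sub_eq_add_neg, zpow_add₀ hp]; norm_cast
  have e2 : p⁻¹ ^ (2 - 2 * n : ℤ) = (p ^ 2 * p ^ (-(2 * n : ℤ)))⁻¹ := by rw [inv_zpow, e1]
  have e3 : p⁻¹ ^ (-(2 * n : ℤ)) = (p ^ (-(2 * n : ℤ)))⁻¹ := by rw [inv_zpow]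
  have e4 : p⁻¹ ^ (-2 : ℤ) = p ^ 2 := by rw [inv_zpow, zpow_neg, inv_inv]; norm_cast
  have e5 : p ^ (-2 : ℤ) = (p ^ 2)⁻¹ := by rw [zpow_neg]; norm_cast
  rw [e1, e2, e3, e4, e5]
  have hx : p ^ (-(2 * n : ℤ)) ≠ 0 := zpow_ne_zero _ hp
  generalize p ^ (-(2 * n : ℤ)) = x at *
  generalize (-1 : Kq) ^ r = ε at *
  have h' : x + ε ≠ 0 := fun h1 => h (by linear_combination ε * h1 - hε)
  have hε' : ε ≠ 0 := left_ne_zero_of_mul_eq_one hε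
  have hd : 1 + ε * x⁻¹ ≠ 0 := by
    intro h1; apply h'; field_simp at h1; simpa using h1
  rw [div_eq_iff hd, eq_comm, neg_mul, neg_eq_iff_eq_neg, div_mul_eq_mul_div, div_eq_iff h]
  field_simp
  linear_combination (2 * p ^ 2 * x - p ^ 4 * x - x) * hε

/-! ### Structure constants of the Heisenberg generators -/

/-- The multiplicity of the node with label `j + 1`, for `ε = (-1)^r`. -/
def nodeMult (n : ℕ) (ε : Kq) (j : ℕ) : Kq := if j + 1 = n then 1 + ε else 1

/-- The coefficient of the logarithmic derivative of `g_{ij}` at order `r`, for `p = q^{∓r}` and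
`ε = (-1)^r`. -/
def gam (n : ℕ) (p ε : Kq) (i j : ℕ) : Kq :=
  nodeMult n ε j * ((if i = j then (p ^ 2)⁻¹ - 1 else 0) + (if i = j + 1 then p ^ 2 - 1 else 0)) +
    if j + 2 = n ∧ i = n then ε * (1 - p ^ 2) else 0

/-- The structure constants of the Heisenberg generators attached to `h_i`, `h_j`. -/
def pij (n : ℕ) (p : Kq) (r : ℕ) (i j : ℕ) : Kq :=
  fLog n p r - (if i < j then nodeMult n ((-1) ^ r) i * ((p ^ 2)⁻¹ - 1) else 0) +
    (if j < i then nodeMult n ((-1) ^ r) j * (p ^ 2 - 1) else 0)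

/-- This is the compatibility that makes the h's generate the Heisenberg part: up to sign, h_{j+1} /
h_j sees h_i with the constants with which the current X_j does. The exceptional summand of `gam` at
i = n, j = n - 2 is the jump of `nodeMult` between n - 2 and n - 1. -/
theorem pij_sub (n : ℕ) (p : Kq) (r : ℕ) (i j : ℕ) (hi : i ≤ n) (hj : j < n) :
    pij n p r i j - pij n p r i (j + 1) = gam n p ((-1) ^ r) i j := by
  rcases lt_trichotomy i j with h | h | h
  · simp [pij, gam, h, h.ne, show i < j + 1 by omega, show ¬ j < i by omega,
      show ¬ j + 1 < i by omega, show ¬ i = j + 1 by omega, show ¬ (j + 2 = n ∧ i = n) by omega]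
  · subst h
    simp [pij, gam, show ¬ (i + 2 = n ∧ i = n) by omega, show ¬ i + 1 < i by omega]
  · by_cases h' : i = j + 1
    · subst h'
      simp [pij, gam]
      omega
    · have h1 : j + 1 < i := by omega
      have h2 : j + 1 ≠ n := by omega
      simp only [pij, gam, if_neg (show ¬ i < j by omega), if_neg (show ¬ i < j + 1 by omega), if_pos h,
        if_pos h1, if_neg h', if_neg (show ¬ i = j by omega), nodeMult, if_neg h2]
      by_cases h3 : j + 2 = n
      · rw [if_pos (show j + 1 + 1 = n from h3), if_pos (by omega)]; ring
      · rw [if_neg (show ¬ j + 1 + 1 = n from h3), if_neg (by omega)]; ring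

/-- `fLog` is odd, and the two conditional terms of `pij` are interchanged. -/
theorem pij_inv {n : ℕ} {p : Kq} (hp : p ≠ 0) {r : ℕ}
    (h : (1 + (-1) ^ r * p ^ (-(2 * n : ℤ)) : Kq) ≠ 0) (i j : ℕ) :
    pij n p⁻¹ r j i = -pij n p r i j := by
  rw [pij, pij, fLog_inv hp h, inv_pow, inv_inv]
  split_ifs <;> ring

theorem neg_one_pow_cases (r : ℕ) : (Even r ∧ (-1 : Kq) ^ r = 1) ∨ (¬ Even r ∧ (-1 : Kq) ^ r = -1) := by
  rcases Nat.even_or_odd r with h | h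
  · exact Or.inl ⟨h, h.neg_one_pow⟩
  · exact Or.inr ⟨Nat.not_even_iff_odd.mpr h, h.neg_one_pow⟩

/-- The weights in the expansion of the Heisenberg generators of `h_1` in those of the nodes. -/
def weight (n : ℕ) (p ε : Kq) (k : ℕ) : Kq :=
  if k + 1 = n then (1 + ε) / 2 else p ^ (2 * n : ℤ) * p ^ (-(2 * (k + 1) : ℤ)) + ε

theorem sum_range_succ_eq_ite {M : Type*} [AddCommMonoid M] (n j : ℕ) (f : ℕ → M) :
    (∑ k ∈ Finset.range n, if k + 1 = j then f k else 0) =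
      if 1 ≤ j ∧ j ≤ n then f (j - 1) else 0 := by
  rcases j with - | j
  · simp
  · simp only [add_left_inj, Finset.sum_ite_eq', Finset.mem_range]
    simp

theorem sum_range_ite {M : Type*} [AddCommMonoid M] (n j : ℕ) (f : ℕ → M) :
    (∑ k ∈ Finset.range n, if k = j then f k else 0) = if j < n then f j else 0 := by
  simp

/-- The weights solve a linear system: up to a scalar, the weighted combination of node generators
acts on every current as h_1 does. The system is tridiagonal in k, and away from the ends it is a
recurrence solved by the constants and by p^{-2k}; `weight` is the combination of these that also
fits the rows near the last node. -/
theorem sum_weight_gam_left {n : ℕ} (hn : 2 ≤ n) {p ε : Kq} (hp : p ≠ 0) (hε : ε = 1 ∨ ε = -1)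
    {j : ℕ} (hj : j < n) :
    ∑ k ∈ Finset.range n, weight n p ε k * (gam n p ε (k + 1) j - gam n p ε k j) =
      -(p ^ (2 * n : ℤ) + ε) * gam n p ε 0 j := by
  have hx : ∀ k : ℕ, p ^ (-(2 * ((k + 1 : ℕ) + 1) : ℤ)) = p ^ (-(2 * (k + 1) : ℤ)) * (p ^ 2)⁻¹ :=
    fun k => by
      rw [← zpow_natCast p 2, ← zpow_neg, ← zpow_add₀ hp]; congr 1
  have hx0 : p ^ (-(2 * ((0 : ℕ) + 1) : ℤ)) = (p ^ 2)⁻¹ := by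
    rw [← zpow_natCast p 2, ← zpow_neg]; congr 1
  have hx1 : ∀ k : ℕ, k + 2 = n → p ^ (2 * n : ℤ) * p ^ (-(2 * (k + 1) : ℤ)) = p ^ 2 := fun k hk => by
    rw [← zpow_natCast p 2, ← zpow_add₀ hp]; congr 1; push_cast [← hk]; ring
  -- Isolate the few k that contribute, so that the sum collapses by indicator functions. The
  -- summand with k + 1 = n carries the exceptional part of `gam`.
  have hs : ∀ k ∈ Finset.range n, weight n p ε k * (gam n p ε (k + 1) j - gam n p ε k j) =
      (if k + 1 = j then weight n p ε k * (nodeMult n ε j * ((p ^ 2)⁻¹ - 1)) else 0) +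
      (if k = j then weight n p ε k * (nodeMult n ε j * (p ^ 2 - 1)) else 0) +
      (if k + 1 = n then weight n p ε k *
        (if j + 2 = n then ε * (1 - p ^ 2) else 0) else 0) -
      (if k = j then weight n p ε k * (nodeMult n ε j * ((p ^ 2)⁻¹ - 1)) else 0) -
      (if k = j + 1 then weight n p ε k * (nodeMult n ε j * (p ^ 2 - 1)) else 0) := fun k hk => by
    have hk' := Finset.mem_range.mp hk
    have hk'' : ¬ (j + 2 = n ∧ k = n) := by omega
    simp only [gam, add_left_inj, if_neg hk'', ite_and]
    by_cases h4 : j + 2 = n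
    · simp only [h4, if_true]
      split_ifs <;> ring
    · simp only [h4, if_false]
      split_ifs <;> ring
  rw [Finset.sum_congr rfl hs]
  simp only [Finset.sum_add_distrib, Finset.sum_sub_distrib, sum_range_succ_eq_ite, sum_range_ite]
  rw [if_pos hj, if_pos hj, if_pos (show 1 ≤ n ∧ n ≤ n by omega)]
  have hlast : weight n p ε (n - 1) = (1 + ε) / 2 := by rw [weight, if_pos (by omega)]
  rw [hlast]
  have hw : ∀ k, k + 1 < n → weight n p ε k = p ^ (2 * n : ℤ) * p ^ (-(2 * (k + 1) : ℤ)) + ε :=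
    fun k hk => by rw [weight, if_neg (by omega)]
  rcases j with - | j
  · rw [hw 0 (by omega), hx0]
    simp only [gam, nodeMult, if_neg (show ¬ 0 + 1 = n by omega), if_true,
      if_pos (show 0 + 1 < n by omega), if_neg (show ¬ (1 ≤ 0 ∧ 0 ≤ n) by omega),
      if_neg (show ¬ (0 + 2 = n ∧ 0 = n) by omega), if_neg (show ¬ 0 = 0 + 1 by omega)]
    by_cases h2 : 0 + 2 = n
    · have h3 := hx1 0 h2
      rw [hx0] at h3
      rw [if_pos h2, weight, if_pos (by omega)]
      have h5 : p ^ (2 * n : ℤ) = p ^ 2 * p ^ 2 := by field_simp at h3; linear_combination h3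
      rw [h5]
      rcases hε with rfl | rfl <;> field_simp <;> ring
    · rw [if_neg h2, hw (0 + 1) (by omega), hx, hx0]
      field_simp; ring
  · rw [if_pos (by omega), Nat.add_sub_cancel, hw j hj]
    have hg : gam n p ε 0 (j + 1) = 0 := by
      simp [gam, show ¬ (j + 1 + 2 = n ∧ 0 = n) by omega]
    rw [hg]
    by_cases h1 : j + 1 + 1 = n
    · rw [if_neg (show ¬ j + 1 + 1 < n by omega), if_neg (show ¬ j + 1 + 2 = n by omega), nodeMult,
        if_pos h1, weight, if_pos h1, hx1 j h1]
      rcases hε with rfl | rfl <;> field_simp <;> ring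
    · rw [if_pos (show j + 1 + 1 < n by omega), nodeMult, if_neg h1, hw (j + 1) (by omega), hx]
      by_cases h2 : j + 1 + 2 = n
      · rw [if_pos h2, weight, if_pos (by omega)]
        have h3 := hx1 (j + 1) h2
        rw [hx] at h3
        rw [← mul_assoc] at h3
        have h5 : p ^ (2 * n : ℤ) * p ^ (-(2 * (j + 1) : ℤ)) = p ^ 2 * p ^ 2 := by
          field_simp at h3; linear_combination h3
        simp only [← mul_assoc (p ^ (2 * n : ℤ))]
        rw [h5]
        rcases hε with rfl | rfl <;> field_simp <;> ring
      · rw [if_neg h2, hw (j + 1 + 1) (by omega), hx, hx]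
        field_simp; ring

/-- The companion identity for the second argument of the Heisenberg form. The weights are taken at
p⁻¹ because the opposite series h^{-s} carries the opposite power of q. Here, unlike in
`sum_weight_gam_left`, the value of f is involved. -/
theorem sum_weight_gam_right {n : ℕ} (hn : 2 ≤ n) {p : Kq} (hp : p ≠ 0) {r : ℕ}
    (h : (1 + (-1) ^ r * p ^ (-(2 * n : ℤ)) : Kq) ≠ 0) {i : ℕ} (hi : i ≤ n) :
    ∑ k ∈ Finset.range n, weight n p⁻¹ ((-1) ^ r) k * gam n p ((-1) ^ r) i k =
      (p⁻¹ ^ (2 * n : ℤ) + (-1) ^ r) * pij n p r i 0 := by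
  have hx : ∀ k : ℕ, p⁻¹ ^ (-(2 * ((k + 1 : ℕ) + 1) : ℤ)) = p⁻¹ ^ (-(2 * (k + 1) : ℤ)) * p ^ 2 :=
    fun k => by
      rw [inv_zpow', inv_zpow', ← zpow_natCast p 2, ← zpow_add₀ hp]; congr 1
  have hx0 : p⁻¹ ^ (-(2 * ((0 : ℕ) + 1) : ℤ)) = p ^ 2 := by
    rw [inv_zpow', ← zpow_natCast p 2]; congr 1
  have hx1 : ∀ k : ℕ, k + 2 = n → p⁻¹ ^ (2 * n : ℤ) * p⁻¹ ^ (-(2 * (k + 1) : ℤ)) = (p ^ 2)⁻¹ :=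
    fun k hk => by
      rw [inv_zpow', inv_zpow', ← zpow_natCast p 2, ← zpow_neg, ← zpow_add₀ hp]; congr 1
      push_cast [← hk]; ring
  have hV : p⁻¹ ^ (2 * n : ℤ) = p ^ (-(2 * n : ℤ)) := inv_zpow' p _
  have hε : ((-1 : Kq) ^ r) * (-1) ^ r = 1 := by rw [← mul_pow]; simp
  -- The factor p^{-2n} + (-1)^r is (-1)^r times the denominator of `fLog`.
  have hF : (p ^ (-(2 * n : ℤ)) + (-1) ^ r) * fLog n p r =
      ((p ^ 2)⁻¹ - 1) * ((-1) ^ r + p ^ 2 * p ^ (-(2 * n : ℤ))) := by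
    have e1 : p ^ (2 - 2 * n : ℤ) = p ^ 2 * p ^ (-(2 * n : ℤ)) := by
      rw [sub_eq_add_neg, zpow_add₀ hp]; norm_cast
    have e5 : p ^ (-2 : ℤ) = (p ^ 2)⁻¹ := by rw [zpow_neg]; norm_cast
    rw [fLog, e1, e5, mul_div_assoc', div_eq_iff h]
    linear_combination (1 - (p ^ 2)⁻¹) * (p ^ (-(2 * n : ℤ)) - p ^ 2 * p ^ (-(2 * n : ℤ))) * hε
  have hs : ∀ k ∈ Finset.range n, weight n p⁻¹ ((-1) ^ r) k * gam n p ((-1) ^ r) i k =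
      (if k = i then weight n p⁻¹ ((-1) ^ r) k *
        (nodeMult n ((-1) ^ r) k * ((p ^ 2)⁻¹ - 1)) else 0) +
      (if k + 1 = i then weight n p⁻¹ ((-1) ^ r) k *
        (nodeMult n ((-1) ^ r) k * (p ^ 2 - 1)) else 0) +
      (if k + 1 = n - 1 then weight n p⁻¹ ((-1) ^ r) k *
        (if i = n then (-1) ^ r * (1 - p ^ 2) else 0) else 0) := fun k hk => by
    simp only [gam, eq_comm (a := i), show (k + 2 = n ∧ n = i) ↔ (k + 1 = n - 1 ∧ n = i) by
      constructor <;> omega, ite_and]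
    split_ifs <;> ring
  rw [Finset.sum_congr rfl hs]
  simp only [Finset.sum_add_distrib, sum_range_succ_eq_ite, sum_range_ite]
  rw [if_pos (show 1 ≤ n - 1 ∧ n - 1 ≤ n by omega), hV]
  have hw : ∀ k, k + 1 < n → weight n p⁻¹ ((-1) ^ r) k =
      p ^ (-(2 * n : ℤ)) * p⁻¹ ^ (-(2 * (k + 1) : ℤ)) + (-1) ^ r :=
    fun k hk => by rw [weight, if_neg (by omega), hV]
  rw [hV] at hx1
  have hn1 : n - 1 - 1 + 2 = n := by omega
  have hP0 : pij n p r i 0 = fLog n p r + if 0 < i then p ^ 2 - 1 else 0 := by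
    simp [pij, nodeMult, show ¬ 1 = n by omega]
  rw [hP0, mul_add, hF]
  rcases i with - | i
  · rw [if_pos (show 0 < n by omega), if_neg (show ¬ (1 ≤ 0 ∧ 0 ≤ n) by omega),
      if_neg (show ¬ 0 = n by omega), hw 0 (by omega), hx0, nodeMult,
      if_neg (by omega)]
    simp
    ring
  · rw [if_pos (show 1 ≤ i + 1 ∧ i + 1 ≤ n by omega), Nat.add_sub_cancel, if_pos (show 0 < i + 1 by omega)]
    by_cases h1 : i + 1 = n
    · rw [if_neg (show ¬ i + 1 < n by omega), if_pos h1, weight, if_pos h1, nodeMult, if_pos h1, hw (n - 1 - 1) (by omega),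
        hx1 _ hn1]
      have e : (1 + (-1 : Kq) ^ r) / 2 * ((1 + (-1) ^ r)) = 1 + (-1) ^ r := by
        linear_combination hε / 2
      rcases neg_one_pow_cases r with ⟨-, h2⟩ | ⟨-, h2⟩ <;> rw [h2] <;> field_simp <;> ring
    · rw [if_pos (show i + 1 < n by omega), if_neg h1, hw i (by omega), mul_zero, add_zero]
      by_cases h2 : i + 2 = n
      · rw [weight, if_pos (by omega), nodeMult, if_pos (by omega), nodeMult, if_neg (by omega),
          hx1 _ h2]
        rcases neg_one_pow_cases r with ⟨-, h2⟩ | ⟨-, h2⟩ <;> rw [h2] <;> field_simp <;> ring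
      · rw [hw (i + 1) (by omega), hx, nodeMult, if_neg (by omega), nodeMult, if_neg (by omega)]
        field_simp; ring

/-! ### Logarithmic derivatives and constant terms of g_{ij} -/

/-- `q^{∓r}`. -/
def qr (s : ℤˣ) (r : ℕ) : Kq := q ^ (-((s : ℤ) * r))

theorem qr_ne_zero (s : ℤˣ) (r : ℕ) : qr s r ≠ 0 := zpow_ne_zero _ q_ne_zero

theorem qr_neg (s : ℤˣ) (r : ℕ) : qr (-s) r = (qr s r)⁻¹ := by
  rw [qr, qr, ← zpow_neg]; congr 1; push_cast; ring

theorem one_add_qr_ne_zero {n : ℕ} (hn : n ≠ 0) (s : ℤˣ) (r : ℕ) :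
    (1 + (-1) ^ r * (qr s r) ^ (-(2 * n : ℤ)) : Kq) ≠ 0 := by
  have h := one_add_xi_ne_zero (r := r) hn
  have h' : (q ^ r : Kq) = qr (-1) r := by
    rw [qr, ← zpow_natCast]; congr 1; simp
  rw [h'] at h
  rcases Int.units_eq_one_or s with rfl | rfl
  · rw [qr_neg, inv_zpow, ] at h
    intro h1
    apply h
    have hε : ((-1 : Kq) ^ r) * (-1) ^ r = 1 := by rw [← mul_pow]; simp
    have hx : (qr 1 r) ^ (-(2 * n : ℤ)) ≠ 0 := zpow_ne_zero _ (qr_ne_zero _ _)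
    field_simp
    linear_combination (-1) ^ r * h1 - (qr 1 r) ^ (-(2 * n : ℤ)) * hε
  · exact h

theorem xi_denom_ne_zero {n : ℕ} (hn : n ≠ 0) (s : ℤˣ) (r : ℕ) :
    (qr s r) ^ (2 * n : ℤ) + (-1) ^ r ≠ 0 := by
  have h := one_add_qr_ne_zero hn s r
  rw [zpow_neg] at h
  have hx : (qr s r) ^ (2 * n : ℤ) ≠ 0 := zpow_ne_zero _ (qr_ne_zero _ _)
  intro h1
  apply h
  field_simp
  simpa using h1

theorem qr_sq_inv (s : ℤˣ) (r : ℕ) : (qr s r ^ 2)⁻¹ = q ^ (2 * (s : ℤ) * r) := by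
  rw [qr, ← zpow_natCast, ← zpow_mul, ← zpow_neg]; congr 1; push_cast; ring

theorem qr_sq (s : ℤˣ) (r : ℕ) : qr s r ^ 2 = q ^ (-(2 * (s : ℤ) * r)) := by
  rw [qr, ← zpow_natCast, ← zpow_mul]; congr 1; push_cast; ring

/-- The logarithmic derivative of `g_{ij}`. -/
def gLog {n : ℕ} (s : ℤˣ) (i : Fin (n + 1)) (j : Fin n) : Kq⟦X⟧ :=
  PowerSeries.mk fun r => gam n (qr s r) ((-1) ^ r) i j

theorem coeff_ratLog_one (s : ℤˣ) (e : ℤ) (r : ℕ) :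
    PowerSeries.coeff r (ratLog s 1 e) = q ^ (2 * e * s * r) - 1 := by
  simp [ratLog]

theorem coeff_ratLog_two (s : ℤˣ) (e : ℤ) (r : ℕ) :
    PowerSeries.coeff r (ratLog s 2 (2 * e)) =
      (1 + (-1) ^ r) * (q ^ (2 * e * s * r) - 1) := by
  rw [ratLog, PowerSeries.coeff_mk]
  split_ifs with h
  · obtain ⟨t, rfl⟩ := h
    have h1 : (2 * (2 * e) * s * ((2 * t / 2 : ℕ) : ℤ)) = 2 * e * s * ((2 * t : ℕ) : ℤ) := by
      rw [Nat.mul_div_cancel_left _ (by norm_num)]; push_cast; ring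
    rw [h1, pow_mul, neg_one_sq, one_pow]; norm_num
  · rw [(Nat.not_even_iff_odd.mp fun h' => h h'.two_dvd).neg_one_pow]; ring

/-- A case check along the definition of g. For j = n the function depends on x^2, so odd orders
vanish; this is the factor 1 + (-1)^r of `nodeMult`. The pole at x = -1 of g_{n+1,n-1} gives the
exceptional term with (-1)^r. -/
theorem eulerD_gSer {n : ℕ} (s : ℤˣ) (i : Fin (n + 1)) (j : Fin n) :
    eulerD (Ext.gSer s i j) = gLog s i j * Ext.gSer s i j := by
  have hj := j.isLt
  by_cases hi : i.val < n
  · rw [Ext.gSer, dif_pos hi, eulerD_ratExp_q s (d j) (by rw [d]; split_ifs <;> norm_num)]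
    congr 1
    ext r
    have h3 : ¬ (j.val + 2 = n ∧ i.val = n) := by omega
    rw [gLog, PowerSeries.coeff_mk, gam, if_neg h3, add_zero, qr_sq_inv, qr_sq, epsRoot, nodeMult]
    simp only [Fin.ext_iff]
    by_cases hl : j.val + 1 = n
    · have h4 : ¬ i.val = j.val + 1 := by omega
      simp only [d, IsLast, hl, if_true, if_neg (show ¬ i.val = n by omega)]
      split_ifs
      · have := coeff_ratLog_two s 1 r
        simp only [mul_one] at this
        rw [Nat.cast_ofNat, this]; ring
      · have := coeff_ratLog_two s 0 r
        simp only [mul_zero, zero_mul, zpow_zero, sub_self] at this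
        rw [this]; ring
    · simp only [d, IsLast, hl, if_false]
      rw [coeff_ratLog_one]
      split_ifs
      · omega
      · simp
      · simp
      · simp
  · have hi' : i.val = n := by omega
    by_cases hl : j.val + 1 = n
    · have h1 : Ext.gSer s i j = ratExp s 2 1 (-1) (q ^ (-2 : ℤ)) (-q ^ (-(-2) : ℤ)) := by
        rw [Ext.gSer, dif_neg hi, if_pos hl]; norm_cast
      rw [h1, eulerD_ratExp_q s 2 two_ne_zero]
      congr 1
      ext r
      have := coeff_ratLog_two s (-1) r
      simp only [mul_neg, mul_one] at this
      rw [this]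
      simp [gLog, gam, nodeMult, hl, hi', qr_sq, show ¬ n = j.val by omega,
        show ¬ j.val + 2 = n by omega]
    · by_cases hl2 : j.val + 2 = n
      · rw [Ext.gSer, dif_neg hi, if_neg hl, if_pos hl2, eulerD_ratExp s 1 one_ne_zero _ _ _ _
          (inv_ne_zero q_ne_zero) q_ne_zero one_ne_zero one_ne_zero]
        congr 1
        ext r
        have h1 : (-q⁻¹ / q : Kq) = (-1) * q ^ (-2 : ℤ) := by
          rw [zpow_neg, show ((2 : ℤ)) = ((2 : ℕ) : ℤ) from rfl, zpow_natCast]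
          field_simp [q_ne_zero]
        have h2 : ((-1 : Kq) / 1) = -1 := div_one _
        have h5 : ((-1 : Kq) ^ (s : ℤ)) = -1 := by
          rcases Int.units_eq_one_or s with rfl | rfl
          · exact zpow_one _
          · rw [Units.val_neg, Units.val_one, zpow_neg_one]; norm_num
        rw [h1, h2, mul_zpow, h5, map_sub, linLog, linLog, gLog, PowerSeries.coeff_mk,
          PowerSeries.coeff_mk, PowerSeries.coeff_mk, gam,
          if_pos (show j.val + 2 = n ∧ i.val = n from ⟨hl2, hi'⟩), hi',
          if_neg (show ¬ n = j.val by omega), if_neg (show ¬ n = j.val + 1 by omega), qr_sq,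
          mul_pow, ← zpow_mul, ← zpow_natCast (q ^ _), ← zpow_mul, Nat.div_one]
        rcases Nat.eq_zero_or_pos r with rfl | hr
        · simp
        · rw [if_pos ⟨one_dvd _, hr.ne'⟩, if_pos ⟨one_dvd _, hr.ne'⟩]
          rw [show (-2 * (s : ℤ) * (r : ℤ)) = -(2 * (s : ℤ) * r) by ring]
          push_cast; ring
      · rw [Ext.gSer, dif_neg hi, if_neg hl, if_neg hl2, eulerD_one]
        have : gLog s i j = 0 := by
          ext r
          rw [gLog, PowerSeries.coeff_mk, gam, if_neg (by omega), if_neg (by omega),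
            if_neg (by omega)]
          simp
        rw [this, zero_mul]

/-- `(ε_i, α_j)`, where `ε_{n+1} = -ε_n`. -/
def epsRoot' {n : ℕ} (i : Fin (n + 1)) (j : Fin n) : ℤ :=
  (if i.val = j.val then (d j : ℤ) else 0) - (if i.val = j.val + 1 then (d j : ℤ) else 0) +
    if j.val + 2 = n ∧ i.val = n then 1 else 0

theorem coeff_zero_gSer {n : ℕ} (s : ℤˣ) (i : Fin (n + 1)) (j : Fin n) :
    PowerSeries.coeff 0 (Ext.gSer s i j) = q ^ ((s : ℤ) * epsRoot' i j) := by
  have hj := j.isLt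
  by_cases hi : i.val < n
  · rw [Ext.gSer, dif_pos hi, coeff_zero_ratExp_q s (d j) (by rw [d]; split_ifs <;> norm_num)]
    congr 2
    rw [epsRoot, epsRoot', if_neg (show ¬ (j.val + 2 = n ∧ i.val = n) by omega)]
    simp only [Fin.ext_iff, d, IsLast]
    split_ifs <;> omega
  · have hi' : i.val = n := by omega
    by_cases hl : j.val + 1 = n
    · have h1 : Ext.gSer s i j = ratExp s 2 1 (-1) (q ^ (-2 : ℤ)) (-q ^ (-(-2) : ℤ)) := by
        rw [Ext.gSer, dif_neg hi, if_pos hl]; norm_cast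
      rw [h1, coeff_zero_ratExp_q s 2 two_ne_zero]
      congr 2
      simp [epsRoot', hi', hl, d, show ¬ n = j.val by omega, show ¬ j.val + 2 = n by omega]
    · by_cases hl2 : j.val + 2 = n
      · rw [Ext.gSer, dif_neg hi, if_neg hl, if_pos hl2, coeff_zero_ratExp s 1 one_ne_zero, epsRoot',
          if_neg (show ¬ i.val = j.val by omega), if_neg (show ¬ i.val = j.val + 1 by omega),
          if_pos (show j.val + 2 = n ∧ i.val = n from ⟨hl2, hi'⟩)]
        rcases Int.units_eq_one_or s with rfl | rfl
        · simp
        · have h1 : ((-1 : ℤˣ) = 1) = False := by decide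
          simp [h1]
      · rw [Ext.gSer, dif_neg hi, if_neg hl, if_neg hl2, epsRoot', if_neg (by omega),
          if_neg (by omega), if_neg (by omega)]
        simp

/-! ### Comparison with the root data and Drinfeld's structure constants -/

theorem qi_ne_zero {n : ℕ} (i : Fin n) : qi i ≠ 0 := pow_ne_zero _ q_ne_zero

theorem qi_sub_ne_zero {n : ℕ} (i : Fin n) : qi i - (qi i)⁻¹ ≠ 0 := by
  intro h
  have h1 : qi i * qi i = 1 := by
    have := sub_eq_zero.mp h
    nth_rewrite 2 [this]
    exact mul_inv_cancel₀ (qi_ne_zero i)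
  rw [qi, ← pow_add] at h1
  refine q_pow_ne_one ?_ h1
  rw [d]; split_ifs <;> norm_num

theorem qi_zpow {n : ℕ} (i : Fin n) (k : ℤ) : qi i ^ k = q ^ ((d i : ℤ) * k) := by
  rw [qi, ← zpow_natCast, ← zpow_mul]

theorem form_comm {n : ℕ} (i j : Fin n) : form i j = form j i := by
  simp only [form, cartan, d, IsLast, Fin.ext_iff]
  split_ifs <;> omega

theorem epsRoot'_sub {n : ℕ} (i j : Fin n) (hi : ¬ IsLast i) :
    epsRoot' i.castSucc j - epsRoot' i.succ j = form i j := by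
  simp only [epsRoot', form, cartan, d, IsLast, Fin.ext_iff, Fin.val_castSucc, Fin.val_succ] at *
  split_ifs <;> omega

/-- Since α_n = 2 ε_n, a square root of k_n can scale the currents by integral powers of q. -/
theorem two_epsRoot' {n : ℕ} (i j : Fin n) (hi : IsLast i) :
    2 * epsRoot' i.castSucc j = form i j := by
  simp only [epsRoot', form, cartan, d, IsLast, Fin.ext_iff, Fin.val_castSucc] at *
  split_ifs <;> omega

theorem epsRoot'_last {n : ℕ} (i j : Fin n) (hi : IsLast i) :
    epsRoot' i.succ j = -epsRoot' i.castSucc j := by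
  simp only [epsRoot', d, IsLast, Fin.val_castSucc, Fin.val_succ] at *
  split_ifs <;> omega

theorem units_cast_mul_self (s : ℤˣ) : ((s : ℤ) : Kq) * (s : ℤ) = 1 := by
  rcases Int.units_eq_one_or s with rfl | rfl <;> simp

theorem d_pos {n : ℕ} (i : Fin n) : 0 < d i := by rw [d]; split_ifs <;> norm_num

theorem heis_mul {n : ℕ} (s : ℤˣ) (i j : Fin n) (t : ℕ) (ht : t ≠ 0) :
    (-((s : ℤ) : Kq)) * (qi i - (qi i)⁻¹) * ((dd i j * t : ℕ) : Kq) *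
        Dr.heis i j (-((s : ℤ) * (dd i j * t : ℕ))) =
      dd i j * (q ^ (-((s : ℤ) * t) * form i j) - q ^ (-(-((s : ℤ) * t)) * form i j)) := by
  have hd : (dd i j : ℤ) ≠ 0 := by
    have := d_pos i
    have : d i ≤ dd i j := le_max_left _ _
    omega
  have h1 : (dd i j : ℤ) ∣ -((s : ℤ) * (dd i j * t : ℕ)) :=
    ⟨-((s : ℤ) * t), by push_cast; ring⟩
  have h2 : -((s : ℤ) * (dd i j * t : ℕ)) * cartan i j / dd i j = -((s : ℤ) * t) * cartan i j := by
    rw [show -((s : ℤ) * (dd i j * t : ℕ)) * cartan i j =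
      (-((s : ℤ) * t) * cartan i j) * dd i j by push_cast; ring]
    exact Int.mul_ediv_cancel _ hd
  have h3 : ∀ k, qi i ^ (k * cartan i j) = q ^ (k * form i j) := fun k => by
    rw [qi_zpow, form]; congr 1; ring
  rw [Dr.heis, if_pos h1, h2, qnum, h3, ← neg_mul (-((s : ℤ) * t)), h3]
  have h4 : ((-((s : ℤ) * (dd i j * t : ℕ)) : ℤ) : Kq) = -((s : ℤ) : Kq) * ((dd i j * t : ℕ) : Kq) := by
    push_cast; ring
  rw [h4]
  have h5 := qi_sub_ne_zero i
  have h6 : ((s : ℤ) : Kq) ≠ 0 := left_ne_zero_of_mul_eq_one (units_cast_mul_self s)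
  have h7 : ((dd i j * t : ℕ) : Kq) ≠ 0 := by
    have : dd i j ≠ 0 := by exact_mod_cast hd
    exact Nat.cast_ne_zero.mpr (mul_ne_zero this ht)
  generalize qi i - (qi i)⁻¹ = w at h5 ⊢
  field_simp

theorem gam_sub_eq_zero {n : ℕ} {p ε : Kq} {i j : Fin n} (h1 : i.val ≠ j.val) (h2 : i.val + 1 ≠ j.val)
    (h3 : i.val ≠ j.val + 1) : gam n p ε (i + 1) j - gam n p ε i j = 0 := by
  rw [gam, gam, if_neg h2, if_neg (by omega), if_neg (by omega), if_neg h1, if_neg h3,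
    if_neg (by omega)]
  ring

theorem gam_sub_diag {n : ℕ} (p ε : Kq) {i : ℕ} (_ : i < n) :
    gam n p ε (i + 1) i - gam n p ε i i = nodeMult n ε i * (p ^ 2 - (p ^ 2)⁻¹) := by
  rw [gam, gam, if_neg (show ¬ i + 1 = i by omega), if_pos rfl,
    if_neg (show ¬ (i + 2 = n ∧ i + 1 = n) by omega), if_pos rfl,
    if_neg (show ¬ i = i + 1 by omega), if_neg (show ¬ (i + 2 = n ∧ i = n) by omega)]
  ring

theorem gam_sub_up {n : ℕ} (p ε : Kq) {i : ℕ} (_ : i + 1 < n) :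
    gam n p ε (i + 1) (i + 1) - gam n p ε i (i + 1) = nodeMult n ε (i + 1) * ((p ^ 2)⁻¹ - 1) := by
  rw [gam, gam, if_pos rfl, if_neg (show ¬ i + 1 = i + 1 + 1 by omega),
    if_neg (show ¬ (i + 1 + 2 = n ∧ i + 1 = n) by omega), if_neg (show ¬ i = i + 1 by omega),
    if_neg (show ¬ i = i + 1 + 1 by omega), if_neg (show ¬ (i + 1 + 2 = n ∧ i = n) by omega)]
  ring

/-- When j + 1 is the last node, the exceptional summand of `gam` completes 1 to 1 + ε. This is
needed because Drinfeld's constants between the last node and its neighbour vanish at odd order. -/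
theorem gam_sub_down {n : ℕ} (p ε : Kq) {j : ℕ} (hj : j + 1 < n) :
    gam n p ε (j + 1 + 1) j - gam n p ε (j + 1) j =
      (1 - p ^ 2) * if j + 2 = n then 1 + ε else 1 := by
  rw [gam, gam, if_neg (show ¬ j + 1 + 1 = j by omega), if_neg (show ¬ j + 1 + 1 = j + 1 by omega),
    if_neg (show ¬ j + 1 = j by omega), if_pos (show j + 1 = j + 1 from rfl),
    if_neg (show ¬ (j + 2 = n ∧ j + 1 = n) by omega), nodeMult, if_neg (show ¬ j + 1 = n by omega)]
  by_cases h : j + 2 = n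
  · rw [if_pos ⟨h, h⟩, if_pos h]; ring
  · rw [if_neg (fun h' => h h'.1), if_neg h]; ring

theorem node_cases {n : ℕ} (i j : Fin n) :
    (i.val = j.val ∧ j.val + 1 = n ∧ form i j = 4 ∧ dd i j = 2) ∨
    (i.val = j.val ∧ j.val + 1 ≠ n ∧ form i j = 2 ∧ dd i j = 1) ∨
    (i.val + 1 = j.val ∧ j.val + 1 = n ∧ form i j = -2 ∧ dd i j = 2) ∨
    (i.val + 1 = j.val ∧ j.val + 1 ≠ n ∧ form i j = -1 ∧ dd i j = 1) ∨
    (i.val = j.val + 1 ∧ i.val + 1 = n ∧ form i j = -2 ∧ dd i j = 2) ∨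
    (i.val = j.val + 1 ∧ i.val + 1 ≠ n ∧ form i j = -1 ∧ dd i j = 1) ∨
    (i.val ≠ j.val ∧ i.val + 1 ≠ j.val ∧ i.val ≠ j.val + 1 ∧ form i j = 0) := by
  have hi := i.isLt
  have hj := j.isLt
  simp only [form, cartan, dd, d, IsLast, Fin.ext_iff]
  by_cases h1 : i.val = j.val
  · by_cases h2 : j.val + 1 = n <;> simp [h1, h2]
  · have h6 : ¬ i.val = n := hi.ne
    have h7 : ¬ j.val = n := hj.ne
    by_cases h3 : i.val + 1 = j.val
    · by_cases h2 : j.val + 1 = n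
      · simp [h1, h2, h3, h7]
      · simp [h1, h2, h3, h7]
    · by_cases h4 : i.val = j.val + 1
      · by_cases h2 : i.val + 1 = n
        · simp [h1, h2, h4.symm, h6, Ne.symm h7]
        · simp [h1, h2, h3, h4.symm, h6]
      · simp [h1, h3, h4, Ne.symm h4]

/-- The relation between the structure constants of the Drinfeld generators `a_{i,r}` and those of
the generators attached to `h_i`. -/
theorem heis_eq {n : ℕ} (s : ℤˣ) (i j : Fin n) {r : ℕ} (hr : r ≠ 0) :
    (-((s : ℤ) : Kq)) * (qi i - (qi i)⁻¹) * (r : Kq) * Dr.heis i j (-((s : ℤ) * r)) =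
      qr s r ^ ((j : ℤ) - i) *
        (gam n (qr s r) ((-1) ^ r) (i + 1) j - gam n (qr s r) ((-1) ^ r) i j) := by
  have hi := i.isLt
  have hj := j.isLt
  by_cases hd : dd i j ∣ r
  · obtain ⟨t, rfl⟩ := hd
    have ht : t ≠ 0 := right_ne_zero_of_mul hr
    rw [heis_mul s i j t ht]
    have hu : q ^ (-((s : ℤ) * t)) ≠ 0 := zpow_ne_zero _ q_ne_zero
    have hp : qr s (dd i j * t) = (q ^ (-((s : ℤ) * t))) ^ (dd i j) := by
      rw [qr, ← zpow_natCast, ← zpow_mul]; congr 1; push_cast; ring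
    rw [hp, zpow_mul q, zpow_mul q, zpow_neg q (-((s : ℤ) * t)), inv_zpow]
    generalize q ^ (-((s : ℤ) * t)) = u at hu ⊢
    rcases node_cases i j with ⟨h, hl, hf, hd⟩ | ⟨h, hl, hf, hd⟩ | ⟨h, hl, hf, hd⟩ | ⟨h, hl, hf, hd⟩ |
      ⟨h, hl, hf, hd⟩ | ⟨h, hl, hf, hd⟩ | ⟨h1, h2, h3, hf⟩
    · have e : ((j : ℕ) : ℤ) - (i : ℕ) = 0 := by omega
      rw [hf, hd, e, h, gam_sub_diag _ _ hj, nodeMult, if_pos hl, pow_mul, neg_one_sq, one_pow]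
      field_simp; norm_num; ring
    · have e : ((j : ℕ) : ℤ) - (i : ℕ) = 0 := by omega
      rw [hf, hd, e, h, gam_sub_diag _ _ hj, nodeMult, if_neg hl]
      field_simp; norm_num
    · have e : ((j : ℕ) : ℤ) - (i : ℕ) = 1 := by omega
      rw [hf, hd, e, ← h, gam_sub_up _ _ (by omega), nodeMult, if_pos (by omega), pow_mul, neg_one_sq,
        one_pow]
      field_simp; norm_num; ring
    · have e : ((j : ℕ) : ℤ) - (i : ℕ) = 1 := by omega
      rw [hf, hd, e, ← h, gam_sub_up _ _ (by omega), nodeMult, if_neg (by omega)]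
      field_simp; norm_num
    · have e : ((j : ℕ) : ℤ) - (i : ℕ) = -1 := by omega
      rw [hf, hd, e, h, gam_sub_down _ _ (by omega), if_pos (by omega), pow_mul, neg_one_sq, one_pow]
      field_simp; norm_num; ring
    · have e : ((j : ℕ) : ℤ) - (i : ℕ) = -1 := by omega
      rw [hf, hd, e, h, gam_sub_down _ _ (by omega), if_neg (by omega)]
      field_simp; norm_num
    · rw [hf, gam_sub_eq_zero h1 h2 h3]
      simp
  · have hz : Dr.heis i j (-((s : ℤ) * r)) = 0 := by
      rw [Dr.heis, if_neg]
      intro h1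
      apply hd
      rcases Int.units_eq_one_or s with rfl | rfl
      · simpa [Int.natCast_dvd_natCast] using h1
      · simpa [Int.natCast_dvd_natCast] using h1
    -- When d_{ij} = 2 does not divide r, the order r is odd and the factor 1 + (-1)^r annihilates
    -- the right-hand side as well.
    have ho : dd i j = 2 → (-1 : Kq) ^ r = -1 := fun h2 => by
      rw [h2] at hd
      exact (Nat.not_even_iff_odd.mp fun h' => hd h'.two_dvd).neg_one_pow
    rw [hz, mul_zero]
    rcases node_cases i j with ⟨h, hl, hf, h4⟩ | ⟨h, hl, hf, h4⟩ | ⟨h, hl, hf, h4⟩ | ⟨h, hl, hf, h4⟩ |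
      ⟨h, hl, hf, h4⟩ | ⟨h, hl, hf, h4⟩ | ⟨h1, h2, h3, hf⟩
    · rw [ho h4, h, gam_sub_diag _ _ hj, nodeMult, if_pos hl]; ring
    · exact absurd (h4 ▸ one_dvd r) hd
    · rw [ho h4, ← h, gam_sub_up _ _ (by omega), nodeMult, if_pos (by omega)]; ring
    · exact absurd (h4 ▸ one_dvd r) hd
    · rw [ho h4, h, gam_sub_down _ _ (by omega), if_pos (by omega)]; ring
    · exact absurd (h4 ▸ one_dvd r) hd
    · rw [gam_sub_eq_zero h1 h2 h3, mul_zero]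

/-! ### Functoriality of the series constructions -/

section Maps

variable {A B : Type*} [Ring A] [Ring B]

theorem map_crossCoeff (F : A →+* B) (S G H : A⟦X⟧) (a b : ℕ) :
    F (crossCoeff S G H a b) =
      crossCoeff (PowerSeries.map F S) (PowerSeries.map F G) (PowerSeries.map F H) a b := by
  simp [crossCoeff]

theorem map_crossCoeff' (F : A →+* B) (S G H : A⟦X⟧) (a b : ℕ) :
    F (crossCoeff' S G H a b) =
      crossCoeff' (PowerSeries.map F S) (PowerSeries.map F G) (PowerSeries.map F H) a b := by
  simp [crossCoeff']

theorem map_zpw (F : A →+* B) (g g' : A) (z : ℤ) : F (zpw g g' z) = zpw (F g) (F g') z := by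
  rw [zpw, zpw]; split_ifs <;> simp

theorem map_invCoeff (F : A →+* B) (c : A) (f : ℕ → A) (m : ℕ) :
    F (invCoeff c f m) = invCoeff (F c) (fun m => F (f m)) m := by
  induction m using Nat.strong_induction_on with
  | _ m ih =>
    rcases m with - | m
    · rw [invCoeff, invCoeff]
    · rw [invCoeff, invCoeff, map_neg, map_mul, map_sum]
      congr 2
      refine Finset.sum_congr rfl fun k _ => ?_
      rw [map_mul, ih _ (by omega)]

theorem map_invSeries (F : A →+* B) (c : A) (S : A⟦X⟧) :
    PowerSeries.map F (invSeries c S) = invSeries (F c) (PowerSeries.map F S) := by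
  ext m
  simp [invSeries, map_invCoeff]

theorem zpw_units (u : Aˣ) (z : ℤ) : zpw (u : A) (↑u⁻¹) z = ((u ^ z : Aˣ) : A) := by
  rw [zpw]
  split_ifs with h
  · lift z to ℕ using h
    simp
  · obtain ⟨m, rfl⟩ : ∃ m : ℕ, z = -m := ⟨(-z).toNat, by omega⟩
    simp

end Maps

section Scaled

variable {A B : Type*} [Ring A] [Algebra Kq A] [Ring B] [Algebra Kq B]

@[simp] theorem coeff_scaled (T : Kq⟦X⟧) (c : A) (k : ℕ) :
    PowerSeries.coeff k (scaled T c) = PowerSeries.coeff k T • c ^ k := by simp [scaled]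

theorem eulerD_scaled (T : Kq⟦X⟧) (c : A) : eulerD (scaled T c) = scaled (eulerD T) c := by
  ext m
  simp only [coeff_eulerD, coeff_scaled, smul_assoc]

theorem scaled_mul (T T' : Kq⟦X⟧) (c : A) : scaled (T * T') c = scaled T c * scaled T' c := by
  ext m
  rw [coeff_scaled, PowerSeries.coeff_mul, PowerSeries.coeff_mul, Finset.sum_smul]
  refine Finset.sum_congr rfl fun p hp => ?_
  rw [coeff_scaled, coeff_scaled, smul_mul_smul_comm, ← pow_add,
    Finset.HasAntidiagonal.mem_antidiagonal.mp hp]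

theorem scaled_one (c : A) : scaled 1 c = 1 := by
  ext m
  rw [coeff_scaled, PowerSeries.coeff_one, PowerSeries.coeff_one]
  split_ifs with h
  · simp [h]
  · simp

theorem scaled_central (T : Kq⟦X⟧) {c : A} (hc : ∀ a, Commute c a) : CentralSeries (scaled T c) :=
  fun k a => by
    rw [coeff_scaled]
    exact ((hc a).pow_left k).smul_left _

theorem eulerD_scaled_of_eq {T P : Kq⟦X⟧} (h : eulerD T = P * T) (c : A) :
    eulerD (scaled T c) = scaled P c * scaled T c := by
  rw [eulerD_scaled, h, scaled_mul]

theorem map_scaled (F : A →ₐ[Kq] B) (T : Kq⟦X⟧) (c : A) :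
    PowerSeries.map (F : A →+* B) (scaled T c) = scaled T (F c) := by
  ext m
  simp

theorem map_expSeries (F : A →ₐ[Kq] B) (S : A⟦X⟧) :
    PowerSeries.map (F : A →+* B) (expSeries S) = expSeries (PowerSeries.map (F : A →+* B) S) := by
  ext m
  simp only [PowerSeries.coeff_map, expSeries, PowerSeries.coeff_mk, ← map_pow]
  simp

theorem map_serre (F : A →ₐ[Kq] B) (t : Kq) (y : ℤ → A) (z : A) {r : ℕ} (m : Fin r → ℤ) :
    F (serre t y z m) = serre t (fun k => F (y k)) (F z) m := by
  simp only [serre, map_sum, map_smul, map_mul, map_list_prod, List.map_take, List.map_drop,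
    List.map_ofFn]
  rfl

theorem map_serreTwo (F : A →ₐ[Kq] B) (y : ℤ → A) (z : A) (a b : ℤ) :
    F (serreTwo y z a b) = serreTwo (fun k => F (y k)) (F z) a b := by
  simp [serreTwo]

/-- Rescaling of the currents in the Serre expression. -/
theorem serre_smul (t : Kq) (y : ℤ → A) (z : A) {r : ℕ} (m : Fin r → ℤ) (f : ℤ → Kq) (c : Kq) :
    serre t (fun k => f k • y k) (c • z) m = ((∏ e, f (m e)) * c) • serre t y z m := by
  have hl : ∀ l : List ℤ, (l.map fun k => f k • y k).prod =
      (l.map f).prod • (l.map y).prod := fun l => by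
    induction l with
    | nil => simp
    | cons a l ih => simp only [List.map_cons, List.prod_cons, ih, smul_mul_smul_comm]
  rw [serre, serre, Finset.smul_sum]
  refine Finset.sum_congr rfl fun π _ => ?_
  rw [Finset.smul_sum]
  refine Finset.sum_congr rfl fun l _ => ?_
  have h1 : ∀ g : ℤ → A, (List.ofFn fun e => g (m (π e))) = (List.ofFn fun e => m (π e)).map g :=
    fun g => by rw [List.map_ofFn]; rfl
  have h2 : ∏ e, f (m e) = (((List.ofFn fun e => m (π e)).take l).map f).prod *
      (((List.ofFn fun e => m (π e)).drop l).map f).prod := by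
    rw [← List.prod_append, ← List.map_append, List.take_append_drop, List.map_ofFn, List.prod_ofFn]
    exact (Equiv.prod_comp π fun e => f (m e)).symm
  rw [h1 (fun k => f k • y k), h1 y, ← List.map_take, ← List.map_drop, ← List.map_take,
    ← List.map_drop, hl, hl, h2, smul_mul_smul_comm, smul_mul_smul_comm, smul_smul, smul_smul]
  congr 1; ring

theorem serreTwo_smul (y : ℤ → A) (z : A) (a b : ℤ) (f : ℤ → Kq) (c : Kq) :
    serreTwo (fun k => f k • y k) (c • z) a b = (f a * f b * c) • serreTwo y z a b := by
  simp only [serreTwo, smul_add, smul_sub, smul_mul_smul_comm]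
  rw [smul_comm (qnum (q ^ 2) 2)]
  congr 1
  · congr 1
    · congr 1; ring
    · congr 1; ring

end Scaled

/-! ### Relations in the extended algebra -/

theorem commute_all_of_generators {ι A : Type*} [Ring A] [Algebra Kq A]
    {F : FreeAlgebra Kq ι →ₐ[Kq] A} (hF : Function.Surjective F) {c : A}
    (h : ∀ g, Commute c (F (FreeAlgebra.ι Kq g))) (y : A) : Commute c y := by
  obtain ⟨f, rfl⟩ := hF y
  induction f using FreeAlgebra.induction with
  | grade0 r => rw [AlgHom.commutes]; exact (Algebra.commutes r c).symm
  | grade1 g => exact h g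
  | mul a b ha hb => rw [map_mul]; exact ha.mul_right hb
  | add a b ha hb => rw [map_add]; exact ha.add_right hb

theorem commutator_of_neg {A : Type*} [Ring A] {a b e : A} (h : -a * b - b * -a = e) :
    a * b - b * a = -e := by
  rw [← h]; noncomm_ring

theorem neg_smul_eq {A : Type*} [Ring A] [Algebra Kq A] (g : Kq) (x : A) :
    -(g • x) = (-g) • x := (neg_smul g x).symm

namespace UqExt

variable {n : ℕ}

theorem mk_rel {a b : Ext.Free n} (h : Ext.Rel n a b) : mk n a = mk n b :=
  RingQuot.mkAlgHom_rel Kq h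

theorem mk_surjective : Function.Surjective (mk n) := RingQuot.mkAlgHom_surjective Kq _

/-- `X^s_{i,k}`. -/
def X (s : ℤˣ) (i : Fin n) (k : ℤ) : UqExt n := mk n (Ext.X s i k)

/-- `q^{c/2}`. -/
def c : (UqExt n)ˣ where
  val := mk n (FreeAlgebra.ι Kq ExtGen.qc)
  inv := mk n (FreeAlgebra.ι Kq ExtGen.qcInv)
  val_inv := by rw [← map_mul, mk_rel Ext.Rel.qc_mul, map_one]
  inv_val := by rw [← map_mul, mk_rel Ext.Rel.qcInv_mul, map_one]

theorem c_central (y : UqExt n) : Commute ((c : (UqExt n)ˣ) : UqExt n) y :=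
  commute_all_of_generators mk_surjective
    (fun g => by
      have := mk_rel (Ext.Rel.qc_central (n := n) g)
      rw [map_mul, map_mul] at this
      exact this) y

theorem c_zpow_central (z : ℤ) (y : UqExt n) : Commute ((c ^ z : (UqExt n)ˣ) : UqExt n) y := by
  exact ((c_central y).symm.units_zpow_right z).symm

theorem mk_qcPow (z : ℤ) : mk n (Ext.qcPow z) = ((c ^ z : (UqExt n)ˣ) : UqExt n) := by
  rw [← zpw_units, Ext.qcPow]
  exact map_zpw (mk n : Ext.Free n →+* UqExt n) _ _ _

theorem h_commute (s : ℤˣ) (i j : Fin (n + 1)) (a b : ℕ) : Commute (h s i a) (h s j b) := by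
  have := mk_rel (Ext.Rel.h_h s i j a b)
  rw [map_mul, map_mul] at this
  exact this

theorem h_zero_mul (s : ℤˣ) (j : Fin (n + 1)) : h s j 0 * h (-s) j 0 = 1 := by
  have := mk_rel (Ext.Rel.h_zero s j)
  rw [map_mul, map_one] at this
  exact this

theorem h_last (i : Fin n) (hi : IsLast i) : h 1 i.castSucc 0 * h 1 i.succ 0 = 1 := by
  have := mk_rel (Ext.Rel.h_last i hi)
  rw [map_mul, map_one] at this
  exact this

theorem h_zero_mul' (s : ℤˣ) (j : Fin (n + 1)) : h (-s) j 0 * h s j 0 = 1 := by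
  have := h_zero_mul (-s) j
  rwa [neg_neg] at this

@[simp] theorem coeff_hSer (s : ℤˣ) (j : Fin (n + 1)) (m : ℕ) :
    PowerSeries.coeff m (hSer s j) = h s j m := by simp [hSer]

theorem hInvSer_mul_hSer (s : ℤˣ) (j : Fin (n + 1)) : hInvSer s j * hSer s j = 1 := by
  apply invSeries_mul
  · rw [coeff_hSer, h_zero_mul]
  · rw [coeff_hSer, h_zero_mul']

theorem coeff_zero_hInvSer (s : ℤˣ) (j : Fin (n + 1)) :
    PowerSeries.coeff 0 (hInvSer s j) = h (-s) j 0 := by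
  simp [hInvSer, invSeries, invCoeff]

/-- The logarithmic derivative of `h^s_j(u)`. -/
def hLog (s : ℤˣ) (j : Fin (n + 1)) : (UqExt n)⟦X⟧ := eulerD (hSer s j) * hInvSer s j

theorem eulerD_hSer (s : ℤˣ) (j : Fin (n + 1)) : eulerD (hSer s j) = hLog s j * hSer s j := by
  rw [hLog, mul_assoc, hInvSer_mul_hSer, mul_one]

theorem coeff_zero_hLog (s : ℤˣ) (j : Fin (n + 1)) : PowerSeries.coeff 0 (hLog s j) = 0 := by
  simp [hLog, PowerSeries.coeff_mul, coeff_eulerD, -PowerSeries.coeff_zero_eq_constantCoeff]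

theorem hSer_coeffCommute (s : ℤˣ) (i j : Fin (n + 1)) : CoeffCommute (hSer s i) (hSer s j) :=
  fun a b => by rw [coeff_hSer, coeff_hSer]; exact h_commute s i j a b

theorem hSer_coeffCommute_inv (s : ℤˣ) (i j : Fin (n + 1)) :
    CoeffCommute (hSer s i) (hInvSer s j) :=
  (hSer_coeffCommute s i j).inv_right (hSer_mul_hInvSer s j) (hInvSer_mul_hSer s j)

theorem hInvSer_coeffCommute (s : ℤˣ) (i j : Fin (n + 1)) :
    CoeffCommute (hInvSer s i) (hInvSer s j) :=
  (hSer_coeffCommute_inv s j i).symm.inv_right (hSer_mul_hInvSer s j) (hInvSer_mul_hSer s j)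

theorem hSer_coeffCommute_hLog (s : ℤˣ) (i j : Fin (n + 1)) :
    CoeffCommute (hSer s i) (hLog s j) :=
  (hSer_coeffCommute s i j).eulerD_right.mul_right (hSer_coeffCommute_inv s i j)

theorem hInvSer_coeffCommute_hLog (s : ℤˣ) (i j : Fin (n + 1)) :
    CoeffCommute (hInvSer s i) (hLog s j) :=
  (hSer_coeffCommute_inv s j i).symm.eulerD_right.mul_right (hInvSer_coeffCommute s i j)

theorem hLog_coeffCommute (s : ℤˣ) (i j : Fin (n + 1)) : CoeffCommute (hLog s i) (hLog s j) :=
  ((hSer_coeffCommute_hLog s j i).symm.eulerD_right).mul_right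
    (hInvSer_coeffCommute_hLog s j i).symm

theorem eulerD_hInvSer (s : ℤˣ) (j : Fin (n + 1)) :
    eulerD (hInvSer s j) = -hLog s j * hInvSer s j :=
  eulerD_inv_of_eq (eulerD_hSer s j) (hSer_mul_hInvSer s j) (hInvSer_mul_hSer s j)
    (hInvSer_coeffCommute_hLog s j j).commute

/-- The series `h^s_{i+1}(u) h^s_i(u)^{-1}`. -/
def psi (s : ℤˣ) (i : Fin n) : (UqExt n)⟦X⟧ := hSer s i.succ * hInvSer s i.castSucc

/-- The logarithmic derivative of `psi s i`. -/
def psiLog (s : ℤˣ) (i : Fin n) : (UqExt n)⟦X⟧ := hLog s i.succ - hLog s i.castSucc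

theorem eulerD_psi (s : ℤˣ) (i : Fin n) : eulerD (psi s i) = psiLog s i * psi s i := by
  rw [psi, eulerD_mul_of_eq (eulerD_hSer s _) (eulerD_hInvSer s _)
    (hSer_coeffCommute_hLog s _ _).commute.neg_right, psiLog, sub_eq_add_neg]

theorem coeff_zero_psi (s : ℤˣ) (i : Fin n) :
    PowerSeries.coeff 0 (psi s i) = h s i.succ 0 * h (-s) i.castSucc 0 := by
  simp only [psi, PowerSeries.coeff_mul, Finset.Nat.antidiagonal_zero, Finset.sum_singleton,
    coeff_hSer, coeff_zero_hInvSer]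

theorem psi_eq (s : ℤˣ) (i : Fin n) : psi s i = hInvSer s i.castSucc * hSer s i.succ :=
  (hSer_coeffCommute_inv s _ _).commute

theorem mk_coeff_psiSer (s : ℤˣ) (i : Fin n) (m : ℕ) :
    mk n (PowerSeries.coeff m (Ext.psiSer s i)) = PowerSeries.coeff m (psi s i) := by
  have h1 : PowerSeries.map (mk n : Ext.Free n →+* UqExt n) (Ext.psiSer s i) = psi s i := by
    rw [psi_eq, Ext.psiSer, map_mul, map_invSeries]
    have h2 : ∀ j : Fin (n + 1),
        PowerSeries.map (mk n : Ext.Free n →+* UqExt n) (Ext.hSer s j) = hSer s j := fun j => by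
      ext m; simp [Ext.hSer, h]
    rw [h2, h2]; rfl
  rw [← h1]; simp

theorem mk_psiZ (s : ℤˣ) (i : Fin n) (m : ℤ) : mk n (Ext.psiZ s i m) =
    if 0 ≤ (s : ℤ) * m then PowerSeries.coeff ((s : ℤ) * m).toNat (psi s i) else 0 := by
  rw [Ext.psiZ]
  split_ifs
  · exact mk_coeff_psiSer _ _ _
  · exact map_zero _

theorem coeff_psi_odd (s : ℤˣ) (i : Fin n) (hi : IsLast i) {m : ℕ} (hm : Odd m) :
    PowerSeries.coeff m (psi s i) = 0 := by
  obtain ⟨k, rfl⟩ := hm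
  rw [← mk_coeff_psiSer, mk_rel (Ext.Rel.psi_odd s i hi k), map_zero]

end UqExt

/-- The logarithmic derivative of an even series is even. -/
theorem log_odd_eq_zero {A : Type*} [Ring A] {F S : A⟦X⟧} {u : A} (hF : eulerD F = S * F)
    (hu : PowerSeries.coeff 0 F * u = 1) (hodd : ∀ m, Odd m → PowerSeries.coeff m F = 0)
    {m : ℕ} (hm : Odd m) : PowerSeries.coeff m S = 0 := by
  induction m using Nat.strong_induction_on with
  | _ m ih =>
    have h1 := congrArg (PowerSeries.coeff m) hF
    rw [coeff_eulerD, hodd m hm, smul_zero, PowerSeries.coeff_mul,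
      Finset.sum_eq_single (m, 0)] at h1
    · calc _ = PowerSeries.coeff m S * PowerSeries.coeff 0 F * u := by rw [mul_assoc, hu, mul_one]
        _ = 0 := by rw [← h1, zero_mul]
    · intro p hp hne
      have hp' := Finset.HasAntidiagonal.mem_antidiagonal.mp hp
      rcases Nat.even_or_odd p.2 with h2 | h2
      · have h3 : Odd p.1 := by
          rcases Nat.even_or_odd p.1 with h3 | h3
          · exact absurd (hp' ▸ h3.add h2) (Nat.not_even_iff_odd.mpr hm)
          · exact h3
        have h4 : p.2 ≠ 0 := fun h4 => hne (Prod.ext (by simp; omega) (by simpa using h4))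
        rw [ih p.1 (by omega) h3, zero_mul]
      · rw [hodd _ h2, mul_zero]
    · intro hne
      simp at hne

/-! ### Action of the logarithmic derivatives on the currents -/

namespace UqExt

variable {n : ℕ}

theorem h_zero_X (s σ : ℤˣ) (i : Fin (n + 1)) (j : Fin n) (l : ℤ) :
    h s i 0 * X σ j l = q ^ ((σ : ℤ) * ((s : ℤ) * epsRoot' i j)) • (X σ j l * h s i 0) := by
  rcases Int.units_eq_one_or σ with rfl | rfl
  · have := mk_rel (Ext.Rel.h_Xp s i j 0 l)
    simp only [map_mul, zero_add, Finset.sum_range_one, coeff_scaled, pow_zero, map_smul,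
      coeff_zero_gSer, smul_mul_assoc, one_mul, Nat.cast_zero, mul_zero, sub_zero] at this
    simpa [h, X] using this
  · have := mk_rel (Ext.Rel.h_Xm s i j 0 l)
    simp only [map_mul, zero_add, Finset.sum_range_one, coeff_scaled, pow_zero, map_smul,
      coeff_zero_gSer, smul_mul_assoc, one_mul, Nat.cast_zero, mul_zero, sub_zero] at this
    change X (-1) j l * h s i 0 = _ • (h s i 0 * X (-1) j l) at this
    rw [this, smul_smul, ← zpow_add₀ q_ne_zero]
    simp

/-- `commutator_of_conj` for the current k ↦ X_{j, l - s k}. The relation with X^- has the form X h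
= g h X, so there it is h⁻¹ that conjugates; its logarithmic derivative is -L, which accounts for
the sign σ. -/
theorem commutator_hLog_X (s σ : ℤˣ) (i : Fin (n + 1)) (j : Fin n) (r : ℕ) (l : ℤ) :
    PowerSeries.coeff r (hLog s i) * X σ j l - X σ j l * PowerSeries.coeff r (hLog s i) =
      (((σ : ℤ) : Kq) * gam n (qr s r) ((-1) ^ r) i j) •
        (((c ^ (-((σ : ℤ) * r)) : (UqExt n)ˣ) : UqExt n) * X σ j (l - s * r)) := by
  have hy : ∀ k k' : ℕ, X σ j (l - s * (k : ℤ) - s * (k' : ℤ)) = X σ j (l - s * ((k + k' : ℕ) : ℤ)) :=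
    fun k k' => by congr 1; push_cast; ring
  have hG0 : ∀ u : (UqExt n), IsUnit (PowerSeries.coeff 0 (scaled (Ext.gSer s i j) u)) := fun u => by
    rw [coeff_scaled, pow_zero, coeff_zero_gSer]
    exact isUnit_one.smul (Units.mk0 (q ^ ((s : ℤ) * epsRoot' i j)) (zpow_ne_zero _ q_ne_zero))
  rcases Int.units_eq_one_or σ with rfl | rfl
  · have hc : ∀ y : UqExt n, Commute ((c ^ (-1 : ℤ) : (UqExt n)ˣ) : UqExt n) y := c_zpow_central _
    have := commutator_of_conj (eulerD_hSer s i) (hSer_mul_hInvSer s i)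
      (scaled_central (Ext.gSer s i j) hc) (eulerD_scaled_of_eq (eulerD_gSer s i j) _)
      (scaled_central _ hc) (hG0 _) (fun k => X 1 j (l - s * (k : ℤ))) (fun k => by
        ext a
        have := mk_rel (Ext.Rel.h_Xp s i j a (l - s * (k : ℤ)))
        simp only [map_mul, map_sum, coeff_scaled, map_smul, map_pow, mk_qcPow] at this
        rw [PowerSeries.coeff_mul_C, coeff_shiftSeries_mul, coeff_hSer]
        simp only [coeff_scaled, coeff_hSer, ← hy]
        exact this) r 0
    simp only [Nat.cast_zero, mul_zero, sub_zero, zero_add, coeff_scaled, gLog,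
      PowerSeries.coeff_mk] at this
    rw [this]
    simp
  · have hc : ∀ y : UqExt n, Commute ((c ^ (1 : ℤ) : (UqExt n)ˣ) : UqExt n) y := c_zpow_central _
    have := commutator_of_conj (eulerD_hInvSer s i) (hInvSer_mul_hSer s i)
      (scaled_central (Ext.gSer s i j) hc) (eulerD_scaled_of_eq (eulerD_gSer s i j) _)
      (scaled_central _ hc) (hG0 _) (fun k => X (-1) j (l - s * (k : ℤ))) (fun k => by
        have h1 : PowerSeries.C (X (-1) j (l - s * (k : ℤ))) * hSer s i = hSer s i *
            shiftSeries (scaled (Ext.gSer s i j) ((c ^ (1 : ℤ) : (UqExt n)ˣ) : UqExt n))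
              (fun k => X (-1) j (l - s * (k : ℤ))) k := by
          ext a
          have := mk_rel (Ext.Rel.h_Xm s i j a (l - s * (k : ℤ)))
          simp only [map_mul, map_sum, coeff_scaled, map_smul, map_pow, mk_qcPow] at this
          rw [PowerSeries.coeff_C_mul, coeff_mul_shiftSeries (scaled_central _ hc), coeff_hSer]
          simp only [coeff_scaled, coeff_hSer, ← hy]
          exact this
        calc _ = hInvSer s i * (PowerSeries.C (X (-1) j (l - s * (k : ℤ))) * hSer s i) *
              hInvSer s i := by
              rw [mul_assoc, mul_assoc, hSer_mul_hInvSer, mul_one]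
          _ = _ := by rw [h1, ← mul_assoc, hInvSer_mul_hSer, one_mul]) r 0
    simp only [Nat.cast_zero, mul_zero, sub_zero, zero_add, coeff_scaled, gLog,
      PowerSeries.coeff_mk, map_neg] at this
    rw [commutator_of_neg this, smul_mul_assoc]
    simp only [zpow_one, Units.val_neg, Units.val_one, neg_mul, one_mul, neg_neg, Int.cast_neg,
      Int.cast_one, zpow_natCast, Units.val_pow_eq_pow_val]
    exact neg_smul_eq (A := UqExt n) _ _

end UqExt

/-! ### The relations between `h^±_i(u)` and `h^∓_j(v)` -/

section Cross

theorem central_zpow {A : Type*} [Ring A] {c : Aˣ} (hc : ∀ y, Commute (c : A) y) (z : ℤ) (y : A) :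
    Commute ((c ^ z : Aˣ) : A) y := ((hc y).symm.units_zpow_right z).symm

variable {A : Type*} [Ring A] [Algebra Kq A]

theorem constantCoeff_fSer_ne_zero (n : ℕ) : PowerSeries.constantCoeff (fSer n) ≠ 0 := by
  have h1 : xi n * q ^ (-2 : ℤ) ≠ 0 :=
    mul_ne_zero (neg_ne_zero.mpr (zpow_ne_zero _ q_ne_zero)) (zpow_ne_zero _ q_ne_zero)
  simpa [fSer, infProd_zero] using h1

theorem coeff_zero_scaled (T : Kq⟦X⟧) (c c' : A) :
    PowerSeries.coeff 0 (scaled T c) = PowerSeries.coeff 0 (scaled T c') := by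
  rw [coeff_scaled, coeff_scaled, pow_zero, pow_zero]

/-- The series `f(x q^{sc}) ρ(x q^c)`, where `c` stands for `q^{c/2}`. -/
def crossLeft (n : ℕ) (c : Aˣ) (s : ℤˣ) (ρ : Kq⟦X⟧) : A⟦X⟧ :=
  scaled (fSer n) ((c ^ (2 * (s : ℤ)) : Aˣ) : A) * scaled ρ ((c ^ (2 : ℤ) : Aˣ) : A)

/-- The series `f(x q^{-sc}) ρ(x q^{-c})`, where `c` stands for `q^{c/2}`. -/
def crossRight (n : ℕ) (c : Aˣ) (s : ℤˣ) (ρ : Kq⟦X⟧) : A⟦X⟧ :=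
  scaled (fSer n) ((c ^ (-(2 * (s : ℤ))) : Aˣ) : A) * scaled ρ ((c ^ (-2 : ℤ) : Aˣ) : A)

/-- The commutators `(f_r - R_r) (q^{rc} - q^{-rc})`. -/
def crossLog (n : ℕ) (c : Aˣ) (s : ℤˣ) (R : Kq⟦X⟧) : A⟦X⟧ :=
  PowerSeries.mk fun r => (fLog n (qr s r) r - PowerSeries.coeff r R) •
    (((c ^ (2 * r : ℤ) : Aˣ) : A) - ((c ^ (-(2 * r) : ℤ) : Aˣ) : A))

theorem smul_cross_aux {R V : Type*} [CommRing R] [AddCommGroup V] [Module R V] (f g : R)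
    (x y : V) : f • y + g • y - (f • x + g • x) = (-f - g) • (x - y) := by module

theorem smul_cross_aux' {R V : Type*} [CommRing R] [AddCommGroup V] [Module R V] (f g : R)
    (x y : V) : f • x + g • y - (f • y + g • x) = (f - g) • (x - y) := by module

/-- The argument of f is scaled by q^{±sc}, that of ρ by q^{±c} whatever s is. For s = 1 the oddness
of `fLog` reconciles the two; for s = -1 the shapes already agree. -/
theorem crossLog_eq {n : ℕ} (hn : n ≠ 0) (c : Aˣ) (s : ℤˣ) (R : Kq⟦X⟧) :
    (scaled (PowerSeries.mk fun r => fLog n (q ^ r) r) ((c ^ (-(2 * (s : ℤ))) : Aˣ) : A) +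
        scaled R ((c ^ (-2 : ℤ) : Aˣ) : A)) -
      (scaled (PowerSeries.mk fun r => fLog n (q ^ r) r) ((c ^ (2 * (s : ℤ)) : Aˣ) : A) +
        scaled R ((c ^ (2 : ℤ) : Aˣ) : A)) = crossLog n c s R := by
  ext r
  have hpow : ∀ z : ℤ, ((c ^ z : Aˣ) : A) ^ r = ((c ^ (z * r) : Aˣ) : A) := fun z => by
    rw [zpow_mul, zpow_natCast, Units.val_pow_eq_pow_val]
  simp only [map_sub, map_add, coeff_scaled, crossLog, PowerSeries.coeff_mk, hpow]
  have h1 : (q ^ r : Kq) = qr (-1) r := by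
    rw [qr, ← zpow_natCast]; congr 1; simp
  rcases Int.units_eq_one_or s with rfl | rfl
  · have h2 : fLog n (q ^ r) r = -fLog n (qr 1 r) r := by
      rw [h1, qr_neg, fLog_inv (qr_ne_zero _ _) (one_add_qr_ne_zero hn _ _)]
    have h3 : fLog n (qr 1 r) r = - fLog n (q ^ r) r := by rw [h2]; exact (neg_neg _).symm
    rw [h3]
    refine Eq.trans ?_ (smul_cross_aux _ _ _ _)
    simp
  · rw [h1]
    refine Eq.trans ?_ (smul_cross_aux' _ _ _ _)
    simp

variable {n : ℕ} {c : Aˣ} {ρ R : Kq⟦X⟧}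

theorem crossLeft_mul_inv (hρ : PowerSeries.constantCoeff ρ ≠ 0) (hc : ∀ y, Commute (c : A) y)
    (s : ℤˣ) : crossLeft n c s ρ *
      (scaled (fSer n)⁻¹ ((c ^ (2 * (s : ℤ)) : Aˣ) : A) *
        scaled ρ⁻¹ ((c ^ (2 : ℤ) : Aˣ) : A)) = 1 := by
  rw [crossLeft, mul_assoc, ← mul_assoc (scaled ρ _),
    ((scaled_central ρ (central_zpow hc 2)).commute _).eq, mul_assoc, ← scaled_mul,
    PowerSeries.mul_inv_cancel _ hρ, scaled_one, mul_one, ← scaled_mul,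
    PowerSeries.mul_inv_cancel _ (constantCoeff_fSer_ne_zero n), scaled_one]

theorem centralSeries_crossLeft (hc : ∀ y, Commute (c : A) y) (s : ℤˣ) :
    CentralSeries (crossLeft n c s ρ) :=
  (scaled_central _ (central_zpow hc _)).mul (scaled_central _ (central_zpow hc _))

theorem crossLeft_inv_mul (hρ : PowerSeries.constantCoeff ρ ≠ 0) (hc : ∀ y, Commute (c : A) y)
    (s : ℤˣ) : (scaled (fSer n)⁻¹ ((c ^ (2 * (s : ℤ)) : Aˣ) : A) *
        scaled ρ⁻¹ ((c ^ (2 : ℤ) : Aˣ) : A)) * crossLeft n c s ρ = 1 := by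
  rw [← ((centralSeries_crossLeft hc s).commute _).eq]
  exact crossLeft_mul_inv hρ hc s

theorem centralSeries_crossRight (hc : ∀ y, Commute (c : A) y) (s : ℤˣ) :
    CentralSeries (crossRight n c s ρ) :=
  (scaled_central _ (central_zpow hc _)).mul (scaled_central _ (central_zpow hc _))

theorem coeff_zero_crossRight (s : ℤˣ) :
    PowerSeries.coeff 0 (crossRight n c s ρ) = PowerSeries.coeff 0 (crossLeft n c s ρ) := by
  simp only [crossRight, crossLeft, PowerSeries.coeff_mul, Finset.Nat.antidiagonal_zero,
    Finset.sum_singleton]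
  rw [coeff_zero_scaled (fSer n) _ ((c ^ (2 * (s : ℤ)) : Aˣ) : A),
    coeff_zero_scaled ρ _ ((c ^ (2 : ℤ) : Aˣ) : A)]

theorem coeff_zero_crossQuot (hρ : PowerSeries.constantCoeff ρ ≠ 0) (hc : ∀ y, Commute (c : A) y)
    (s : ℤˣ) : PowerSeries.coeff 0 ((scaled (fSer n)⁻¹ ((c ^ (2 * (s : ℤ)) : Aˣ) : A) *
        scaled ρ⁻¹ ((c ^ (2 : ℤ) : Aˣ) : A)) * crossRight n c s ρ) = 1 := by
  have := congrArg (PowerSeries.coeff 0) (crossLeft_inv_mul (n := n) hρ hc s)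
  rw [PowerSeries.coeff_mul, Finset.Nat.antidiagonal_zero, Finset.sum_singleton] at this ⊢
  rw [coeff_zero_crossRight, this]
  simp

theorem eulerD_crossAux (hn : n ≠ 0) (hR : eulerD ρ = R * ρ) {c₁ c₂ : A}
    (hc₂ : ∀ y, Commute c₂ y) :
    eulerD (scaled (fSer n) c₁ * scaled ρ c₂) =
      (scaled (PowerSeries.mk fun r => fLog n (q ^ r) r) c₁ + scaled R c₂) *
        (scaled (fSer n) c₁ * scaled ρ c₂) :=
  eulerD_mul_of_eq (eulerD_scaled_of_eq (eulerD_fSer hn) _) (eulerD_scaled_of_eq hR _)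
    ((scaled_central _ hc₂).commute _).symm

variable {E E' F F' S S' : A⟦X⟧}

theorem heisComm_of_crossSeries (hn : n ≠ 0) (hc : ∀ y, Commute (c : A) y)
    (hρ : PowerSeries.constantCoeff ρ ≠ 0) (hR : eulerD ρ = R * ρ) (s : ℤˣ)
    (hE : eulerD E = S * E) (hEE' : E * E' = 1) (hF : eulerD F = S' * F) (hFF' : F * F' = 1)
    (h : ∀ a b, crossCoeff (crossLeft n c s ρ) E F a b =
      crossCoeff' (crossRight n c s ρ) E F a b) :
    HeisComm S S' (crossLog n c s R) := by
  rw [← crossLog_eq hn]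
  exact heisComm_of_cross hE hEE' hF hFF' (centralSeries_crossLeft hc s)
    (centralSeries_crossRight hc s) (eulerD_crossAux hn hR (central_zpow hc _))
    (eulerD_crossAux hn hR (central_zpow hc _))
    ((scaled_central _ (central_zpow hc _)).add (scaled_central _ (central_zpow hc _)))
    ((scaled_central _ (central_zpow hc _)).add (scaled_central _ (central_zpow hc _)))
    (crossLeft_mul_inv hρ hc s) (crossLeft_inv_mul hρ hc s)
    (by rw [coeff_zero_crossQuot hρ hc]; exact isUnit_one) h

theorem crossSeries_of_heisComm (hn : n ≠ 0) (hc : ∀ y, Commute (c : A) y)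
    (hρ : PowerSeries.constantCoeff ρ ≠ 0) (hR : eulerD ρ = R * ρ) (s : ℤˣ)
    (hE : eulerD E = S * E) (hS : PowerSeries.coeff 0 S = 0)
    (hF : eulerD F = S' * F) (hS' : PowerSeries.coeff 0 S' = 0)
    (hE0 : ∀ b, Commute (PowerSeries.coeff 0 E) (PowerSeries.coeff b F))
    (hF0 : ∀ r, Commute (PowerSeries.coeff r S) (PowerSeries.coeff 0 F))
    (h : HeisComm S S' (crossLog n c s R)) (a b : ℕ) :
    crossCoeff (crossLeft n c s ρ) E F a b = crossCoeff' (crossRight n c s ρ) E F a b := by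
  have h0 : PowerSeries.coeff 0 (crossLog n c s R) = 0 := by
    rw [crossLog, PowerSeries.coeff_mk, Nat.cast_zero, mul_zero, neg_zero, sub_self, smul_zero]
  rw [← crossLog_eq hn] at h h0
  exact cross_of_heisComm hE hS hF hS' (centralSeries_crossLeft hc s)
    (centralSeries_crossRight hc s) (eulerD_crossAux hn hR (central_zpow hc _))
    (eulerD_crossAux hn hR (central_zpow hc _))
    ((scaled_central _ (central_zpow hc _)).add (scaled_central _ (central_zpow hc _)))
    ((scaled_central _ (central_zpow hc _)).add (scaled_central _ (central_zpow hc _)))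
    (crossLeft_mul_inv hρ hc s) (crossLeft_inv_mul hρ hc s)
    (coeff_zero_crossQuot hρ hc s) hE0 hF0 h0 h a b

end Cross

/-! ### Heisenberg relations in the extended algebra -/

/-- The expansion of the rational function `(x^d - 1) / (q^d x^d - q^{-d})`, `d` the multiplicity
of the node with label `i + 1`. -/
def rhoSer (n : ℕ) (s : ℤˣ) (i : ℕ) : Kq⟦X⟧ :=
  if i + 1 = n then ratExp s 2 1 (-1) (q ^ 2) (-q ^ (-2 : ℤ)) else ratExp s 1 1 (-1) q (-q⁻¹)

/-- The logarithmic derivative of `rhoSer`. -/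
def rhoLog (n : ℕ) (s : ℤˣ) (i : ℕ) : Kq⟦X⟧ :=
  PowerSeries.mk fun r => nodeMult n ((-1) ^ r) i * ((qr s r ^ 2)⁻¹ - 1)

theorem rhoSer_eq (n : ℕ) (s : ℤˣ) (i : ℕ) : rhoSer n s i =
    if i + 1 = n then ratExp s 2 1 (-1) (q ^ (2 : ℤ)) (-q ^ (-2 : ℤ))
    else ratExp s 1 1 (-1) (q ^ (1 : ℤ)) (-q ^ (-1 : ℤ)) := by
  rw [rhoSer, zpow_one, zpow_neg_one, ← zpow_natCast q 2]; rfl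

theorem eulerD_rhoSer (n : ℕ) (s : ℤˣ) (i : ℕ) :
    eulerD (rhoSer n s i) = rhoLog n s i * rhoSer n s i := by
  rw [rhoSer_eq]
  split_ifs with h
  · rw [eulerD_ratExp_q s 2 two_ne_zero]
    congr 1
    ext r
    have := coeff_ratLog_two s 1 r
    simp only [mul_one] at this
    rw [this, rhoLog, PowerSeries.coeff_mk, nodeMult, if_pos h, qr_sq_inv]
  · rw [eulerD_ratExp_q s 1 one_ne_zero]
    congr 1
    ext r
    rw [coeff_ratLog_one, rhoLog, PowerSeries.coeff_mk, nodeMult, if_neg h, qr_sq_inv]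
    simp

theorem constantCoeff_rhoSer_ne_zero (n : ℕ) (s : ℤˣ) (i : ℕ) :
    PowerSeries.constantCoeff (rhoSer n s i) ≠ 0 := by
  rw [rhoSer_eq, ← PowerSeries.coeff_zero_eq_constantCoeff_apply]
  split_ifs
  · rw [coeff_zero_ratExp_q s 2 two_ne_zero]; exact zpow_ne_zero _ q_ne_zero
  · rw [coeff_zero_ratExp_q s 1 one_ne_zero]; exact zpow_ne_zero _ q_ne_zero

section

variable {A : Type*} [Ring A] [Algebra Kq A]

theorem crossLog_zero (n : ℕ) (c : Aˣ) (s : ℤˣ) (i : ℕ) : crossLog n c s 0 =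
    PowerSeries.mk fun r => pij n (qr s r) r i i •
      (((c ^ (2 * r : ℤ) : Aˣ) : A) - ((c ^ (-(2 * r) : ℤ) : Aˣ) : A)) := by
  ext r
  simp [crossLog, pij]

theorem crossLog_rhoLog (n : ℕ) (c : Aˣ) (s : ℤˣ) {i j : ℕ} (h : i < j) :
    crossLog n c s (rhoLog n s i) = PowerSeries.mk fun r => pij n (qr s r) r i j •
      (((c ^ (2 * r : ℤ) : Aˣ) : A) - ((c ^ (-(2 * r) : ℤ) : Aˣ) : A)) := by
  ext r
  simp only [crossLog, pij, rhoLog, PowerSeries.coeff_mk, if_pos h, if_neg h.asymm, add_zero]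

end

namespace UqExt

variable {n : ℕ}

theorem map_hSer (s : ℤˣ) (j : Fin (n + 1)) :
    PowerSeries.map (mk n : Ext.Free n →+* UqExt n) (Ext.hSer s j) = hSer s j := by
  ext m; simp [Ext.hSer, h]

theorem mk_hhLeft (ρ : ℤˣ → Kq⟦X⟧) (s : ℤˣ) (i j : Fin (n + 1)) (a b : ℕ) :
    mk n (Ext.hhLeft ρ s i j a b) =
      crossCoeff (crossLeft n c s (ρ s)) (hSer s i) (hSer (-s) j) a b := by
  refine (map_crossCoeff (mk n : Ext.Free n →+* UqExt n) _ _ _ a b).trans ?_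
  rw [map_mul, map_scaled, map_scaled, map_hSer, map_hSer, mk_qcPow, mk_qcPow, crossLeft]

theorem mk_hhRight (ρ : ℤˣ → Kq⟦X⟧) (s : ℤˣ) (i j : Fin (n + 1)) (a b : ℕ) :
    mk n (Ext.hhRight ρ s i j a b) =
      crossCoeff' (crossRight n c s (ρ s)) (hSer s i) (hSer (-s) j) a b := by
  refine (map_crossCoeff' (mk n : Ext.Free n →+* UqExt n) _ _ _ a b).trans ?_
  rw [map_mul, map_scaled, map_scaled, map_hSer, map_hSer, mk_qcPow, mk_qcPow, crossRight]

theorem heisComm_hLog_of_le (hn : n ≠ 0) (s : ℤˣ) {i j : Fin (n + 1)} (hij : i ≤ j) :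
    HeisComm (hLog s i) (hLog (-s) j) (PowerSeries.mk fun r => pij n (qr s r) r i j •
      (((c ^ (2 * r : ℤ) : (UqExt n)ˣ) : UqExt n) -
        ((c ^ (-(2 * r) : ℤ) : (UqExt n)ˣ) : UqExt n))) := by
  rcases eq_or_lt_of_le hij with rfl | hij
  · rw [← crossLog_zero]
    refine heisComm_of_crossSeries (ρ := 1) hn c_central (by simp) (by simp) s
      (eulerD_hSer s i) (hSer_mul_hInvSer s i) (eulerD_hSer (-s) i) (hSer_mul_hInvSer (-s) i)
      fun a b => ?_
    have := mk_rel (Ext.Rel.h_h_eq s i a b)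
    rwa [mk_hhLeft, mk_hhRight] at this
  · rw [← crossLog_rhoLog n c s (show i.val < j.val from hij)]
    refine heisComm_of_crossSeries hn c_central (constantCoeff_rhoSer_ne_zero n s i)
      (eulerD_rhoSer n s i) s
      (eulerD_hSer s i) (hSer_mul_hInvSer s i) (eulerD_hSer (-s) j) (hSer_mul_hInvSer (-s) j)
      fun a b => ?_
    rw [rhoSer]
    split_ifs with hi
    -- For i with label n, the only index j > i has label n + 1, so the relation with ρ_{n,n+1}
    -- applies.
    · have hi' : i.val < n := by omega
      have hj : j = Fin.succ ⟨i.val, hi'⟩ := Fin.ext (by simp; omega)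
      have := mk_rel (Ext.Rel.h_h_last s ⟨i.val, hi'⟩ hi a b)
      rw [mk_hhLeft, mk_hhRight] at this
      rw [hj]
      exact this
    · have := mk_rel (Ext.Rel.h_h_lt s i j hij hi a b)
      rwa [mk_hhLeft, mk_hhRight] at this

theorem neg_comm_aux {R V : Type*} [CommRing R] [AddCommGroup V] [Module R V] (r : ℕ) (g : R)
    (x : V) : -(r • (-g • x)) = r • (g • x) := by simp

theorem heisComm_hLog (hn : n ≠ 0) (s : ℤˣ) (i j : Fin (n + 1)) :
    HeisComm (hLog s i) (hLog (-s) j) (PowerSeries.mk fun r => pij n (qr s r) r i j •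
      (((c ^ (2 * r : ℤ) : (UqExt n)ˣ) : UqExt n) -
        ((c ^ (-(2 * r) : ℤ) : (UqExt n)ˣ) : UqExt n))) := by
  rcases le_total i j with hij | hij
  · exact heisComm_hLog_of_le hn s hij
  · intro r l
    -- The defining relations cover i ≤ j only. In the other case, reverse the commutator and the
    -- signs; `pij_inv` restores the form of the constants.
    have := heisComm_hLog_of_le hn (-s) hij l r
    rw [neg_neg] at this
    rw [← neg_sub, this]
    by_cases h : r = l
    · subst h
      rw [if_pos rfl, if_pos rfl, PowerSeries.coeff_mk, PowerSeries.coeff_mk, qr_neg,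
        pij_inv (qr_ne_zero _ _) (one_add_qr_ne_zero hn _ _)]
      exact neg_comm_aux (R := Kq) (V := UqExt n) r _ _
    · rw [if_neg h, if_neg (Ne.symm h)]; exact neg_zero

end UqExt

/-! ### The series `φ^±_i(u)` -/

/-- The series `∑_m F(φ^s_{i, s m}) t^m`. -/
def phiSer {n : ℕ} {A : Type*} [Ring A] [Algebra Kq A] (F : Dr.Free n →ₐ[Kq] A) (s : ℤˣ)
    (i : Fin n) : A⟦X⟧ := PowerSeries.mk fun m => F (Dr.phi s i m)

/-- The logarithmic derivative of `phiSer`. -/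
def phiLog {n : ℕ} {A : Type*} [Ring A] [Algebra Kq A] (F : Dr.Free n →ₐ[Kq] A) (s : ℤˣ)
    (i : Fin n) : A⟦X⟧ :=
  PowerSeries.mk fun r => (((s : ℤ) : Kq) * (qi i - (qi i)⁻¹) * r) • F (Dr.aPart s i r)

section Phi

variable {n : ℕ} {A : Type*} [Ring A] [Algebra Kq A] (F : Dr.Free n →ₐ[Kq] A) (s : ℤˣ) (i : Fin n)

theorem phiSer_eq : phiSer F s i = PowerSeries.C (zpw (F (Dr.k i)) (F (Dr.kInv i)) s) *
    expSeries (PowerSeries.mk fun r =>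
      (((s : ℤ) : Kq) * (qi i - (qi i)⁻¹)) • F (Dr.aPart s i r)) := by
  have h1 := map_expSeries F (PowerSeries.mk fun r =>
      (((s : ℤ) : Kq) * (qi i - (qi i)⁻¹)) • Dr.aPart s i r)
  have h2 : PowerSeries.map (F : Dr.Free n →+* A) (PowerSeries.mk fun r =>
      (((s : ℤ) : Kq) * (qi i - (qi i)⁻¹)) • Dr.aPart s i r) = PowerSeries.mk fun r =>
      (((s : ℤ) : Kq) * (qi i - (qi i)⁻¹)) • F (Dr.aPart s i r) := by
    ext r; simp
  rw [h2] at h1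
  rw [← h1]
  ext m
  rw [PowerSeries.coeff_C_mul, phiSer, PowerSeries.coeff_mk, Dr.phi, map_mul,
    PowerSeries.coeff_map]
  congr 1
  exact map_zpw (F : Dr.Free n →+* A) _ _ _

theorem coeff_zero_phiSer :
    PowerSeries.coeff 0 (phiSer F s i) = zpw (F (Dr.k i)) (F (Dr.kInv i)) s := by
  rw [phiSer_eq, PowerSeries.coeff_C_mul, coeff_zero_expSeries, mul_one]

theorem aPart_zero : Dr.aPart s i 0 = 0 := by rw [Dr.aPart, dif_pos rfl]

theorem coeff_zero_phiLog : PowerSeries.coeff 0 (phiLog F s i) = 0 := by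
  simp [phiLog, -PowerSeries.coeff_zero_eq_constantCoeff]

theorem eulerD_phiSer
    (ha : ∀ r r', Commute (F (Dr.aPart s i r)) (F (Dr.aPart s i r')))
    (hk : ∀ r, Commute (zpw (F (Dr.k i)) (F (Dr.kInv i)) s) (F (Dr.aPart s i r))) :
    eulerD (phiSer F s i) = phiLog F s i * phiSer F s i := by
  rw [phiSer_eq, eulerD_mul, eulerD_C, zero_mul, zero_add]
  set S : A⟦X⟧ := PowerSeries.mk fun r =>
      (((s : ℤ) : Kq) * (qi i - (qi i)⁻¹)) • F (Dr.aPart s i r) with hS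
  have h1 : eulerD S = phiLog F s i := by
    ext r
    rw [coeff_eulerD, hS, PowerSeries.coeff_mk, phiLog, PowerSeries.coeff_mk, mul_comm _ (r : Kq),
      mul_smul (r : Kq), Nat.cast_smul_eq_nsmul]
  have h2 : CoeffCommute S S := fun a b => by
    simp only [hS, PowerSeries.coeff_mk]
    exact ((ha a b).smul_left _).smul_right _
  rw [eulerD_expSeries (by rw [hS, PowerSeries.coeff_mk, aPart_zero, map_zero, smul_zero])
    h2.eulerD_right.commute, h1, ← mul_assoc, ← mul_assoc]
  congr 1
  refine (commute_C_iff.mpr fun b => ?_)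
  rw [phiLog, PowerSeries.coeff_mk]
  exact (hk b).smul_right _

end Phi

/-! ### Normalization of the Heisenberg generators -/

/-- The coefficient `q^{(i+1) s r} s (q_i - q_i^{-1}) r`. -/
def aCoef (s : ℤˣ) (i : Fin n) (r : ℕ) : Kq :=
  q ^ ((s : ℤ) * (i.val + 1 : ℤ) * r) * (((s : ℤ) : Kq) * (qi i - (qi i)⁻¹) * r)

theorem aCoef_ne_zero {n : ℕ} (s : ℤˣ) (i : Fin n) {r : ℕ} (hr : r ≠ 0) : aCoef s i r ≠ 0 :=
  mul_ne_zero (zpow_ne_zero _ q_ne_zero) (mul_ne_zero (mul_ne_zero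
    (left_ne_zero_of_mul_eq_one (units_cast_mul_self s)) (qi_sub_ne_zero i))
    (Nat.cast_ne_zero.mpr hr))

/-- The structure constants of the differences of logarithmic derivatives. -/
def gamDiff {n : ℕ} (s : ℤˣ) (i j : Fin n) (r : ℕ) : Kq :=
  gam n (qr (-s) r) ((-1) ^ r) (i + 1) j - gam n (qr (-s) r) ((-1) ^ r) i j

/-- The power of q in `heis_eq` depends on j - i. It splits into a part for node i, contained in
`aCoef`, and a part for node j, which comes from the shift in X_j(u q^j). -/
theorem gamDiff_eq {n : ℕ} (s : ℤˣ) (i j : Fin n) {r : ℕ} (hr : r ≠ 0) :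
    gamDiff s i j r = aCoef s i r * (q ^ (-((s : ℤ) * (j.val + 1 : ℤ) * r)) *
      Dr.heis i j ((s : ℤ) * r)) := by
  have h1 := heis_eq (-s) i j hr
  have h2 : -(((-s : ℤˣ) : ℤ) * (r : ℤ)) = s * r := by simp
  have h3 : -(((-s : ℤˣ) : ℤ) : Kq) = ((s : ℤ) : Kq) := by push_cast; exact neg_neg _
  have h4 : qr (-s) r ^ ((j : ℤ) - i) ≠ 0 := zpow_ne_zero _ (qr_ne_zero _ _)
  rw [h2, h3] at h1
  rw [← mul_right_inj' h4, gamDiff, ← h1, aCoef]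
  have h5 : qr (-s) r ^ ((j : ℤ) - i) * (q ^ ((s : ℤ) * (i.val + 1 : ℤ) * r) *
      q ^ (-((s : ℤ) * (j.val + 1 : ℤ) * r))) = 1 := by
    rw [qr, h2, ← zpow_mul, ← zpow_add₀ q_ne_zero, ← zpow_add₀ q_ne_zero,
      ← zpow_zero q]
    congr 1; ring
  linear_combination (-(((s : ℤ) : Kq) * (qi i - (qi i)⁻¹) * r * Dr.heis i j ((s : ℤ) * r))) * h5

/-- Every nonzero integer is `s r` with a sign `s` and `r ≥ 1`. -/
theorem exists_sign_mul (l : {l : ℤ // l ≠ 0}) :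
    ∃ (s : ℤˣ) (r : ℕ) (hr : r ≠ 0), l = ⟨(s : ℤ) * r,
      mul_ne_zero s.ne_zero (Int.natCast_ne_zero.mpr hr)⟩ := by
  obtain ⟨l, hl⟩ := l
  rcases Int.natAbs_eq l with h | h
  · exact ⟨1, l.natAbs, Int.natAbs_ne_zero.mpr hl, Subtype.ext (by simpa using h)⟩
  · exact ⟨-1, l.natAbs, Int.natAbs_ne_zero.mpr hl, Subtype.ext (by simpa using h)⟩

theorem sign_mul_inj {s s' : ℤˣ} {r r' : ℕ} (hr : r ≠ 0) (h : (s : ℤ) * r = s' * r') :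
    s = s' ∧ r = r' := by
  rcases Int.units_eq_one_or s with rfl | rfl <;>
    rcases Int.units_eq_one_or s' with rfl | rfl <;>
    simp at h ⊢ <;> omega

theorem comm_sub_aux {A : Type*} [Ring A] (a b x : A) :
    (a - b) * x - x * (a - b) = (a * x - x * a) - (b * x - x * b) := by noncomm_ring

theorem comm_sub_aux' {A : Type*} [Ring A] (a b x : A) :
    x * (a - b) - (a - b) * x = (x * a - a * x) - (x * b - b * x) := by noncomm_ring

theorem comm_smul_aux {A : Type*} [Ring A] [Algebra Kq A] (f g : Kq) (a b : A) :
    (f • a) * (g • b) - (g • b) * (f • a) = (f * g) • (a * b - b * a) := by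
  rw [smul_mul_smul_comm, smul_mul_smul_comm, mul_comm g f, smul_sub]

theorem smul_sub_aux {A : Type*} [Ring A] [Algebra Kq A] (f g : Kq) (y : A) :
    f • y - g • y = (f - g) • y := (sub_smul f g y).symm

theorem epsRoot'_sub_eq {n : ℕ} (i j : Fin n) :
    epsRoot' i.castSucc j - epsRoot' i.succ j = form i j := by
  by_cases hi : IsLast i
  · rw [epsRoot'_last i j hi, ← two_epsRoot' i j hi]; ring
  · exact epsRoot'_sub i j hi

/-! ### The extended relations in logarithmic form and the images of Drinfeld's generators -/

/-- The coefficient of `u^m` in a series in `u^s` with coefficients `F`. -/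
def signCoeff {A : Type*} [Ring A] (F : A⟦X⟧) (s : ℤˣ) (m : ℤ) : A :=
  if 0 ≤ (s : ℤ) * m then PowerSeries.coeff ((s : ℤ) * m).toNat F else 0

/-- Elements of an algebra subject to the relations of the extended algebra, with the relations
of the `h^±_j(u)` expressed by their logarithmic derivatives `L`, and `psi s i` in place of
`h^s_{i+1}(u) h^s_i(u)^{-1}`. -/
structure ExtData (n : ℕ) (A : Type*) [Ring A] [Algebra Kq A] where
  c : Aˣ
  X : ℤˣ → Fin n → ℤ → A
  hU : Fin (n + 1) → Aˣ
  L : ℤˣ → Fin (n + 1) → A⟦X⟧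
  psi : ℤˣ → Fin n → A⟦X⟧
  c_central : ∀ y, Commute (c : A) y
  hU_commute : ∀ i j, Commute (hU i) (hU j)
  hU_L : ∀ i s j r, Commute (hU i : A) (PowerSeries.coeff r (L s j))
  hU_last : ∀ i : Fin n, IsLast i → hU i.succ = (hU i.castSucc)⁻¹
  hU_X : ∀ (s : ℤˣ) i j l, (hU i : A) * X s j l = q ^ ((s : ℤ) * epsRoot' i j) • (X s j l * (hU i : A))
  L_zero : ∀ s i, PowerSeries.coeff 0 (L s i) = 0
  L_comm : ∀ s i j, CoeffCommute (L s i) (L s j)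
  L_heis : ∀ (s : ℤˣ) i j, HeisComm (L s i) (L (-s) j) (PowerSeries.mk fun r => pij n (qr s r) r i j •
      (((c ^ (2 * r : ℤ) : Aˣ) : A) - ((c ^ (-(2 * r) : ℤ) : Aˣ) : A)))
  L_X : ∀ (s σ : ℤˣ) i j r l, PowerSeries.coeff r (L s i) * X σ j l - X σ j l * PowerSeries.coeff r (L s i) =
      (((σ : ℤ) : Kq) * gam n (qr s r) ((-1) ^ r) i j) •
        (((c ^ (-((σ : ℤ) * r)) : Aˣ) : A) * X σ j (l - s * r))
  eulerD_psi : ∀ s i, eulerD (psi s i) = (L s i.succ - L s i.castSucc) * psi s i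
  psi_zero : ∀ (s : ℤˣ) i, PowerSeries.coeff 0 (psi s i) =
    (((hU i.castSucc * (hU i.succ)⁻¹) ^ (-(s : ℤ)) : Aˣ) : A)
  psi_odd : ∀ s i, IsLast i → ∀ m, Odd m → PowerSeries.coeff m (psi s i) = 0
  X_odd : ∀ (s : ℤˣ) i, IsLast i → ∀ m, Odd m → X s i m = 0
  X_X : ∀ i j, ¬ IsLast j → ∀ m l, X 1 i m * X (-1) j l - X (-1) j l * X 1 i m =
    if i = j then (qi i - (qi i)⁻¹) • (((c ^ (m - l) : Aˣ) : A) * signCoeff (psi (-1) i) (-1) (-(m + l))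
      - ((c ^ (l - m) : Aˣ) : A) * signCoeff (psi 1 i) 1 (-(m + l))) else 0
  X_X_last : ∀ i j, IsLast j → ∀ m l, X 1 i m * X (-1) j l - X (-1) j l * X 1 i m =
    if i = j then (qi j - (qi j)⁻¹) •
      ((if Even m then ((c ^ (m - l + 2) : Aˣ) : A) * signCoeff (psi (-1) i) (-1) (-(m + l)) else 0) -
      (if Even l then ((c ^ (l - m - 2) : Aˣ) : A) * signCoeff (psi 1 i) 1 (-(m + l)) else 0)) else 0
  quad : ∀ (s : ℤˣ) i j, ¬ IsLast i → ¬ IsLast j → ∀ m l,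
    (q ^ (-((i.val + 1 : ℤ) * (m + 1))) • X s i (m + 1)) * (q ^ (-((j.val + 1 : ℤ) * l)) • X s j l) -
      q ^ ((s : ℤ) * form i j) •
        ((q ^ (-((i.val + 1 : ℤ) * m)) • X s i m) * (q ^ (-((j.val + 1 : ℤ) * (l + 1))) • X s j (l + 1)))
    = q ^ ((s : ℤ) * form i j) •
        ((q ^ (-((j.val + 1 : ℤ) * l)) • X s j l) * (q ^ (-((i.val + 1 : ℤ) * (m + 1))) • X s i (m + 1))) -
      (q ^ (-((j.val + 1 : ℤ) * (l + 1))) • X s j (l + 1)) * (q ^ (-((i.val + 1 : ℤ) * m)) • X s i m)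
  quad_last : ∀ (s : ℤˣ) i j, IsLast j → ∀ m l,
    (q ^ (-((i.val + 1 : ℤ) * (m + 2))) • X s i (m + 2)) * (q ^ (-((j.val + 1 : ℤ) * l)) • X s j l) -
      q ^ ((s : ℤ) * form i j) •
        ((q ^ (-((i.val + 1 : ℤ) * m)) • X s i m) * (q ^ (-((j.val + 1 : ℤ) * (l + 2))) • X s j (l + 2)))
    = q ^ ((s : ℤ) * form i j) •
        ((q ^ (-((j.val + 1 : ℤ) * l)) • X s j l) * (q ^ (-((i.val + 1 : ℤ) * (m + 2))) • X s i (m + 2))) -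
      (q ^ (-((j.val + 1 : ℤ) * (l + 2))) • X s j (l + 2)) * (q ^ (-((i.val + 1 : ℤ) * m)) • X s i m)
  serre : ∀ (s : ℤˣ) i j, i ≠ j → cartan i j = 0 ∨ cartan i j = -1 →
    ∀ (m : Fin (1 - cartan i j).toNat → ℤ) l, TwistedAffine.serre (qi i) (X s i) (X s j l) m = 0
  serre_two : ∀ (s : ℤˣ) i j, cartan i j = -2 → ∀ (m : Fin 2 → ℤ) l,
    (∑ π : Equiv.Perm (Fin 2),
      (q ^ (2 * (s : ℤ)) • serreTwo (X s i) (X s j l) (m (π 0) + 1) (m (π 1)) +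
        serreTwo (X s i) (X s j l) (m (π 0)) (m (π 1) + 1))) = 0

namespace ExtData

variable {n : ℕ} {A : Type*} [Ring A] [Algebra Kq A] (D : ExtData n A)

/-- The logarithmic derivative of `psi`. -/
def psiLog (s : ℤˣ) (i : Fin n) : A⟦X⟧ := D.L s i.succ - D.L s i.castSucc

theorem psiLog_coeffCommute (s : ℤˣ) (i j : Fin n) : CoeffCommute (D.psiLog s i) (D.psiLog s j) := by
  have h1 := D.L_comm s
  intro a b
  simp only [psiLog, map_sub]
  exact ((h1 _ _ a b).sub_right (h1 _ _ a b)).sub_left ((h1 _ _ a b).sub_right (h1 _ _ a b))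

theorem coeff_zero_psiLog (s : ℤˣ) (i : Fin n) : PowerSeries.coeff 0 (D.psiLog s i) = 0 := by
  rw [psiLog, map_sub, D.L_zero, D.L_zero, sub_zero]

/-- `1` or `q^c`. -/
def cLast (i : Fin n) : Aˣ := if IsLast i then D.c ^ (2 : ℤ) else 1

theorem cLast_central (i : Fin n) (y : A) : Commute (D.cLast i : A) y := by
  rw [cLast]; split_ifs
  · exact central_zpow D.c_central 2 y
  · rw [Units.val_one]; exact Commute.one_left y

/-- The image of `k_i`. -/
def kU (i : Fin n) : Aˣ := D.cLast i * (D.hU i.castSucc * (D.hU i.succ)⁻¹)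

theorem cLast_units (i : Fin n) (v : Aˣ) : Commute (D.cLast i) v := Units.ext (D.cLast_central i v)

theorem kU_zpow (i : Fin n) (s : ℤˣ) : ((D.kU i ^ (s : ℤ) : Aˣ) : A) =
    ((D.cLast i ^ (s : ℤ) : Aˣ) : A) * PowerSeries.coeff 0 (D.psi (-s) i) := by
  rw [kU, (D.cLast_units i _).mul_zpow, Units.val_mul, D.psi_zero, Units.val_neg, neg_neg]

theorem kU_commute (i j : Fin n) : Commute (D.kU i) (D.kU j) := by
  have h1 : ∀ a b : Fin n, Commute (D.hU a.castSucc * (D.hU a.succ)⁻¹)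
      (D.hU b.castSucc * (D.hU b.succ)⁻¹) := fun a b =>
    ((D.hU_commute _ _).mul_right (D.hU_commute _ _).inv_right).mul_left
      ((D.hU_commute _ _).mul_right (D.hU_commute _ _).inv_right).inv_left
  exact (D.cLast_units i _).mul_left ((D.cLast_units j _).symm.mul_right (h1 i j))

theorem kU_commute_L (i : Fin n) (s : ℤˣ) (j : Fin (n + 1)) (r : ℕ) :
    Commute (D.kU i : A) (PowerSeries.coeff r (D.L s j)) := by
  rw [kU, Units.val_mul, Units.val_mul]
  exact (D.cLast_central i _).mul_left ((D.hU_L _ s _ r).mul_left (D.hU_L _ s _ r).units_inv_left)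

theorem hU_inv_X (s : ℤˣ) (i : Fin (n + 1)) (j : Fin n) (l : ℤ) :
    ((D.hU i)⁻¹ : Aˣ) * D.X s j l =
      q ^ (-((s : ℤ) * epsRoot' i j)) • (D.X s j l * ((D.hU i)⁻¹ : Aˣ)) := by
  have h1 := congrArg (fun y : A => (((D.hU i)⁻¹ : Aˣ) : A) * y * (((D.hU i)⁻¹ : Aˣ) : A))
    (D.hU_X s i j l)
  simp only [← mul_assoc, Units.inv_mul, one_mul, mul_smul_comm, smul_mul_assoc] at h1
  rw [mul_assoc _ (D.hU i : A), Units.mul_inv, mul_one] at h1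
  rw [h1, smul_smul, ← zpow_add₀ q_ne_zero, neg_add_cancel, zpow_zero, one_smul]

theorem kU_X (s : ℤˣ) (i j : Fin n) (l : ℤ) : (D.kU i : A) * D.X s j l =
    q ^ ((s : ℤ) * form i j) • (D.X s j l * (D.kU i : A)) := by
  rw [kU, Units.val_mul, Units.val_mul, mul_assoc, mul_assoc, D.hU_inv_X, mul_smul_comm,
    ← mul_assoc (D.hU _ : A), D.hU_X, smul_mul_assoc, smul_smul, mul_smul_comm,
    ← zpow_add₀ q_ne_zero, ← mul_assoc (D.X s j l) (D.cLast i : A), ← (D.cLast_central i (D.X s j l)).eq,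
    ← epsRoot'_sub_eq i j]
  simp only [mul_assoc]
  congr 2
  ring

/-- The image of `a_{i, s r}`. -/
def aImg (s : ℤˣ) (i : Fin n) (r : ℕ) : A :=
  (aCoef s i r)⁻¹ • PowerSeries.coeff r (D.psiLog (-s) i)

/-- The image of `a_{i,l}`. -/
def aElt (i : Fin n) (l : ℤ) : A := if 0 ≤ l then D.aImg 1 i l.toNat else D.aImg (-1) i (-l).toNat

theorem aElt_mul (s : ℤˣ) (i : Fin n) {r : ℕ} (hr : r ≠ 0) : D.aElt i ((s : ℤ) * r) = D.aImg s i r := by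
  rcases Int.units_eq_one_or s with rfl | rfl
  · simp [aElt]
  · rw [aElt, if_neg (by simp; omega)]; simp

/-- The image of `x^s_{i,m}`. -/
def xImg (s : ℤˣ) (i : Fin n) (m : ℤ) : A :=
  ((qi i - (qi i)⁻¹)⁻¹ * q ^ (-((i.val + 1 : ℤ) * m))) • D.X s i m

theorem aImg_commute (s : ℤˣ) (i j : Fin n) (r r' : ℕ) : Commute (D.aImg s i r) (D.aImg s j r') :=
  ((D.psiLog_coeffCommute _ i j r r').smul_left _).smul_right _

theorem commutator_psiLog_X (s σ : ℤˣ) (i j : Fin n) (r : ℕ) (l : ℤ) :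
    PowerSeries.coeff r (D.psiLog (-s) i) * D.X σ j l - D.X σ j l * PowerSeries.coeff r (D.psiLog (-s) i) =
      (((σ : ℤ) : Kq) * gamDiff s i j r) •
        (((D.c ^ (-((σ : ℤ) * r)) : (A)ˣ) : A) * D.X σ j (s * r + l)) := by
  rw [psiLog, map_sub, comm_sub_aux, D.L_X, D.L_X, smul_sub_aux, ← mul_sub]
  have h1 : l - ((-s : ℤˣ) : ℤ) * r = s * r + l := by push_cast; ring
  rw [h1]
  rfl

theorem commutator_aImg_xImg (s σ : ℤˣ) (i j : Fin n) {r : ℕ} (hr : r ≠ 0) (l : ℤ) :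
    D.aImg s i r * D.xImg σ j l - D.xImg σ j l * D.aImg s i r =
      (((σ : ℤ) : Kq) * Dr.heis i j (s * r)) •
        (((D.c ^ (-((σ : ℤ) * r)) : (A)ˣ) : A) * D.xImg σ j (s * r + l)) := by
  rw [aImg, xImg, xImg, comm_smul_aux, D.commutator_psiLog_X, smul_smul, mul_smul_comm, smul_smul,
    gamDiff_eq s i j hr]
  congr 1
  have h1 := inv_mul_cancel₀ (aCoef_ne_zero s i hr)
  have h2 : q ^ (-((j.val + 1 : ℤ) * (s * r + l))) =
      q ^ (-((s : ℤ) * (j.val + 1 : ℤ) * r)) * q ^ (-((j.val + 1 : ℤ) * l)) := by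
    rw [← zpow_add₀ q_ne_zero]; congr 1; ring
  rw [h2]
  linear_combination ((qi j - (qi j)⁻¹)⁻¹ * q ^ (-((j.val + 1 : ℤ) * l)) * (((σ : ℤ) : Kq) *
    (q ^ (-((s : ℤ) * (j.val + 1 : ℤ) * r)) * Dr.heis i j (s * r)))) * h1

/-- A mixed second difference of `pij`: the difference in the second index is `gam` by `pij_sub`,
and the difference of `gam` in the first is `gamDiff`. -/
theorem commutator_psiLog (s : ℤˣ) (i j : Fin n) (r l : ℕ) :
    PowerSeries.coeff r (D.psiLog (-s) i) * PowerSeries.coeff l (D.psiLog s j) -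
        PowerSeries.coeff l (D.psiLog s j) * PowerSeries.coeff r (D.psiLog (-s) i) =
      if r = l then (-(r * gamDiff s i j r)) • (((D.c ^ (2 * r : ℤ) : (A)ˣ) : A) -
        ((D.c ^ (-(2 * r) : ℤ) : (A)ˣ) : A)) else 0 := by
  have h1 := fun a b => D.L_heis (-s) a b r l
  rw [neg_neg] at h1
  rw [psiLog, psiLog, map_sub, map_sub, comm_sub_aux, comm_sub_aux', comm_sub_aux', h1, h1, h1, h1]
  by_cases h : r = l
  · subst h
    simp only [if_true, PowerSeries.coeff_mk, ← Nat.cast_smul_eq_nsmul Kq, smul_smul]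
    rw [smul_sub_aux, smul_sub_aux, smul_sub_aux]
    congr 1
    have h3 := pij_sub n (qr (-s) r) r (i + 1) j (by omega) j.isLt
    have h4 := pij_sub n (qr (-s) r) r i j (by omega) j.isLt
    rw [gamDiff, ← h3, ← h4]
    simp only [Fin.val_succ, Fin.val_castSucc]
    ring
  · simp [h]

theorem commutator_aImg (s : ℤˣ) (i j : Fin n) {r l : ℕ} (hr : r ≠ 0) (hl : l ≠ 0) :
    D.aImg s i r * D.aImg (-s) j l - D.aImg (-s) j l * D.aImg s i r =
      if r = l then (Dr.heis i j (s * r) / (qi j - (qi j)⁻¹)) •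
        (((D.c ^ (2 * (s * r) : ℤ) : (A)ˣ) : A) -
        ((D.c ^ (-(2 * (s * r)) : ℤ) : (A)ˣ) : A)) else 0 := by
  rw [aImg, aImg, comm_smul_aux, neg_neg, D.commutator_psiLog]
  by_cases h : r = l
  · subst h
    rw [if_pos rfl, if_pos rfl, smul_smul, gamDiff_eq s i j hr]
    have h1 := inv_mul_cancel₀ (aCoef_ne_zero s i hr)
    have h2 := inv_mul_cancel₀ (aCoef_ne_zero (-s) j hr)
    have h3 : q ^ (-((s : ℤ) * (j.val + 1 : ℤ) * r)) * ((s : ℤ) : Kq) * (qi j - (qi j)⁻¹) * r =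
        -aCoef (-s) j r := by
      rw [aCoef]; push_cast
      rw [show -(s : ℤ) * ((j.val : ℤ) + 1) * r = -((s : ℤ) * (j.val + 1 : ℤ) * r) by ring]
      ring
    have h4 := qi_sub_ne_zero j
    have h5 := units_cast_mul_self s
    have h6 : (aCoef s i r)⁻¹ * (aCoef (-s) j r)⁻¹ * -(r * (aCoef s i r *
        (q ^ (-((s : ℤ) * (j.val + 1 : ℤ) * r)) * Dr.heis i j ((s : ℤ) * r)))) =
        ((s : ℤ) : Kq) * (Dr.heis i j (s * r) / (qi j - (qi j)⁻¹)) := by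
      have h7 : q ^ (-((s : ℤ) * (j.val + 1 : ℤ) * r)) * r =
          -(aCoef (-s) j r * ((s : ℤ) : Kq) / (qi j - (qi j)⁻¹)) := by
        generalize qi j - (qi j)⁻¹ = w at *
        field_simp
        linear_combination ((s : ℤ) : Kq) * h3 - q ^ (-((s : ℤ) * (j.val + 1 : ℤ) * r)) * r * w * h5
      generalize q ^ (-((s : ℤ) * (j.val + 1 : ℤ) * r)) = y at *
      generalize qi j - (qi j)⁻¹ = w at *
      generalize aCoef s i r = α at *
      generalize aCoef (-s) j r = β at *
      generalize (r : Kq) = ρ at *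
      calc _ = (α⁻¹ * α) * (-(β⁻¹ * (y * ρ))) * Dr.heis i j ((s : ℤ) * r) := by ring
        _ = (β⁻¹ * β) * (((s : ℤ) : Kq) * (Dr.heis i j (s * r) / w)) := by rw [h1, h7]; ring
        _ = _ := by rw [h2, one_mul]
    rw [h6]
    rcases Int.units_eq_one_or s with rfl | rfl
    · simp
    -- The sign left over from the two normalizations is absorbed by exchanging q^{rc} and q^{-rc}.
    · have h8 : ∀ (f : Kq) (x y : A), (((( -1 : ℤˣ) : ℤ) : Kq) * f) • (x - y) = f • (y - x) :=
        fun f x y => by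
          have : ((((-1 : ℤˣ) : ℤ) : Kq) * f) = -f := by push_cast; ring
          rw [this]
          exact (neg_smul f (x - y)).trans ((smul_neg f (x - y)).symm.trans
            (congrArg _ (neg_sub x y)))
      rw [h8]
      simp
  · simp [h]

end ExtData

/-! ### The homomorphism `ς` -/

/-- The series `Y(b t)`. -/
def twist {A : Type*} [Ring A] [Algebra Kq A] (b : Kq) (Y : A⟦X⟧) : A⟦X⟧ :=
  PowerSeries.mk fun m => b ^ m • PowerSeries.coeff m Y

theorem eulerD_twist {A : Type*} [Ring A] [Algebra Kq A] (b : Kq) {Y S : A⟦X⟧}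
    (h : eulerD Y = S * Y) : eulerD (twist b Y) = twist b S * twist b Y := by
  ext m
  have h1 := congrArg (PowerSeries.coeff m) h
  rw [coeff_eulerD] at h1
  rw [coeff_eulerD, twist, PowerSeries.coeff_mk, smul_comm, h1, PowerSeries.coeff_mul,
    PowerSeries.coeff_mul, Finset.smul_sum]
  refine Finset.sum_congr rfl fun p hp => ?_
  rw [twist, PowerSeries.coeff_mk, PowerSeries.coeff_mk, smul_mul_smul_comm, ← pow_add,
    Finset.HasAntidiagonal.mem_antidiagonal.mp hp]

theorem eulerD_central_mul {A : Type*} [Ring A] {u : A} (hu : ∀ y, Commute u y) {Y S : A⟦X⟧}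
    (h : eulerD Y = S * Y) : eulerD (PowerSeries.C u * Y) = S * (PowerSeries.C u * Y) := by
  rw [eulerD_C_mul, h, ← mul_assoc, ← mul_assoc, (commute_C_iff.mpr fun b => hu _).eq]

namespace ExtData

variable {n : ℕ} {A : Type*} [Ring A] [Algebra Kq A] (D : ExtData n A)

/-- The images of the generators. -/
def genMap : DrGen n → A
  | .x s i m => D.xImg s i m
  | .a i l => D.aElt i l
  | .k i => D.kU i
  | .kInv i => ((D.kU i)⁻¹ : Aˣ)
  | .qc => D.c
  | .qcInv => ((D.c)⁻¹ : Aˣ)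

/-- The homomorphism from the free algebra. -/
def freeMap : Dr.Free n →ₐ[Kq] A := FreeAlgebra.lift Kq D.genMap

theorem freeMap_x (s : ℤˣ) (i : Fin n) (m : ℤ) : D.freeMap (Dr.x s i m) = D.xImg s i m := by
  simp [freeMap, Dr.x, genMap]

theorem freeMap_a (i : Fin n) (l : {l : ℤ // l ≠ 0}) : D.freeMap (Dr.a i l) = D.aElt i l := by
  simp [freeMap, Dr.a, genMap]

theorem freeMap_k (i : Fin n) : D.freeMap (Dr.k i) = D.kU i := by
  simp [freeMap, Dr.k, genMap]

theorem freeMap_kInv (i : Fin n) : D.freeMap (Dr.kInv i) = ((D.kU i)⁻¹ : Aˣ) := by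
  simp [freeMap, Dr.kInv, genMap]

theorem freeMap_qc : D.freeMap (FreeAlgebra.ι Kq DrGen.qc) = D.c := by
  simp [freeMap, genMap]

theorem freeMap_qcInv : D.freeMap (FreeAlgebra.ι Kq DrGen.qcInv) = ((D.c)⁻¹ : Aˣ) := by
  simp [freeMap, genMap]

theorem freeMap_qcPow (z : ℤ) : D.freeMap (Dr.qcPow z) = ((D.c ^ z : Aˣ) : A) := by
  have h1 := map_zpw (D.freeMap : Dr.Free n →+* A) (FreeAlgebra.ι Kq DrGen.qc)
    (FreeAlgebra.ι Kq DrGen.qcInv) z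
  refine h1.trans ?_
  rw [← zpw_units]
  congr 1
  · exact D.freeMap_qc
  · exact D.freeMap_qcInv

theorem freeMap_aPart (s : ℤˣ) (i : Fin n) (r : ℕ) : D.freeMap (Dr.aPart s i r) = D.aImg s i r := by
  rw [Dr.aPart]
  split_ifs with h
  · rw [h, aImg, coeff_zero_psiLog, smul_zero, map_zero]
  · rw [freeMap_a, D.aElt_mul s i h]

theorem zpw_freeMap_k (s : ℤˣ) (i : Fin n) : zpw (D.freeMap (Dr.k i)) (D.freeMap (Dr.kInv i)) s =
    ((D.kU i ^ (s : ℤ) : Aˣ) : A) := by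
  rw [freeMap_k, freeMap_kInv, zpw_units]

theorem kU_commute_aImg (i : Fin n) (s : ℤˣ) (j : Fin n) (r : ℕ) :
    Commute (D.kU i : A) (D.aImg s j r) := by
  rw [aImg, psiLog, map_sub]
  exact ((D.kU_commute_L i _ _ r).sub_right (D.kU_commute_L i _ _ r)).smul_right _

theorem eulerD_phiSer_freeMap (s : ℤˣ) (i : Fin n) :
    eulerD (phiSer D.freeMap s i) = phiLog D.freeMap s i * phiSer D.freeMap s i := by
  refine eulerD_phiSer _ _ _ (fun r r' => ?_) fun r => ?_
  · rw [freeMap_aPart, freeMap_aPart]; exact D.aImg_commute _ _ _ _ _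
  · rw [freeMap_aPart, zpw_freeMap_k]
    exact ((D.kU_commute_aImg i s i r).symm.units_zpow_right _).symm

/-- The choice of `aCoef` is explained here: its power of q undoes the substitution u ↦ u q^i, and
the rest is the factor s (q_i - q_i⁻¹) r from differentiating the exponent of φ. -/
theorem phiLog_freeMap (s : ℤˣ) (i : Fin n) : phiLog D.freeMap s i =
    twist (q ^ (-((s : ℤ) * (i.val + 1 : ℤ)))) (D.psiLog (-s) i) := by
  ext r
  rw [phiLog, PowerSeries.coeff_mk, freeMap_aPart, twist, PowerSeries.coeff_mk]
  rcases Nat.eq_zero_or_pos r with rfl | hr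
  · rw [Nat.cast_zero, mul_zero, zero_smul, coeff_zero_psiLog, smul_zero]
  · rw [aImg, smul_smul]
    congr 1
    have h1 := aCoef_ne_zero s i hr.ne'
    rw [mul_inv_eq_iff_eq_mul₀ h1, aCoef, ← mul_assoc, ← zpow_natCast, ← zpow_mul,
      ← zpow_add₀ q_ne_zero]
    rw [show (-((s : ℤ) * (i.val + 1 : ℤ)) * (r : ℤ) + (s : ℤ) * (i.val + 1 : ℤ) * r) = 0 by ring,
      zpow_zero, one_mul]

/-- An exponential of the images of the a_{i,r} is compared with a quotient of the h's: both solve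
the same first-order equation, and the constant terms agree by `kU_zpow`. -/
theorem phiSer_freeMap (s : ℤˣ) (i : Fin n) : phiSer D.freeMap s i =
    PowerSeries.C ((D.cLast i ^ (s : ℤ) : Aˣ) : A) *
      twist (q ^ (-((s : ℤ) * (i.val + 1 : ℤ)))) (D.psi (-s) i) := by
  refine eulerD_unique (coeff_zero_phiLog _ _ _) (D.eulerD_phiSer_freeMap s i) ?_ ?_
  · rw [phiLog_freeMap]
    exact eulerD_central_mul (central_zpow (D.cLast_central i) _)
      (eulerD_twist _ (D.eulerD_psi (-s) i))
  · rw [coeff_zero_phiSer, zpw_freeMap_k, kU_zpow, PowerSeries.coeff_C_mul, twist,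
      PowerSeries.coeff_mk, pow_zero, one_smul]

theorem freeMap_phi (s : ℤˣ) (i : Fin n) (m : ℕ) : D.freeMap (Dr.phi s i m) =
    q ^ (-((s : ℤ) * (i.val + 1 : ℤ) * m)) •
      (((D.cLast i ^ (s : ℤ) : Aˣ) : A) * PowerSeries.coeff m (D.psi (-s) i)) := by
  have h1 := congrArg (PowerSeries.coeff m) (D.phiSer_freeMap s i)
  rw [phiSer, PowerSeries.coeff_mk, PowerSeries.coeff_C_mul, twist, PowerSeries.coeff_mk,
    mul_smul_comm, ← zpow_natCast, ← zpow_mul] at h1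
  rw [h1]
  congr 2; ring

theorem freeMap_phiZ (s : ℤˣ) (i : Fin n) (m : ℤ) : D.freeMap (Dr.phiZ s i m) =
    q ^ (-((i.val + 1 : ℤ) * m)) •
      (((D.cLast i ^ (s : ℤ) : Aˣ) : A) * signCoeff (D.psi (-s) i) (-s) (-m)) := by
  rw [Dr.phiZ, signCoeff]
  have h1 : ((-s : ℤˣ) : ℤ) * -m = (s : ℤ) * m := by push_cast; ring
  rw [h1]
  split_ifs with h
  · rw [freeMap_phi]
    congr 3
    have h2 : (s : ℤ) * s = 1 := by rcases Int.units_eq_one_or s with rfl | rfl <;> rfl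
    rw [Int.toNat_of_nonneg h]
    linear_combination (i.val + 1 : ℤ) * m * h2
  · rw [map_zero, mul_zero, smul_zero]

theorem signCoeff_psi_odd (s : ℤˣ) {i : Fin n} (hi : IsLast i) {m : ℤ} (hm : Odd m) :
    signCoeff (D.psi s i) s m = 0 := by
  rw [signCoeff]
  split_ifs with h
  · refine D.psi_odd s i hi _ ?_
    have : Odd ((s : ℤ) * m) := by
      rcases Int.units_eq_one_or s with rfl | rfl
      · simpa using hm
      · simpa using hm
    rwa [← Int.odd_coe_nat, Int.toNat_of_nonneg h]
  · rfl

/-- At the last node the Drinfeld relation tests the parity of l alone, the extended one that of m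
in one term and of l in the other. They agree because the odd modes of X_n and of ψ_n vanish. The
factors q^{±c} in φ_n account for the shifts by 2 in the exponents of q^{c/2}. -/
theorem rel_x_x (i j : Fin n) (m l : ℤ) :
    D.xImg 1 i m * D.xImg (-1) j l - D.xImg (-1) j l * D.xImg 1 i m =
      if i = j ∧ (d j : ℤ) ∣ l then (qi i - (qi i)⁻¹)⁻¹ •
        (((D.c ^ (m - l) : Aˣ) : A) * D.freeMap (Dr.phiZ 1 i (m + l)) -
          ((D.c ^ (-(m - l)) : Aˣ) : A) * D.freeMap (Dr.phiZ (-1) i (m + l))) else 0 := by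
  rw [xImg, xImg, comm_smul_aux]
  by_cases hij : i = j
  swap
  · rw [if_neg (fun h => hij h.1)]
    by_cases hj : IsLast j
    · rw [D.X_X_last i j hj, if_neg hij, smul_zero]
    · rw [D.X_X i j hj, if_neg hij, smul_zero]
  subst hij
  have hw : (qi i - (qi i)⁻¹)⁻¹ * q ^ (-((i.val + 1 : ℤ) * m)) *
      ((qi i - (qi i)⁻¹)⁻¹ * q ^ (-((i.val + 1 : ℤ) * l))) * (qi i - (qi i)⁻¹) =
      (qi i - (qi i)⁻¹)⁻¹ * q ^ (-((i.val + 1 : ℤ) * (m + l))) := by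
    have h1 := inv_mul_cancel₀ (qi_sub_ne_zero i)
    have h2 : q ^ (-((i.val + 1 : ℤ) * (m + l))) =
        q ^ (-((i.val + 1 : ℤ) * m)) * q ^ (-((i.val + 1 : ℤ) * l)) := by
      rw [← zpow_add₀ q_ne_zero]; congr 1; ring
    rw [h2]
    linear_combination (q ^ (-((i.val + 1 : ℤ) * m)) * q ^ (-((i.val + 1 : ℤ) * l)) *
      (qi i - (qi i)⁻¹)⁻¹) * h1
  rw [freeMap_phiZ, freeMap_phiZ, neg_neg, mul_smul_comm, mul_smul_comm, ← smul_sub]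
  by_cases hi : IsLast i
  · have hd : ((d i : ℕ) : ℤ) = 2 := by rw [d, if_pos hi]; rfl
    have hc : D.cLast i = D.c ^ (2 : ℤ) := if_pos hi
    rw [hd]
    by_cases hl : (2 : ℤ) ∣ l
    · rw [if_pos ⟨rfl, hl⟩]
      rcases Int.even_or_odd m with hm | hm
      · rw [D.X_X_last i i hi, if_pos rfl, if_pos hm, if_pos (even_iff_two_dvd.mpr hl), smul_smul,
          smul_smul, hw, hc]
        congr 2
        · rw [← mul_assoc, ← Units.val_mul, ← zpow_mul, ← zpow_add]
          simp
        · rw [← mul_assoc, ← Units.val_mul, ← zpow_mul, ← zpow_add]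
          simp only [Units.val_neg, Units.val_one]
          congr 3; ring
      · have h0 : Odd (-(m + l)) := (hm.add_even (even_iff_two_dvd.mpr hl)).neg
        rw [D.X_odd 1 i hi m hm, D.signCoeff_psi_odd _ hi h0]
        have := D.signCoeff_psi_odd 1 hi h0
        rw [this]
        simp
    · rw [if_neg (fun h => hl h.2), D.X_odd (-1) i hi l
        (Int.not_even_iff_odd.mp fun h => hl h.two_dvd)]
      simp
  · have hd : ((d i : ℕ) : ℤ) = 1 := by rw [d, if_neg hi]; rfl
    have hc : D.cLast i = 1 := if_neg hi
    rw [hd, if_pos ⟨rfl, one_dvd _⟩, D.X_X i i hi, if_pos rfl, smul_smul, smul_smul, hw, hc]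
    simp

theorem xImg_eq (s : ℤˣ) (i : Fin n) (m : ℤ) :
    D.xImg s i m = (qi i - (qi i)⁻¹)⁻¹ • (q ^ (-((i.val + 1 : ℤ) * m)) • D.X s i m) := by
  rw [xImg, mul_smul]

theorem quad_aux {a b p : Kq} {x x' y y' : A}
    (h : x' * y - p • (x * y') = p • (y * x') - y' * x) :
    (a • x') * (b • y) - p • ((b • y) * (a • x')) =
      p • ((a • x) * (b • y')) - (b • y') * (a • x) := by
  simp only [smul_mul_smul_comm, mul_comm b a, smul_comm p, ← smul_sub]
  congr 1
  rw [sub_eq_sub_iff_add_eq_add] at h ⊢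
  rw [h, add_comm]

/-- This is `quad_aux` with the two currents interchanged. It serves i = n, j < n, since the
extended relation with squared variables has n as its second index. -/
theorem quad_aux' {a b p : Kq} {x x' y y' : A}
    (h : y' * x - p • (y * x') = p • (x * y') - x' * y) :
    (a • x') * (b • y) - p • ((b • y) * (a • x')) =
      p • ((a • x) * (b • y')) - (b • y') * (a • x) := by
  simp only [smul_mul_smul_comm, mul_comm b a, smul_comm p, ← smul_sub]
  congr 1
  rw [sub_eq_sub_iff_add_eq_add] at h ⊢
  rw [add_comm, h, add_comm]

theorem rel_quad (s : ℤˣ) (i j : Fin n) (m l : ℤ) :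
    D.xImg s i (m + dd i j) * D.xImg s j l -
        qi i ^ ((s : ℤ) * cartan i j) • (D.xImg s j l * D.xImg s i (m + dd i j)) =
      qi i ^ ((s : ℤ) * cartan i j) • (D.xImg s i m * D.xImg s j (l + dd i j)) -
        D.xImg s j (l + dd i j) * D.xImg s i m := by
  have hp : qi i ^ ((s : ℤ) * cartan i j) = q ^ ((s : ℤ) * form i j) := by
    rw [qi_zpow, form]; congr 1; ring
  simp only [hp, xImg_eq]
  by_cases hj : IsLast j
  · have hd : ((dd i j : ℕ) : ℤ) = 2 := by
      rw [dd, d, d, if_pos hj]; split_ifs <;> rfl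
    rw [hd]
    exact quad_aux (D.quad_last s i j hj m l)
  · by_cases hi : IsLast i
    · have hd : ((dd i j : ℕ) : ℤ) = 2 := by
        rw [dd, d, d, if_pos hi, if_neg hj]; rfl
      rw [hd, form_comm]
      exact quad_aux' (D.quad_last s j i hi l m)
    · have hd : ((dd i j : ℕ) : ℤ) = 1 := by
        rw [dd, d, d, if_neg hi, if_neg hj]; rfl
      rw [hd]
      exact quad_aux (D.quad s i j hi hj m l)

theorem rel_serre_two (s : ℤˣ) (i j : Fin n) (hA : cartan i j = -2) (m : Fin 2 → ℤ) (l : ℤ) :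
    (∑ π : Equiv.Perm (Fin 2),
      (q • serreTwo (D.xImg s i) (D.xImg s j l) (m (π 0) + s) (m (π 1)) +
        q⁻¹ • serreTwo (D.xImg s i) (D.xImg s j l) (m (π 0)) (m (π 1) + s))) = 0 := by
  set f : ℤ → Kq := fun k => (qi i - (qi i)⁻¹)⁻¹ * q ^ (-((i.val + 1 : ℤ) * k)) with hf
  set e : Kq := (qi j - (qi j)⁻¹)⁻¹ * q ^ (-((j.val + 1 : ℤ) * l)) with he
  have h0 : ∀ a b, serreTwo (D.xImg s i) (D.xImg s j l) a b =
      (f a * f b * e) • serreTwo (D.X s i) (D.X s j l) a b := fun a b =>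
    serreTwo_smul (D.X s i) (D.X s j l) a b f e
  have hff : ∀ a b, f a * f b = (qi i - (qi i)⁻¹)⁻¹ ^ 2 * q ^ (-((i.val + 1 : ℤ) * (a + b))) :=
    fun a b => by
      rw [hf, mul_add, neg_add, zpow_add₀ q_ne_zero]; ring
  have hq := q_ne_zero
  have hsum : ∀ π : Equiv.Perm (Fin 2), m (π 0) + m (π 1) = m 0 + m 1 := fun π => by
    have := Equiv.sum_comp π m
    rwa [Fin.sum_univ_two, Fin.sum_univ_two] at this
  simp only [h0, smul_smul, hff]
  rcases Int.units_eq_one_or s with rfl | rfl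
  · refine Eq.trans ?_ ((congrArg (fun y => (q⁻¹ * ((qi i - (qi i)⁻¹)⁻¹ ^ 2 *
      q ^ (-((i.val + 1 : ℤ) * (m 0 + m 1 + 1))) * e)) • y)
        (D.serre_two 1 i j hA m l)).trans (smul_zero _))
    rw [Finset.smul_sum]
    refine Finset.sum_congr rfl fun π _ => ?_
    rw [smul_add, smul_smul, ← hsum π]
    simp only [Units.val_one, mul_one]
    rw [show m (π 0) + 1 + m (π 1) = m (π 0) + m (π 1) + 1 by ring,
      show m (π 0) + (m (π 1) + 1) = m (π 0) + m (π 1) + 1 by ring]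
    congr 2
    have : (q : Kq) ^ (2 : ℤ) = q * q := by rw [← pow_two]; rfl
    rw [this]; field_simp
  -- For the lower sign the Drinfeld relation shifts modes down by one and the extended one shifts
  -- them up, so the latter is used at m - 1, where its two terms change places. The factor q turns
  -- the coefficients q⁻² and 1 into q⁻¹ and q.
  · refine Eq.trans ?_ ((congrArg (fun y => (q * ((qi i - (qi i)⁻¹)⁻¹ ^ 2 *
      q ^ (-((i.val + 1 : ℤ) * (m 0 + m 1 - 1))) * e)) • y)
        (D.serre_two (-1) i j hA (fun k => m k - 1) l)).trans (smul_zero _))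
    rw [Finset.smul_sum]
    refine Finset.sum_congr rfl fun π _ => ?_
    rw [smul_add, smul_smul, ← hsum π]
    simp only [Units.val_neg, Units.val_one, sub_add_cancel, ← sub_eq_add_neg]
    rw [show m (π 0) - 1 + m (π 1) = m (π 0) + m (π 1) - 1 by ring,
      show m (π 0) + (m (π 1) - 1) = m (π 0) + m (π 1) - 1 by ring, add_comm]
    have : (q : Kq) ^ (2 * -1 : ℤ) = q⁻¹ * q⁻¹ := by
      rw [show (2 * -1 : ℤ) = -1 + -1 by norm_num, zpow_add₀ hq, zpow_neg_one]
    rw [this]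
    congr 2
    · field_simp

theorem freeMap_rel {a b : Dr.Free n} (h : Dr.Rel n a b) : D.freeMap a = D.freeMap b := by
  induction h with
  | qc_mul => rw [map_mul, freeMap_qc, freeMap_qcInv, map_one, Units.mul_inv]
  | qcInv_mul => rw [map_mul, freeMap_qc, freeMap_qcInv, map_one, Units.inv_mul]
  | qc_central g => rw [map_mul, map_mul, freeMap_qc]; exact D.c_central _
  | x_odd s i hi m => rw [freeMap_x, xImg, D.X_odd s i hi _ ⟨m, rfl⟩, smul_zero, map_zero]
  | a_odd i hi l hl =>
    obtain ⟨s, r, hr, rfl⟩ := exists_sign_mul l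
    rw [freeMap_a, map_zero, D.aElt_mul s i hr, aImg]
    have hr' : Odd r := by
      rcases Int.units_eq_one_or s with rfl | rfl
      · simpa using hl
      · simpa using hl
    -- The odd generators at the last node vanish because the series ψ_n is even.
    have h1 := log_odd_eq_zero (F := D.psi (-s) i) (S := D.psiLog (-s) i)
      (u := (((D.hU i.castSucc * (D.hU i.succ)⁻¹) ^ (-(s : ℤ)) : Aˣ) : A))
      (D.eulerD_psi _ _) (by
        rw [D.psi_zero, ← Units.val_mul, ← zpow_add]; simp) (D.psi_odd _ i hi) hr'
    rw [h1, smul_zero]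
  | k_mul i => rw [map_mul, freeMap_k, freeMap_kInv, map_one, Units.mul_inv]
  | kInv_mul i => rw [map_mul, freeMap_k, freeMap_kInv, map_one, Units.inv_mul]
  | k_k i j =>
    rw [map_mul, map_mul, freeMap_k, freeMap_k, ← Units.val_mul, (D.kU_commute i j).eq, Units.val_mul]
  | k_a i j l =>
    obtain ⟨s, r, hr, rfl⟩ := exists_sign_mul l
    rw [map_mul, map_mul, freeMap_k, freeMap_a, D.aElt_mul s j hr]
    exact D.kU_commute_aImg i s j r
  | k_x s i j m =>
    rw [map_mul, map_mul, map_smul, freeMap_k, freeMap_kInv, freeMap_x, xImg, mul_smul_comm, kU_X,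
      smul_mul_assoc, smul_mul_assoc, mul_assoc, Units.mul_inv, mul_one, smul_comm, qi_zpow, form]
    congr 2; ring
  | a_a i j m l =>
    obtain ⟨s, r, hr, rfl⟩ := exists_sign_mul m
    obtain ⟨s', r', hr', rfl⟩ := exists_sign_mul l
    rw [map_sub, map_mul, map_mul, freeMap_a, freeMap_a, D.aElt_mul s i hr, D.aElt_mul s' j hr']
    rcases eq_or_ne s s' with rfl | hs
    -- Modes of equal sign never have total degree zero, so no central term occurs.
    · rw [(D.aImg_commute s i j r r').eq, sub_self, if_neg, map_zero]
      intro h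
      have h1 : (s : ℤ) * r = ((-s : ℤˣ) : ℤ) * r' := by push_cast; linarith
      have := (sign_mul_inj hr h1).1
      exact absurd this (by rcases Int.units_eq_one_or s with rfl | rfl <;> decide)
    · obtain rfl : s' = -s := by
        rcases Int.units_eq_one_or s with rfl | rfl <;>
          rcases Int.units_eq_one_or s' with rfl | rfl <;> simp_all
      rw [D.commutator_aImg s i j hr hr']
      by_cases h : r = r'
      · subst h
        rw [if_pos rfl, if_pos (by push_cast; ring), map_smul, map_sub, freeMap_qcPow, freeMap_qcPow]
      · rw [if_neg h, if_neg, map_zero]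
        intro h1
        have h2 : (s : ℤ) * r = (s : ℤ) * r' := by push_cast at h1; linarith
        exact h (sign_mul_inj hr h2).2
  | a_x s i j m l =>
    obtain ⟨σ, r, hr, rfl⟩ := exists_sign_mul m
    rw [map_sub, map_mul, map_mul, map_smul, map_mul, freeMap_a, freeMap_x, freeMap_x,
      D.aElt_mul σ i hr, D.commutator_aImg_xImg σ s i j hr, freeMap_qcPow]
    congr 5
    rcases Int.units_eq_one_or σ with rfl | rfl <;> simp
  | x_x i j m l =>
    rw [map_sub, map_mul, map_mul, freeMap_x, freeMap_x, rel_x_x]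
    split_ifs
    · rw [map_smul, map_sub, map_mul, map_mul, freeMap_qcPow, freeMap_qcPow]
    · rw [map_zero]
  | quad s i j m l =>
    simp only [map_sub, map_mul, map_smul, freeMap_x]
    exact D.rel_quad s i j m l
  | serre s i j hij hA m l =>
    rw [map_serre, map_zero]
    simp only [freeMap_x]
    have := serre_smul (qi i) (D.X s i) (D.X s j l) m
      (fun k => (qi i - (qi i)⁻¹)⁻¹ * q ^ (-((i.val + 1 : ℤ) * k)))
      ((qi j - (qi j)⁻¹)⁻¹ * q ^ (-((j.val + 1 : ℤ) * l)))
    rw [D.serre s i j hij hA, smul_zero] at this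
    exact this
  | serre_two s i j hA m l =>
    rw [map_sum, map_zero, ← D.rel_serre_two s i j hA m l]
    refine Finset.sum_congr rfl fun π _ => ?_
    rw [map_add, map_smul, map_smul, map_serreTwo, map_serreTwo]
    simp only [freeMap_x]

/-- The homomorphism from the quantum affine algebra. -/
def toHom : UqA n →ₐ[Kq] A := RingQuot.liftAlgHom Kq ⟨D.freeMap, fun _ _ => D.freeMap_rel⟩

theorem toHom_mk (y : Dr.Free n) : D.toHom (UqA.mk n y) = D.freeMap y :=
  RingQuot.liftAlgHom_mkAlgHom_apply _ _ _ _

end ExtData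

/-! ### The extended algebra as an instance of `ExtData` -/

namespace UqExt

variable {n : ℕ}

theorem h_zero_commute (s s' : ℤˣ) (i j : Fin (n + 1)) (b : ℕ) :
    Commute (h s i 0) (h s' j b) := by
  rcases eq_or_ne s s' with rfl | hs
  · exact h_commute _ _ _ _ _
  · have hs' : s' = -s := by
      rcases Int.units_eq_one_or s with rfl | rfl <;>
        rcases Int.units_eq_one_or s' with rfl | rfl <;> simp_all
    subst hs'
    let u : (UqExt n)ˣ := ⟨h (-s) i 0, h s i 0, h_zero_mul' _ _, h_zero_mul _ _⟩
    have h1 : Commute (u : UqExt n) (h (-s) j b) := h_commute _ _ _ _ _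
    exact h1.units_inv_left

theorem h_zero_commute_hLog (s s' : ℤˣ) (i j : Fin (n + 1)) (b : ℕ) :
    Commute (h s i 0) (PowerSeries.coeff b (hLog s' j)) := by
  have h1 : CoeffCommute (PowerSeries.C (h s i 0)) (hSer s' j) := fun a b => by
    rw [PowerSeries.coeff_C]
    split_ifs
    · rw [coeff_hSer]; exact h_zero_commute _ _ _ _ _
    · exact Commute.zero_left _
  have h2 := (h1.eulerD_right.mul_right
    (h1.inv_right (hSer_mul_hInvSer s' j) (hInvSer_mul_hSer s' j))) 0 b
  rwa [PowerSeries.coeff_zero_C] at h2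

/-- The unit `h^+_{j,0}`. -/
def hU (j : Fin (n + 1)) : (UqExt n)ˣ := ⟨h 1 j 0, h (-1) j 0, h_zero_mul _ _, h_zero_mul' _ _⟩

theorem hU_zpow (j : Fin (n + 1)) (s : ℤˣ) : ((hU j ^ (s : ℤ) : (UqExt n)ˣ) : UqExt n) = h s j 0 := by
  rcases Int.units_eq_one_or s with rfl | rfl
  · simp [hU]
  · simp [hU]

theorem hU_commute (i j : Fin (n + 1)) : Commute (hU (n := n) i) (hU j) :=
  Units.ext (h_commute 1 i j 0 0)

theorem hU_last {i : Fin n} (hi : IsLast i) : hU i.succ = (hU i.castSucc)⁻¹ :=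
  eq_inv_of_mul_eq_one_right (Units.ext (h_last i hi))

theorem hU_X (s : ℤˣ) (i : Fin (n + 1)) (j : Fin n) (l : ℤ) :
    (hU i : UqExt n) * X s j l = q ^ ((s : ℤ) * epsRoot' i j) • (X s j l * (hU i : UqExt n)) := by
  have := h_zero_X 1 s i j l
  rwa [Units.val_one, one_mul] at this

theorem psi_zero (s : ℤˣ) (i : Fin n) : PowerSeries.coeff 0 (psi s i) =
    (((hU i.castSucc * (hU i.succ)⁻¹) ^ (-(s : ℤ)) : (UqExt n)ˣ) : UqExt n) := by
  rw [(hU_commute i.castSucc i.succ).inv_right.mul_zpow, Units.val_mul, inv_zpow', neg_neg, hU_zpow,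
    ← Units.val_neg, hU_zpow, coeff_zero_psi, (h_zero_commute s (-s) _ _ 0).eq]

theorem mk_psiZ' (s : ℤˣ) (i : Fin n) (m : ℤ) : mk n (Ext.psiZ s i m) = signCoeff (psi s i) s m :=
  mk_psiZ s i m

theorem mk_Xq (s : ℤˣ) (i : Fin n) (m : ℤ) :
    mk n (Ext.Xq s i m) = q ^ (-((i.val + 1 : ℤ) * m)) • X s i m := by
  rw [Ext.Xq, map_smul, X]

/-- The generators of the extended algebra. -/
def data (hn : n ≠ 0) : ExtData n (UqExt n) where
  c := c
  X := X
  hU := hU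
  L := hLog
  psi := psi
  c_central := c_central
  hU_commute := hU_commute
  hU_L i s j r := h_zero_commute_hLog 1 s i j r
  hU_last i hi := hU_last hi
  hU_X := hU_X
  L_zero := coeff_zero_hLog
  L_comm := hLog_coeffCommute
  L_heis := heisComm_hLog hn
  L_X := commutator_hLog_X
  eulerD_psi := eulerD_psi
  psi_zero := psi_zero
  psi_odd s i hi m hm := coeff_psi_odd s i hi hm
  X_odd s i hi m hm := by
    obtain ⟨k, rfl⟩ := hm
    exact (mk_rel (Ext.Rel.X_odd s i hi k)).trans (map_zero _)
  X_X i j hj m l := by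
    have := mk_rel (Ext.Rel.X_X i j hj m l)
    rw [map_sub, map_mul, map_mul] at this
    refine this.trans ?_
    split_ifs
    · rw [map_smul, map_sub, map_mul, map_mul, mk_psiZ', mk_psiZ', mk_qcPow, mk_qcPow]
    · exact map_zero _
  X_X_last i j hj m l := by
    have := mk_rel (Ext.Rel.X_X_last i j hj m l)
    rw [map_sub, map_mul, map_mul] at this
    refine this.trans ?_
    have h1 : ∀ (P : Prop) [Decidable P] (a : Ext.Free n),
        mk n (if P then a else 0) = if P then mk n a else 0 := fun P _ a => by
      split_ifs
      · rfl
      · exact map_zero _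
    rw [h1, map_smul, map_sub, h1, h1, map_mul, map_mul, mk_psiZ', mk_psiZ', mk_qcPow, mk_qcPow]
  quad s i j hi hj m l := by
    have := mk_rel (Ext.Rel.quad s i j hi hj m l)
    simp only [map_sub, map_mul, map_smul, mk_Xq] at this
    exact this
  quad_last s i j hj m l := by
    have := mk_rel (Ext.Rel.quad_last s i j hj m l)
    simp only [map_sub, map_mul, map_smul, mk_Xq] at this
    exact this
  serre s i j hij hA m l := by
    have := mk_rel (Ext.Rel.serre s i j hij hA m l)
    rw [map_serre, map_zero] at this
    exact this
  serre_two s i j hA m l := by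
    have := mk_rel (Ext.Rel.serre_two s i j hA m l)
    simp only [map_sum, map_zero, map_add, map_smul, map_serreTwo] at this
    exact this

theorem isCurrentMap_toHom (hn : n ≠ 0) : IsCurrentMap n (data hn).toHom where
  map_qc := by
    rw [ExtData.toHom_mk, ExtData.freeMap_qcPow, mk_qcPow]; rfl
  map_k i hi := by
    have hc : (data hn).cLast i = 1 := if_neg hi
    rw [ExtData.toHom_mk, ExtData.freeMap_k, ExtData.kU, hc, one_mul, Units.val_mul]; rfl
  map_k_last i hi := by
    have hc : (data hn).cLast i = c ^ (2 : ℤ) := if_pos hi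
    have h1 : (data hn).hU i.succ = ((data hn).hU i.castSucc)⁻¹ := (data hn).hU_last i hi
    rw [ExtData.toHom_mk, ExtData.freeMap_k, ExtData.kU, hc, h1, inv_inv, Units.val_mul,
      Units.val_mul, mk_qcPow, pow_two]; rfl
  map_x s i m := by
    rw [ExtData.toHom_mk, ExtData.freeMap_x, ExtData.xImg_eq]; rfl
  map_phi s i hi m := by
    have hc : (data hn).cLast i = 1 := if_neg hi
    rw [ExtData.toHom_mk, ExtData.freeMap_phi, hc, one_zpow, Units.val_one, one_mul]; rfl
  map_phi_last s i hi m := by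
    have hc : (data hn).cLast i = c ^ (2 : ℤ) := if_pos hi
    rw [ExtData.toHom_mk, ExtData.freeMap_phi, hc, ← zpow_mul, mk_qcPow]; rfl

end UqExt

/-! ### Homomorphisms from the quantum affine algebra -/

theorem inv_unique_of_eq {A : Type*} [Ring A] {a a' b b' : A} (h1 : a * b = 1) (h2 : b' * a' = 1)
    (h : a = a') : b = b' := by
  subst h
  exact (left_inv_eq_right_inv h2 h1).symm

section DrRel

variable {n : ℕ} {A : Type*} [Ring A] [Algebra Kq A] {F : Dr.Free n →ₐ[Kq] A}

theorem Dr.aPart_commute (hF : ∀ ⦃a b⦄, Dr.Rel n a b → F a = F b)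
    (s : ℤˣ) (i j : Fin n) (r l : ℕ) :
    Commute (F (Dr.aPart s i r)) (F (Dr.aPart s j l)) := by
  rw [Dr.aPart, Dr.aPart]
  split_ifs with hr hl hl
  · rw [map_zero]
  · rw [map_zero]; exact Commute.zero_left _
  · rw [map_zero]; exact Commute.zero_right _
  · have := hF (Dr.Rel.a_a i j ⟨(s : ℤ) * r, mul_ne_zero s.ne_zero (Int.natCast_ne_zero.mpr hr)⟩
      ⟨(s : ℤ) * l, mul_ne_zero s.ne_zero (Int.natCast_ne_zero.mpr hl)⟩)
    rw [if_neg, map_zero, map_sub, map_mul, map_mul] at this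
    · exact sub_eq_zero.mp this
    · intro h
      have h1 : (s : ℤ) * r = ((-s : ℤˣ) : ℤ) * l := by push_cast; simpa using h
      have := (sign_mul_inj hr h1).1
      exact absurd this (by rcases Int.units_eq_one_or s with rfl | rfl <;> decide)

/-- The image of `k_i` as a unit. -/
def Dr.kUnit (hF : ∀ ⦃a b⦄, Dr.Rel n a b → F a = F b)
    (i : Fin n) : Aˣ where
  val := F (Dr.k i)
  inv := F (Dr.kInv i)
  val_inv := by rw [← map_mul, hF (Dr.Rel.k_mul i), map_one]
  inv_val := by rw [← map_mul, hF (Dr.Rel.kInv_mul i), map_one]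

theorem Dr.zpw_k (hF : ∀ ⦃a b⦄, Dr.Rel n a b → F a = F b)
    (s : ℤˣ) (i : Fin n) : zpw (F (Dr.k i)) (F (Dr.kInv i)) s =
    ((Dr.kUnit hF i ^ (s : ℤ) : Aˣ) : A) := by
  rw [← zpw_units]; rfl

theorem Dr.k_commute_aPart (hF : ∀ ⦃a b⦄, Dr.Rel n a b → F a = F b)
    (i : Fin n) (s : ℤˣ) (j : Fin n) (r : ℕ) :
    Commute (Dr.kUnit hF i : A) (F (Dr.aPart s j r)) := by
  rw [Dr.aPart]
  split_ifs with hr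
  · rw [map_zero]; exact Commute.zero_right _
  · have := hF (Dr.Rel.k_a i j ⟨(s : ℤ) * r, mul_ne_zero s.ne_zero (Int.natCast_ne_zero.mpr hr)⟩)
    rw [map_mul, map_mul] at this
    exact this

theorem Dr.eulerD_phiSer' (hF : ∀ ⦃a b⦄, Dr.Rel n a b → F a = F b)
    (s : ℤˣ) (i : Fin n) :
    eulerD (phiSer F s i) = phiLog F s i * phiSer F s i := by
  refine eulerD_phiSer _ _ _ (fun r r' => Dr.aPart_commute hF s i i r r') fun r => ?_
  rw [Dr.zpw_k hF]
  exact ((Dr.k_commute_aPart hF i s i r).symm.units_zpow_right _).symm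

/-- Homomorphisms from the quantum affine algebra are determined by the images of the series
`φ^±_i(u)` and of `x^±_{i,m}`, `k_i`, `q^{c/2}`. -/
theorem Dr.hom_ext (hF : ∀ ⦃a b⦄, Dr.Rel n a b → F a = F b)
    {F' : Dr.Free n →ₐ[Kq] A} (hF' : ∀ ⦃a b⦄, Dr.Rel n a b → F' a = F' b)
    (hc : F (FreeAlgebra.ι Kq DrGen.qc) = F' (FreeAlgebra.ι Kq DrGen.qc))
    (hx : ∀ s i m, F (Dr.x s i m) = F' (Dr.x s i m)) (hk : ∀ i, F (Dr.k i) = F' (Dr.k i))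
    (hphi : ∀ s i m, F (Dr.phi s i m) = F' (Dr.phi s i m)) : F = F' := by
  apply FreeAlgebra.hom_ext
  funext g
  rcases g with ⟨s, i, m⟩ | ⟨i, l⟩ | i | i | _ | _
  · exact hx s i m
  · obtain ⟨s, r, hr, rfl⟩ := exists_sign_mul l
    have h1 : phiSer F s i = phiSer F' s i := by
      ext m; simp only [phiSer, PowerSeries.coeff_mk, hphi]
    have h2 := Dr.eulerD_phiSer' hF s i
    have h3 := Dr.eulerD_phiSer' hF' s i
    rw [h1, h3] at h2
    -- The constant term of φ is k_i^{±1}, so φ is invertible. It can be cancelled from the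
    -- first-order equation, which exposes the a_{i,r}.
    have h4 : phiSer F' s i * invSeries ((Dr.kUnit hF' i ^ (-(s : ℤ)) : Aˣ) : A) (phiSer F' s i) = 1 := by
      apply mul_invSeries
      rw [coeff_zero_phiSer, Dr.zpw_k hF', ← Units.val_mul, ← zpow_add, add_neg_cancel, zpow_zero,
        Units.val_one]
    have h5 : phiLog F s i = phiLog F' s i := by
      calc phiLog F s i = phiLog F s i * phiSer F' s i *
            invSeries ((Dr.kUnit hF' i ^ (-(s : ℤ)) : Aˣ) : A) (phiSer F' s i) := by
            rw [mul_assoc, h4, mul_one]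
        _ = _ := by rw [← h2, mul_assoc, h4, mul_one]
    have h6 := congrArg (PowerSeries.coeff r) h5
    rw [phiLog, phiLog, PowerSeries.coeff_mk, PowerSeries.coeff_mk] at h6
    have h7 : ((s : ℤ) : Kq) * (qi i - (qi i)⁻¹) * r ≠ 0 := mul_ne_zero (mul_ne_zero
      (left_ne_zero_of_mul_eq_one (units_cast_mul_self s)) (qi_sub_ne_zero i))
      (Nat.cast_ne_zero.mpr hr)
    have h8 := smul_right_injective A h7 h6
    rw [Dr.aPart, dif_neg hr] at h8
    exact h8
  · exact hk i
  · refine inv_unique_of_eq (a := F (Dr.k i)) (a' := F' (Dr.k i)) ?_ ?_ (hk i)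
    · exact (Dr.kUnit hF i).mul_inv
    · exact (Dr.kUnit hF' i).inv_mul
  · exact hc
  · refine inv_unique_of_eq ?_ ?_ hc
    · exact (map_mul F _ _).symm.trans ((hF Dr.Rel.qc_mul).trans (map_one F))
    · exact (map_mul F' _ _).symm.trans ((hF' Dr.Rel.qcInv_mul).trans (map_one F'))

end DrRel

theorem UqA.mk_rel {n : ℕ} {a b : Dr.Free n} (h : Dr.Rel n a b) : UqA.mk n a = UqA.mk n b :=
  RingQuot.mkAlgHom_rel Kq h

theorem IsCurrentMap.unique {n : ℕ} {ς ς' : UqA n →ₐ[Kq] UqExt n} (h : IsCurrentMap n ς)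
    (h' : IsCurrentMap n ς') : ς = ς' := by
  apply RingQuot.ringQuot_ext'
  change ς.comp (UqA.mk n) = ς'.comp (UqA.mk n)
  have hq : Dr.qcPow (n := n) 1 = FreeAlgebra.ι Kq DrGen.qc := by simp [Dr.qcPow, zpw]
  refine Dr.hom_ext (F := ς.comp (UqA.mk n)) (fun a b hab => congrArg ς (UqA.mk_rel hab))
    (F' := ς'.comp (UqA.mk n)) (fun a b hab => congrArg ς' (UqA.mk_rel hab)) ?_ ?_ ?_ ?_
  · have h1 := h.map_qc.trans h'.map_qc.symm
    rw [hq] at h1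
    exact h1
  · exact fun s i m => (h.map_x s i m).trans (h'.map_x s i m).symm
  · intro i
    by_cases hi : IsLast i
    · exact (h.map_k_last i hi).trans (h'.map_k_last i hi).symm
    · exact (h.map_k i hi).trans (h'.map_k i hi).symm
  · intro s i m
    by_cases hi : IsLast i
    · exact (h.map_phi_last s i hi m).trans (h'.map_phi_last s i hi m).symm
    · exact (h.map_phi s i hi m).trans (h'.map_phi s i hi m).symm

/-! ### Coefficients of the inverse homomorphism -/

/-- The coefficients expressing the logarithmic derivatives of `h^±_{i+1}(u)` in the Heisenberg
generators of the nodes. -/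
def logCoef (n : ℕ) (s : ℤˣ) (i k r : ℕ) : Kq :=
  (if k < i then 1 else 0) - weight n (qr s r) ((-1) ^ r) k / (qr s r ^ (2 * n : ℤ) + (-1) ^ r)

theorem sum_range_lt_ite {M : Type*} [AddCommGroup M] {n i : ℕ} (hi : i ≤ n) (f : ℕ → M) :
    (∑ k ∈ Finset.range n, if k < i then f k else 0) = ∑ k ∈ Finset.range i, f k := by
  rw [← Finset.sum_filter]
  congr 1
  ext k
  simp only [Finset.mem_filter, Finset.mem_range]
  omega

/-- The indicator part of `logCoef` telescopes to the value at i minus the value at 0, and the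
weights supply the value at 0. -/
theorem sum_logCoef_gam {n : ℕ} (hn : 2 ≤ n) (s : ℤˣ) {i j : ℕ} (r : ℕ) (hi : i ≤ n) (hj : j < n) :
    ∑ k ∈ Finset.range n, logCoef n s i k r *
      (gam n (qr s r) ((-1) ^ r) (k + 1) j - gam n (qr s r) ((-1) ^ r) k j) =
      gam n (qr s r) ((-1) ^ r) i j := by
  have h0 := xi_denom_ne_zero (show n ≠ 0 by omega) s r
  have h1 := sum_weight_gam_left hn (qr_ne_zero s r) (neg_one_pow_eq_or Kq r) hj
  have h2 : ∀ k ∈ Finset.range n, logCoef n s i k r *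
      (gam n (qr s r) ((-1) ^ r) (k + 1) j - gam n (qr s r) ((-1) ^ r) k j) =
      (if k < i then gam n (qr s r) ((-1) ^ r) (k + 1) j - gam n (qr s r) ((-1) ^ r) k j else 0) -
      (qr s r ^ (2 * n : ℤ) + (-1) ^ r)⁻¹ * (weight n (qr s r) ((-1) ^ r) k *
        (gam n (qr s r) ((-1) ^ r) (k + 1) j - gam n (qr s r) ((-1) ^ r) k j)) := fun k _ => by
    rw [logCoef]; split_ifs <;> ring
  rw [Finset.sum_congr rfl h2, Finset.sum_sub_distrib, sum_range_lt_ite hi,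
    Finset.sum_range_sub (fun k => gam n (qr s r) ((-1) ^ r) k j), ← Finset.mul_sum, h1,
    ← mul_assoc, mul_neg, inv_mul_cancel₀ h0]
  ring

/-- The same telescoping in the second argument, after writing `gam` as a difference of `pij`; the
boundary term at 0 cancels by `sum_weight_gam_right`. -/
theorem sum_logCoef_pij {n : ℕ} (hn : 2 ≤ n) (s : ℤˣ) {i j : ℕ} (r : ℕ) (hi : i ≤ n) (hj : j ≤ n) :
    ∑ k ∈ Finset.range n, logCoef n (-s) j k r * gam n (qr s r) ((-1) ^ r) i k =
      -pij n (qr s r) r i j := by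
  have h0 := xi_denom_ne_zero (show n ≠ 0 by omega) (-s) r
  have h1 := sum_weight_gam_right hn (qr_ne_zero s r) (one_add_qr_ne_zero (show n ≠ 0 by omega) s r) hi
  rw [qr_neg] at h0
  have h2 : ∀ k ∈ Finset.range n, logCoef n (-s) j k r * gam n (qr s r) ((-1) ^ r) i k =
      (if k < j then -pij n (qr s r) r i (k + 1) - -pij n (qr s r) r i k else 0) -
      ((qr s r)⁻¹ ^ (2 * n : ℤ) + (-1) ^ r)⁻¹ * (weight n (qr s r)⁻¹ ((-1) ^ r) k *
        gam n (qr s r) ((-1) ^ r) i k) := fun k hk => by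
    rw [logCoef, qr_neg, ← pij_sub n (qr s r) r i k hi (Finset.mem_range.mp hk)]
    split_ifs <;> ring
  rw [Finset.sum_congr rfl h2, Finset.sum_sub_distrib, sum_range_lt_ite hj,
    Finset.sum_range_sub (fun k => -pij n (qr s r) r i k), ← Finset.mul_sum, h1,
    ← mul_assoc, inv_mul_cancel₀ h0]
  ring

/-! ### Drinfeld's relations with a square root of k_n, and the constant terms of the h's -/

/-- Elements of an algebra subject to the relations of the quantum affine algebra, together with a
square root `K` of `k_n`. -/
structure DrData (n : ℕ) (A : Type*) [Ring A] [Algebra Kq A] where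
  c : Aˣ
  K : Aˣ
  kU : Fin n → Aˣ
  x : ℤˣ → Fin n → ℤ → A
  a : ℤˣ → Fin n → ℕ → A
  phi : ℤˣ → Fin n → A⟦X⟧
  c_central : ∀ y, Commute (c : A) y
  K_kU : ∀ i, Commute K (kU i)
  kU_commute : ∀ i j, Commute (kU i) (kU j)
  K_sq : ∀ i, IsLast i → kU i = K * K
  K_a : ∀ s i r, Commute (K : A) (a s i r)
  kU_a : ∀ i s j r, Commute (kU i : A) (a s j r)
  K_x : ∀ i : Fin n, IsLast i → ∀ (s : ℤˣ) j l,
    (K : A) * x s j l = q ^ ((s : ℤ) * epsRoot' i.castSucc j) • (x s j l * (K : A))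
  kU_x : ∀ i (s : ℤˣ) j l, (kU i : A) * x s j l = q ^ ((s : ℤ) * form i j) • (x s j l * (kU i : A))
  a_zero : ∀ s i, a s i 0 = 0
  a_odd : ∀ s i, IsLast i → ∀ r, Odd r → a s i r = 0
  a_commute : ∀ s i j r l, Commute (a s i r) (a s j l)
  a_heis : ∀ (s : ℤˣ) i j r l, r ≠ 0 → l ≠ 0 → a s i r * a (-s) j l - a (-s) j l * a s i r =
      if r = l then (Dr.heis i j (s * r) / (qi j - (qi j)⁻¹)) •
        (((c ^ (2 * (s * r) : ℤ) : Aˣ) : A) - ((c ^ (-(2 * (s * r)) : ℤ) : Aˣ) : A)) else 0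
  a_x : ∀ (s σ : ℤˣ) i j r l, r ≠ 0 → a s i r * x σ j l - x σ j l * a s i r =
      (((σ : ℤ) : Kq) * Dr.heis i j (s * r)) •
        (((c ^ (-((σ : ℤ) * r)) : Aˣ) : A) * x σ j (s * r + l))
  eulerD_phi : ∀ s i, eulerD (phi s i) =
    (PowerSeries.mk fun r => (((s : ℤ) : Kq) * (qi i - (qi i)⁻¹) * r) • a s i r) * phi s i
  phi_zero : ∀ s i, PowerSeries.coeff 0 (phi s i) = ((kU i ^ (s : ℤ) : Aˣ) : A)
  x_odd : ∀ (s : ℤˣ) i, IsLast i → ∀ m, Odd m → x s i m = 0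
  x_x : ∀ i j m l, x 1 i m * x (-1) j l - x (-1) j l * x 1 i m =
    if i = j ∧ (d j : ℤ) ∣ l then (qi i - (qi i)⁻¹)⁻¹ •
        (((c ^ (m - l) : Aˣ) : A) * signCoeff (phi 1 i) 1 (m + l) -
          ((c ^ (-(m - l)) : Aˣ) : A) * signCoeff (phi (-1) i) (-1) (m + l)) else 0
  quad : ∀ (s : ℤˣ) i j m l, x s i (m + dd i j) * x s j l -
        qi i ^ ((s : ℤ) * cartan i j) • (x s j l * x s i (m + dd i j)) =
      qi i ^ ((s : ℤ) * cartan i j) • (x s i m * x s j (l + dd i j)) -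
        x s j (l + dd i j) * x s i m
  serre : ∀ (s : ℤˣ) i j, i ≠ j → cartan i j = 0 ∨ cartan i j = -1 →
    ∀ (m : Fin (1 - cartan i j).toNat → ℤ) l, TwistedAffine.serre (qi i) (x s i) (x s j l) m = 0
  serre_two : ∀ (s : ℤˣ) i j, cartan i j = -2 → ∀ (m : Fin 2 → ℤ) l,
    (∑ π : Equiv.Perm (Fin 2),
      (q • serreTwo (x s i) (x s j l) (m (π 0) + s) (m (π 1)) +
        q⁻¹ • serreTwo (x s i) (x s j l) (m (π 0)) (m (π 1) + s))) = 0

theorem units_commute {A : Type*} [Ring A] {u v : Aˣ} (h : Commute (u : A) v) : Commute u v := Units.ext h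

/-- With c standing for q^{c/2}, the left side is the value given to h^+_{n+1,0}, and the inverse on
the right is that of the value forced on h^+_{n,0}, namely c⁻¹ K. So this is the relation h^+_{n,0}
h^+_{n+1,0} = 1. -/
theorem mul_inv_eq_aux {G : Type*} [Group G] {c K : G} (hc : Commute c K) :
    c * K⁻¹ = ((c ^ (2 : ℤ))⁻¹ * (K * K * (c * K⁻¹)))⁻¹ := by
  have h1 : K * K * (c * K⁻¹) = c * K := by
    rw [← mul_assoc, mul_assoc K K c, ← hc.eq, ← mul_assoc, ← hc.eq, mul_assoc, mul_inv_cancel,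
      mul_one]
  have h2 : (c ^ (2 : ℤ))⁻¹ * (c * K) = c⁻¹ * K := by group
  rw [h1, h2, mul_inv_rev, inv_inv, hc.inv_right.eq]

namespace DrData

variable {n : ℕ} {A : Type*} [Ring A] [Algebra Kq A] (D : DrData n A)

/-- `1` or `q^c`. -/
def cLast (i : Fin n) : Aˣ := if IsLast i then D.c ^ (2 : ℤ) else 1

theorem cLast_central (i : Fin n) (y : A) : Commute (D.cLast i : A) y := by
  rw [cLast]; split_ifs
  · exact central_zpow D.c_central 2 y
  · rw [Units.val_one]; exact Commute.one_left y

/-- The image of `h^+_{j,0}`. -/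
def hU (j : Fin (n + 1)) : Aˣ :=
  Fin.reverseInduction (motive := fun _ => Aˣ) (D.c * D.K⁻¹)
    (fun i u => (D.cLast i)⁻¹ * (D.kU i * u)) j

theorem hU_last' : D.hU (Fin.last n) = D.c * D.K⁻¹ := by
  rw [hU, Fin.reverseInduction_last]

theorem hU_castSucc (i : Fin n) : D.hU i.castSucc = (D.cLast i)⁻¹ * (D.kU i * D.hU i.succ) := by
  rw [hU, Fin.reverseInduction_castSucc]; rfl

theorem commute_hU {y : A} (hK : Commute (D.K : A) y) (hk : ∀ i, Commute (D.kU i : A) y)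
    (j : Fin (n + 1)) : Commute (D.hU j : A) y := by
  induction j using Fin.reverseInduction with
  | last =>
    rw [hU_last', Units.val_mul]
    exact (D.c_central y).mul_left hK.units_inv_left
  | cast i ih =>
    rw [hU_castSucc, Units.val_mul, Units.val_mul]
    exact (D.cLast_central i y).units_inv_left.mul_left ((hk i).mul_left ih)

theorem hU_commute (i j : Fin (n + 1)) : Commute (D.hU i) (D.hU j) := by
  have h : ∀ u v : Aˣ, Commute u v → Commute (u : A) (v : A) := fun u v huv => by
    have := congrArg Units.val huv.eq
    exact this
  refine units_commute (D.commute_hU ?_ (fun k => ?_) i)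
  · exact (D.commute_hU (Commute.refl _) (fun k => h _ _ (D.K_kU k).symm) j).symm
  · exact (D.commute_hU (h _ _ (D.K_kU k)) (fun k' => h _ _ (D.kU_commute k' k)) j).symm

theorem hU_a (j : Fin (n + 1)) (s : ℤˣ) (i : Fin n) (r : ℕ) : Commute (D.hU j : A) (D.a s i r) :=
  D.commute_hU (D.K_a s i r) (fun k => D.kU_a k s i r) j

theorem hU_succ_last (i : Fin n) (hi : IsLast i) : D.hU i.succ = (D.hU i.castSucc)⁻¹ := by
  have h1 : i.succ = Fin.last n := Fin.ext (by simpa using hi)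
  rw [hU_castSucc, h1, hU_last', D.K_sq i hi, cLast, if_pos hi]
  exact mul_inv_eq_aux (units_commute (D.c_central D.K))

theorem inv_x {u : Aˣ} {y : A} {e : ℤ} (h : (u : A) * y = q ^ e • (y * (u : A))) :
    ((u⁻¹ : Aˣ) : A) * y = q ^ (-e) • (y * ((u⁻¹ : Aˣ) : A)) := by
  have h1 := congrArg (fun z : A => ((u⁻¹ : Aˣ) : A) * z * ((u⁻¹ : Aˣ) : A)) h
  simp only [← mul_assoc, Units.inv_mul, one_mul, mul_smul_comm, smul_mul_assoc] at h1
  rw [mul_assoc _ (u : A), Units.mul_inv, mul_one] at h1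
  rw [h1, smul_smul, ← zpow_add₀ q_ne_zero, neg_add_cancel, zpow_zero, one_smul]

theorem mul_x {u v y : A} {e e' : ℤ} (h : u * y = q ^ e • (y * u)) (h' : v * y = q ^ e' • (y * v)) :
    u * v * y = q ^ (e + e') • (y * (u * v)) := by
  rw [mul_assoc, h', mul_smul_comm, ← mul_assoc, h, smul_mul_assoc, smul_smul,
    ← zpow_add₀ q_ne_zero, mul_assoc, add_comm]

theorem central_x {u y : A} (h : Commute u y) : u * y = q ^ (0 : ℤ) • (y * u) := by
  rw [zpow_zero, one_smul]; exact h

/-- Downward induction on weights: K⁻¹ has weight -ε_n = ε_{n+1}, and each k_i adds α_i = ε_i -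
ε_{i+1}, including i = n under this convention. -/
theorem hU_x (hn : n ≠ 0) (i : Fin (n + 1)) (s : ℤˣ) (j : Fin n) (l : ℤ) :
    (D.hU i : A) * D.x s j l = q ^ ((s : ℤ) * epsRoot' i j) • (D.x s j l * (D.hU i : A)) := by
  induction i using Fin.reverseInduction with
  | last =>
    have h0 : n - 1 < n := by omega
    have hi : IsLast (⟨n - 1, h0⟩ : Fin n) := by simp [IsLast]; omega
    have h1 : Fin.last n = Fin.succ ⟨n - 1, h0⟩ := Fin.ext (by simp; omega)
    have h2 := mul_x (central_x (D.c_central (D.x s j l))) (inv_x (D.K_x _ hi s j l))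
    rw [hU_last', Units.val_mul, h2]
    congr 2
    rw [h1, epsRoot'_last _ _ hi]; ring
  | cast i ih =>
    have h2 := mul_x (central_x (D.cLast_central i (D.x s j l)).units_inv_left)
      (mul_x (D.kU_x i s j l) ih)
    rw [hU_castSucc, Units.val_mul, Units.val_mul, h2]
    congr 2
    rw [← epsRoot'_sub_eq i j]; ring

/-! #### Logarithmic derivatives -/

/-- The logarithmic derivative of `h^s_{k+1}(u) h^s_k(u)^{-1}`. -/
def beta (s : ℤˣ) (k : Fin n) (r : ℕ) : A := aCoef (-s) k r • D.a (-s) k r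

/-- The image of `X^s_{i,m}`. -/
def X (s : ℤˣ) (i : Fin n) (m : ℤ) : A :=
  ((qi i - (qi i)⁻¹) * q ^ ((i.val + 1 : ℤ) * m)) • D.x s i m

theorem gamDiff_neg (s : ℤˣ) (i j : Fin n) (r : ℕ) : gamDiff (-s) i j r =
    gam n (qr s r) ((-1) ^ r) (i + 1) j - gam n (qr s r) ((-1) ^ r) i j := by
  rw [gamDiff, neg_neg]

theorem beta_zero (s : ℤˣ) (k : Fin n) : D.beta s k 0 = 0 := by
  rw [beta, D.a_zero, smul_zero]

theorem commutator_beta_X (s σ : ℤˣ) (k j : Fin n) {r : ℕ} (hr : r ≠ 0) (l : ℤ) :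
    D.beta s k r * D.X σ j l - D.X σ j l * D.beta s k r =
      (((σ : ℤ) : Kq) * gamDiff (-s) k j r) •
        (((D.c ^ (-((σ : ℤ) * r)) : Aˣ) : A) * D.X σ j (l - s * r)) := by
  have e : l - s * r = ((-s : ℤˣ) : ℤ) * r + l := by push_cast; ring
  rw [beta, X, X, comm_smul_aux, D.a_x _ _ _ _ _ _ hr, smul_smul, mul_smul_comm, smul_smul,
    gamDiff_eq (-s) k j hr, e]
  congr 1
  have h2 : q ^ ((j.val + 1 : ℤ) * l) = q ^ (-(((-s : ℤˣ) : ℤ) * (j.val + 1 : ℤ) * r)) *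
      q ^ ((j.val + 1 : ℤ) * (((-s : ℤˣ) : ℤ) * r + l)) := by
    rw [← zpow_add₀ q_ne_zero]; congr 1; ring
  rw [h2]; ring

theorem beta_commute (s : ℤˣ) (i j : Fin n) (r l : ℕ) : Commute (D.beta s i r) (D.beta s j l) :=
  ((D.a_commute _ _ _ _ _).smul_left _).smul_right _

/-- The central element `q^{rc} - q^{-rc}`. -/
def cDiff (r : ℕ) : A := ((D.c ^ (2 * r : ℤ) : Aˣ) : A) - ((D.c ^ (-(2 * r) : ℤ) : Aˣ) : A)

theorem cDiff_sign (s : ℤˣ) (r : ℕ) : ((D.c ^ (2 * (s * r) : ℤ) : Aˣ) : A) -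
    ((D.c ^ (-(2 * (s * r)) : ℤ) : Aˣ) : A) = ((s : ℤ) : Kq) • D.cDiff r := by
  rcases Int.units_eq_one_or s with rfl | rfl
  · simp [cDiff]
  · have h : ((((-1 : ℤˣ) : ℤ) : Kq)) • D.cDiff r = -D.cDiff r := by
      have : ((((-1 : ℤˣ) : ℤ) : Kq)) = -1 := by push_cast; rfl
      rw [this]; exact neg_one_smul Kq _
    rw [h, cDiff, neg_sub]
    simp

theorem commutator_beta (s : ℤˣ) (i j : Fin n) (r l : ℕ) :
    D.beta s i r * D.beta (-s) j l - D.beta (-s) j l * D.beta s i r =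
      if r = l then (-(r * gamDiff (-s) i j r)) • D.cDiff r else 0 := by
  rcases Nat.eq_zero_or_pos r with rfl | hr
  · simp [beta_zero]
  rcases Nat.eq_zero_or_pos l with rfl | hl
  · simp [beta_zero, hr.ne']
  have h1 := D.a_heis (-s) i j r l hr.ne' hl.ne'
  rw [neg_neg] at h1
  rw [beta, beta, comm_smul_aux, neg_neg, h1]
  by_cases h : r = l
  · subst h
    rw [if_pos rfl, if_pos rfl, D.cDiff_sign, smul_smul, smul_smul, gamDiff_eq (-s) i j hr.ne']
    congr 1
    have h3 : aCoef s j r = q ^ (-(((-s : ℤˣ) : ℤ) * (j.val + 1 : ℤ) * r)) *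
        (((s : ℤ) : Kq) * (qi j - (qi j)⁻¹) * r) := by
      rw [aCoef]; congr 2; push_cast; ring
    have h4 : (((-s : ℤˣ) : ℤ) : Kq) = -((s : ℤ) : Kq) := by push_cast; rfl
    have h5 := units_cast_mul_self s
    have h6 := inv_mul_cancel₀ (qi_sub_ne_zero j)
    rw [h3, h4, div_eq_mul_inv]
    generalize qi j - (qi j)⁻¹ = w at *
    generalize aCoef (-s) i r = α
    generalize q ^ (-(((-s : ℤˣ) : ℤ) * (j.val + 1 : ℤ) * r)) = β
    generalize Dr.heis i j (((-s : ℤˣ) : ℤ) * (r : ℤ)) = η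
    generalize ((s : ℤ) : Kq) = σ at *
    linear_combination (-α * β * r * η * (w⁻¹ * w)) * h5 - α * β * r * η * h6
  · rw [if_neg h, if_neg h, smul_zero]

/-- The logarithmic derivative of the image of `h^s_i(u)`. -/
def L (s : ℤˣ) (i : Fin (n + 1)) : A⟦X⟧ :=
  PowerSeries.mk fun r => ∑ k : Fin n, logCoef n s i k r • D.beta s k r

theorem sum_comm_smul (f : Fin n → Kq) (g : Fin n → A) (y : A) :
    (∑ k, f k • g k) * y - y * (∑ k, f k • g k) = ∑ k, f k • (g k * y - y * g k) := by
  simp only [Finset.sum_mul, Finset.mul_sum, ← Finset.sum_sub_distrib, smul_sub, smul_mul_assoc,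
    mul_smul_comm]

theorem L_zero (s : ℤˣ) (i : Fin (n + 1)) : PowerSeries.coeff 0 (D.L s i) = 0 := by
  simp only [L, PowerSeries.coeff_mk, beta_zero, smul_zero, Finset.sum_const_zero]

theorem L_commute (s : ℤˣ) (i j : Fin (n + 1)) : CoeffCommute (D.L s i) (D.L s j) := by
  intro a b
  simp only [L, PowerSeries.coeff_mk]
  exact Commute.sum_left _ _ _ fun k _ => Commute.sum_right _ _ _ fun k' _ =>
    ((D.beta_commute _ _ _ _ _).smul_left _).smul_right _

theorem hU_L (i : Fin (n + 1)) (s : ℤˣ) (j : Fin (n + 1)) (r : ℕ) :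
    Commute (D.hU i : A) (PowerSeries.coeff r (D.L s j)) := by
  simp only [L, PowerSeries.coeff_mk]
  exact Commute.sum_right _ _ _ fun k _ => ((D.hU_a i _ k r).smul_right _).smul_right _

/-- The weight part of `logCoef` does not depend on i and cancels; the indicators differ only at k =
i. -/
theorem L_sub (s : ℤˣ) (i : Fin n) (r : ℕ) : PowerSeries.coeff r (D.L s i.succ - D.L s i.castSucc) =
    D.beta s i r := by
  simp only [L, map_sub, PowerSeries.coeff_mk, ← Finset.sum_sub_distrib, ← sub_smul]
  rw [Finset.sum_eq_single i]
  · rw [logCoef, logCoef, Fin.val_succ, Fin.val_castSucc, if_pos (by omega), if_neg (by omega)]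
    rw [sub_sub_sub_cancel_right, sub_zero, one_smul]
  · intro k _ hk
    have hk' : k.val ≠ i.val := fun h => hk (Fin.ext h)
    rw [logCoef, logCoef, Fin.val_succ, Fin.val_castSucc, sub_sub_sub_cancel_right]
    by_cases h : k.val < i.val
    · rw [if_pos (by omega), if_pos h, sub_self, zero_smul]
    · rw [if_neg (by omega), if_neg h, sub_self, zero_smul]
  · intro h; exact absurd (Finset.mem_univ i) h

theorem sum_gamDiff (hn : 2 ≤ n) (s : ℤˣ) (i : Fin (n + 1)) (j : Fin n) (r : ℕ) :
    ∑ k : Fin n, logCoef n s i k r * gamDiff (-s) k j r = gam n (qr s r) ((-1) ^ r) i j := by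
  simp only [gamDiff_neg]
  rw [← sum_logCoef_gam hn s r (Nat.lt_succ_iff.mp i.isLt) j.isLt, Finset.sum_range]

theorem L_X (hn : 2 ≤ n) (s σ : ℤˣ) (i : Fin (n + 1)) (j : Fin n) (r : ℕ) (l : ℤ) :
    PowerSeries.coeff r (D.L s i) * D.X σ j l - D.X σ j l * PowerSeries.coeff r (D.L s i) =
      (((σ : ℤ) : Kq) * gam n (qr s r) ((-1) ^ r) i j) •
        (((D.c ^ (-((σ : ℤ) * r)) : Aˣ) : A) * D.X σ j (l - s * r)) := by
  rcases Nat.eq_zero_or_pos r with rfl | hr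
  · have h1 : gam n (qr s 0) ((-1) ^ 0) i j = 0 := by
      simp [gam, qr]
    rw [L_zero, h1]; simp
  rw [L, PowerSeries.coeff_mk, sum_comm_smul]
  simp only [D.commutator_beta_X s σ _ j hr.ne' l, smul_smul]
  rw [← Finset.sum_smul, ← sum_gamDiff hn s i j r, Finset.mul_sum]
  congr 1
  exact Finset.sum_congr rfl fun k _ => by ring

theorem commutator_L_beta (hn : 2 ≤ n) (s : ℤˣ) (i : Fin (n + 1)) (j : Fin n) (r l : ℕ) :
    PowerSeries.coeff r (D.L s i) * D.beta (-s) j l - D.beta (-s) j l * PowerSeries.coeff r (D.L s i) =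
      if r = l then (-(r * gam n (qr s r) ((-1) ^ r) i j)) • D.cDiff r else 0 := by
  rw [L, PowerSeries.coeff_mk, sum_comm_smul]
  simp only [D.commutator_beta s _ j r l]
  split_ifs
  · simp only [smul_smul]
    rw [← Finset.sum_smul, ← sum_gamDiff hn s i j r, Finset.mul_sum, ← Finset.sum_neg_distrib]
    congr 1
    exact Finset.sum_congr rfl fun k _ => by ring
  · simp

/-- Contract the two arguments one after the other: `commutator_L_beta` handles the first and yields
`gam`, and `sum_logCoef_pij` handles the second. -/
theorem L_heis (hn : 2 ≤ n) (s : ℤˣ) (i j : Fin (n + 1)) :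
    HeisComm (D.L s i) (D.L (-s) j) (PowerSeries.mk fun r => pij n (qr s r) r i j •
      (((D.c ^ (2 * r : ℤ) : Aˣ) : A) - ((D.c ^ (-(2 * r) : ℤ) : Aˣ) : A))) := by
  intro r l
  have h1 : ∀ y : A, y * PowerSeries.coeff l (D.L (-s) j) - PowerSeries.coeff l (D.L (-s) j) * y =
      ∑ k : Fin n, logCoef n (-s) j k l • (y * D.beta (-s) k l - D.beta (-s) k l * y) := fun y => by
    rw [L, PowerSeries.coeff_mk, ← neg_sub, sum_comm_smul, ← Finset.sum_neg_distrib]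
    exact Finset.sum_congr rfl fun k _ => by rw [← smul_neg, neg_sub]
  rw [h1]
  simp only [D.commutator_L_beta hn s i _ r l]
  split_ifs with h
  · subst h
    have h2 := sum_logCoef_pij hn s r (Nat.lt_succ_iff.mp i.isLt) (Nat.lt_succ_iff.mp j.isLt)
    rw [Finset.sum_range] at h2
    simp only [smul_smul]
    rw [← Finset.sum_smul, PowerSeries.coeff_mk, ← Nat.cast_smul_eq_nsmul Kq, smul_smul]
    change _ = _ • D.cDiff r
    congr 1
    have h3 : (r : Kq) * pij n (qr s r) r i j = -(r * -pij n (qr s r) r i j) := by ring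
    rw [h3, ← h2, Finset.mul_sum, ← Finset.sum_neg_distrib]
    exact Finset.sum_congr rfl fun k _ => by ring
  · simp

end DrData

section Exp

variable {A : Type*} [Ring A] [Algebra Kq A]

theorem commute_coeff_expSeries {S : A⟦X⟧} {y : A} (h : ∀ r, Commute y (PowerSeries.coeff r S))
    (m : ℕ) : Commute y (PowerSeries.coeff m (expSeries S)) := by
  rw [expSeries, PowerSeries.coeff_mk]
  refine Commute.sum_right _ _ _ fun N _ => Commute.smul_right ?_ _
  exact commute_C_iff.mp ((commute_C_iff.mpr h).pow_right N) m

/-- In m F_m = ∑ S_a F_b with a + b = m odd, one of a, b is odd; S_0 = 0 makes the induction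
possible. -/
theorem even_of_log_even {F S : A⟦X⟧} (hF : eulerD F = S * F)
    (h0 : PowerSeries.coeff 0 S = 0) (hodd : ∀ m, Odd m → PowerSeries.coeff m S = 0) {m : ℕ} (hm : Odd m) :
    PowerSeries.coeff m F = 0 := by
  induction m using Nat.strong_induction_on with
  | _ m ih =>
    have h1 := congrArg (PowerSeries.coeff m) hF
    rw [coeff_eulerD, PowerSeries.coeff_mul, Finset.sum_eq_zero] at h1
    · exact nsmul_cancel (m := m) (by rintro rfl; simp at hm) (by rw [h1, smul_zero])
    · intro p hp
      have hp' := Finset.HasAntidiagonal.mem_antidiagonal.mp hp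
      rcases Nat.even_or_odd p.1 with h2 | h2
      · have h3 : Odd p.2 := by
          rcases Nat.even_or_odd p.2 with h3 | h3
          · exact absurd (hp' ▸ h2.add h3) (Nat.not_even_iff_odd.mpr hm)
          · exact h3
        rcases Nat.eq_zero_or_pos p.1 with h4 | h4
        · rw [h4, h0, zero_mul]
        · rw [ih p.2 (by omega) h3, mul_zero]
      · rw [hodd _ h2, zero_mul]

end Exp

/-! ### Reconstruction of the series h and verification of the extended relations -/

namespace DrData

variable {n : ℕ} {A : Type*} [Ring A] [Algebra Kq A] (D : DrData n A)

/-- The logarithm of the image of `h^s_i(u)`, up to the constant term. -/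
def logH (s : ℤˣ) (i : Fin (n + 1)) : A⟦X⟧ :=
  PowerSeries.mk fun r => (r : Kq)⁻¹ • PowerSeries.coeff r (D.L s i)

theorem eulerD_logH (s : ℤˣ) (i : Fin (n + 1)) : eulerD (D.logH s i) = D.L s i := by
  ext r
  rw [coeff_eulerD, logH, PowerSeries.coeff_mk]
  rcases Nat.eq_zero_or_pos r with rfl | hr
  · rw [zero_smul, L_zero]
  · rw [← Nat.cast_smul_eq_nsmul Kq, smul_smul, mul_inv_cancel₀ (Nat.cast_ne_zero.mpr hr.ne'),
      one_smul]

/-- The image of `h^s_i(u)`. -/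
def H (s : ℤˣ) (i : Fin (n + 1)) : A⟦X⟧ :=
  PowerSeries.C ((D.hU i ^ (s : ℤ) : Aˣ) : A) * expSeries (D.logH s i)

theorem commute_coeff_H {y : A} {s : ℤˣ} {i : Fin (n + 1)} (h0 : Commute y (D.hU i : A))
    (h : ∀ r, Commute y (PowerSeries.coeff r (D.L s i))) (m : ℕ) :
    Commute y (PowerSeries.coeff m (D.H s i)) := by
  rw [H, PowerSeries.coeff_C_mul]
  refine (h0.units_zpow_right _).mul_right (commute_coeff_expSeries (fun r => ?_) m)
  rw [logH, PowerSeries.coeff_mk]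
  exact (h r).smul_right _

theorem eulerD_H (s : ℤˣ) (i : Fin (n + 1)) : eulerD (D.H s i) = D.L s i * D.H s i := by
  have h1 : CoeffCommute (D.logH s i) (D.logH s i) := fun a b => by
    rw [logH, PowerSeries.coeff_mk, PowerSeries.coeff_mk]
    exact ((D.L_commute s i i a b).smul_left _).smul_right _
  rw [H, eulerD_C_mul, eulerD_expSeries (by simp [logH, L_zero, -PowerSeries.coeff_zero_eq_constantCoeff])
    h1.eulerD_right.commute, eulerD_logH, ← mul_assoc, ← mul_assoc]
  congr 1
  exact commute_C_iff.mpr fun r => ((D.hU_L i s i r).symm.units_zpow_right _).symm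

theorem coeff_zero_H (s : ℤˣ) (i : Fin (n + 1)) :
    PowerSeries.coeff 0 (D.H s i) = ((D.hU i ^ (s : ℤ) : Aˣ) : A) := by
  rw [H, PowerSeries.coeff_C_mul, coeff_zero_expSeries, mul_one]

theorem hU_commute' (i j : Fin (n + 1)) : Commute (D.hU i : A) (D.hU j : A) :=
  congrArg Units.val (D.hU_commute i j).eq

theorem hU_H (i : Fin (n + 1)) (s : ℤˣ) (j : Fin (n + 1)) (m : ℕ) :
    Commute (D.hU i : A) (PowerSeries.coeff m (D.H s j)) :=
  D.commute_coeff_H (D.hU_commute' i j) (D.hU_L i s j) m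

theorem hU_zpow_H (z : ℤ) (i : Fin (n + 1)) (s : ℤˣ) (j : Fin (n + 1)) (m : ℕ) :
    Commute ((D.hU i ^ z : Aˣ) : A) (PowerSeries.coeff m (D.H s j)) :=
  ((D.hU_H i s j m).symm.units_zpow_right z).symm

theorem hU_zpow_L (z : ℤ) (i : Fin (n + 1)) (s : ℤˣ) (j : Fin (n + 1)) (m : ℕ) :
    Commute ((D.hU i ^ z : Aˣ) : A) (PowerSeries.coeff m (D.L s j)) :=
  ((D.hU_L i s j m).symm.units_zpow_right z).symm

theorem L_H_commute (s : ℤˣ) (i j : Fin (n + 1)) : CoeffCommute (D.L s i) (D.H s j) := fun a b =>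
  D.commute_coeff_H (D.hU_L j s i a).symm (fun r => D.L_commute s i j a r) b

theorem H_commute (s : ℤˣ) (i j : Fin (n + 1)) : CoeffCommute (D.H s i) (D.H s j) := fun a b =>
  D.commute_coeff_H (D.hU_H j s i a).symm (fun r => (D.L_H_commute s j i r a).symm) b

/-- The inverse of the image of `h^s_i(u)`. -/
def Hinv (s : ℤˣ) (i : Fin (n + 1)) : A⟦X⟧ :=
  invSeries ((D.hU i ^ (-(s : ℤ)) : Aˣ) : A) (D.H s i)

theorem H_mul_Hinv (s : ℤˣ) (i : Fin (n + 1)) : D.H s i * D.Hinv s i = 1 := by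
  apply mul_invSeries
  rw [coeff_zero_H, ← Units.val_mul, ← zpow_add, add_neg_cancel, zpow_zero, Units.val_one]

theorem Hinv_mul_H (s : ℤˣ) (i : Fin (n + 1)) : D.Hinv s i * D.H s i = 1 := by
  apply invSeries_mul
  · rw [coeff_zero_H, ← Units.val_mul, ← zpow_add, add_neg_cancel, zpow_zero, Units.val_one]
  · rw [coeff_zero_H, ← Units.val_mul, ← zpow_add, neg_add_cancel, zpow_zero, Units.val_one]

theorem coeff_zero_Hinv (s : ℤˣ) (i : Fin (n + 1)) :
    PowerSeries.coeff 0 (D.Hinv s i) = ((D.hU i ^ (-(s : ℤ)) : Aˣ) : A) := by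
  simp [Hinv, invSeries, invCoeff]

theorem L_Hinv_commute (s : ℤˣ) (i j : Fin (n + 1)) : CoeffCommute (D.L s i) (D.Hinv s j) :=
  (D.L_H_commute s i j).inv_right (D.H_mul_Hinv s j) (D.Hinv_mul_H s j)

theorem eulerD_Hinv (s : ℤˣ) (i : Fin (n + 1)) :
    eulerD (D.Hinv s i) = -D.L s i * D.Hinv s i :=
  eulerD_inv_of_eq (D.eulerD_H s i) (D.H_mul_Hinv s i) (D.Hinv_mul_H s i)
    (D.L_Hinv_commute s i i).symm.commute

/-- The image of `h^s_i(u)^{-1} h^s_{i+1}(u)`. -/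
def psi (s : ℤˣ) (i : Fin n) : A⟦X⟧ := PowerSeries.C ((D.cLast i ^ (s : ℤ) : Aˣ) : A) *
  twist (q ^ (-((s : ℤ) * (i.val + 1 : ℤ)))) (D.phi (-s) i)

/-- The reconstructed quotient and the rescaled φ_i have the same logarithmic derivative by `L_sub`;
their constant terms agree by the recursive choice of `hU`. -/
theorem Hinv_mul_H_succ (s : ℤˣ) (i : Fin n) :
    D.Hinv s i.castSucc * D.H s i.succ = D.psi s i := by
  have h0 : PowerSeries.coeff 0 (D.L s i.succ - D.L s i.castSucc) = 0 := by
    rw [map_sub, L_zero, L_zero, sub_zero]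
  refine eulerD_unique h0 ?_ ?_ ?_
  · rw [eulerD_mul_of_eq (D.eulerD_Hinv s _) (D.eulerD_H s _)
      (D.L_Hinv_commute s _ _).symm.commute]
    congr 1; abel
  · rw [psi, eulerD_central_mul (central_zpow (D.cLast_central i) _)
      (eulerD_twist _ (D.eulerD_phi (-s) i))]
    congr 1
    ext r
    rw [L_sub, twist, PowerSeries.coeff_mk, PowerSeries.coeff_mk, smul_smul, beta, aCoef,
      ← zpow_natCast, ← zpow_mul]
    congr 3
    push_cast; ring
  · have hc : ∀ v, Commute (D.cLast i) v := fun v => units_commute (D.cLast_central i v)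
    have h1 : D.kU i = D.cLast i * (D.hU i.castSucc * (D.hU i.succ)⁻¹) := by
      rw [hU_castSucc]; group
    rw [PowerSeries.coeff_mul, Finset.Nat.antidiagonal_zero, Finset.sum_singleton, coeff_zero_Hinv,
      coeff_zero_H, psi, PowerSeries.coeff_C_mul, twist, PowerSeries.coeff_mk, pow_zero, one_smul,
      D.phi_zero, ← Units.val_mul, ← Units.val_mul, h1, (hc _).mul_zpow,
      ((D.hU_commute i.castSucc i.succ).inv_right).mul_zpow, ← mul_assoc, Units.val_neg, ← zpow_add,
      add_neg_cancel, zpow_zero, one_mul, inv_zpow', neg_neg]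

theorem psi_odd (s : ℤˣ) (i : Fin n) (hi : IsLast i) {m : ℕ} (hm : Odd m) :
    PowerSeries.coeff m (D.psi s i) = 0 := by
  rw [psi, PowerSeries.coeff_C_mul, twist, PowerSeries.coeff_mk,
    even_of_log_even (D.eulerD_phi (-s) i)
      (by rw [PowerSeries.coeff_mk, D.a_zero, smul_zero]) (fun r hr => ?_) hm, smul_zero, mul_zero]
  rw [PowerSeries.coeff_mk, D.a_odd _ i hi r hr, smul_zero]

theorem signCoeff_psi_odd (s : ℤˣ) {i : Fin n} (hi : IsLast i) {m : ℤ} (hm : Odd m) :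
    signCoeff (D.psi s i) s m = 0 := by
  rw [signCoeff]
  split_ifs with h
  · refine D.psi_odd s i hi ?_
    have : Odd ((s : ℤ) * m) := by
      rcases Int.units_eq_one_or s with rfl | rfl
      · simpa using hm
      · simpa using hm
    rwa [← Int.odd_coe_nat, Int.toNat_of_nonneg h]
  · rfl

theorem signCoeff_psi (s : ℤˣ) (i : Fin n) (m : ℤ) : signCoeff (D.psi s i) s (-m) =
    q ^ ((i.val + 1 : ℤ) * m) •
      (((D.cLast i ^ (s : ℤ) : Aˣ) : A) * signCoeff (D.phi (-s) i) (-s) m) := by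
  have h1 : ((-s : ℤˣ) : ℤ) * m = (s : ℤ) * -m := by push_cast; ring
  rw [signCoeff, signCoeff, h1]
  split_ifs with h
  · rw [psi, PowerSeries.coeff_C_mul, twist, PowerSeries.coeff_mk, mul_smul_comm, ← zpow_natCast,
      ← zpow_mul]
    congr 2
    have h2 : (s : ℤ) * s = 1 := by rcases Int.units_eq_one_or s with rfl | rfl <;> rfl
    rw [Int.toNat_of_nonneg h]
    linear_combination (i.val + 1 : ℤ) * m * h2
  · rw [mul_zero, smul_zero]

theorem hU_X (hn : n ≠ 0) (i : Fin (n + 1)) (s : ℤˣ) (j : Fin n) (l : ℤ) :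
    (D.hU i : A) * D.X s j l = q ^ ((s : ℤ) * epsRoot' i j) • (D.X s j l * (D.hU i : A)) := by
  rw [X, mul_smul_comm, D.hU_x hn, smul_mul_assoc, smul_comm]

theorem zpow_sign_X {u : Aˣ} {y : A} {e : ℤ} (h : (u : A) * y = q ^ e • (y * (u : A))) (s : ℤˣ) :
    ((u ^ (s : ℤ) : Aˣ) : A) * y = q ^ ((s : ℤ) * e) • (y * ((u ^ (s : ℤ) : Aˣ) : A)) := by
  rcases Int.units_eq_one_or s with rfl | rfl
  · simpa using h
  · simpa using inv_x h

theorem H_Xp (hn : 2 ≤ n) (s : ℤˣ) (i : Fin (n + 1)) (j : Fin n) (a : ℕ) (l : ℤ) :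
    PowerSeries.coeff a (D.H s i) * D.X 1 j l = ∑ k ∈ Finset.range (a + 1),
      PowerSeries.coeff k (scaled (Ext.gSer s i j) ((D.c ^ (-1 : ℤ) : Aˣ) : A)) *
        (D.X 1 j (l - s * k) * PowerSeries.coeff (a - k) (D.H s i)) := by
  have hc := central_zpow D.c_central (-1)
  have h := conj_of_commutator (D.eulerD_H s i) (D.L_zero s i) (scaled_central (Ext.gSer s i j) hc)
    (eulerD_scaled_of_eq (eulerD_gSer s i j) _) (scaled_central _ hc)
    (fun k : ℕ => D.X 1 j (l - s * (k : ℤ))) (fun k => ?_) (fun r k => ?_) 0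
  · have h1 := congrArg (PowerSeries.coeff a) h
    rw [PowerSeries.coeff_mul_C, coeff_shiftSeries_mul] at h1
    simpa using h1
  · rw [coeff_zero_H, zpow_sign_X (D.hU_X (by omega) i 1 j _), coeff_scaled, pow_zero,
      coeff_zero_gSer, Units.val_one, one_mul, smul_mul_assoc, one_mul, smul_mul_assoc]
  · rw [D.L_X hn, coeff_scaled, gLog, PowerSeries.coeff_mk, Units.val_one, one_mul, Int.cast_one,
      one_mul, smul_mul_assoc, ← Units.val_pow_eq_pow_val, ← zpow_natCast (D.c ^ (-1 : ℤ)), ← zpow_mul]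
    rw [show l - s * (k : ℤ) - s * (r : ℤ) = l - s * ((k + r : ℕ) : ℤ) by push_cast; ring,
      show (-1 : ℤ) * (r : ℤ) = -(r : ℤ) by ring]

/-- As X^- stands to the left of h, the commutators are exponentiated for h⁻¹, and the result is
multiplied by h on both sides. -/
theorem H_Xm (hn : 2 ≤ n) (s : ℤˣ) (i : Fin (n + 1)) (j : Fin n) (a : ℕ) (l : ℤ) :
    D.X (-1) j l * PowerSeries.coeff a (D.H s i) = ∑ k ∈ Finset.range (a + 1),
      PowerSeries.coeff k (scaled (Ext.gSer s i j) ((D.c ^ (1 : ℤ) : Aˣ) : A)) *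
        (PowerSeries.coeff (a - k) (D.H s i) * D.X (-1) j (l - s * k)) := by
  have hc := central_zpow D.c_central 1
  have hinv : PowerSeries.coeff 0 (-D.L s i) = 0 := by rw [map_neg, L_zero, neg_zero]
  have h := conj_of_commutator (D.eulerD_Hinv s i) hinv (scaled_central (Ext.gSer s i j) hc)
    (eulerD_scaled_of_eq (eulerD_gSer s i j) _) (scaled_central _ hc)
    (fun k : ℕ => D.X (-1) j (l - s * (k : ℤ))) (fun k => ?_) (fun r k => ?_) 0
  · have h2 : PowerSeries.C (D.X (-1) j (l - s * ((0 : ℕ) : ℤ))) * D.H s i = D.H s i *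
        shiftSeries (scaled (Ext.gSer s i j) ((D.c ^ (1 : ℤ) : Aˣ) : A))
          (fun k : ℕ => D.X (-1) j (l - s * (k : ℤ))) 0 := by
      calc _ = D.H s i * (D.Hinv s i * PowerSeries.C (D.X (-1) j (l - s * ((0 : ℕ) : ℤ)))) * D.H s i := by
            rw [← mul_assoc, H_mul_Hinv, one_mul]
        _ = _ := by rw [h, mul_assoc, mul_assoc, Hinv_mul_H, mul_one]
    have h1 := congrArg (PowerSeries.coeff a) h2
    rw [PowerSeries.coeff_C_mul, coeff_mul_shiftSeries (scaled_central _ hc)] at h1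
    simpa using h1
  · have h2 := zpow_sign_X (D.hU_X (by omega) i (-1) j (l - s * (k : ℤ))) (-s)
    rw [Units.val_neg s] at h2
    rw [coeff_zero_Hinv, h2, coeff_scaled, pow_zero, coeff_zero_gSer, smul_mul_assoc, one_mul,
      smul_mul_assoc]
    congr 2
    push_cast; ring
  · have h2 := D.L_X hn s (-1) i j r (l - s * (k : ℤ))
    have h3 : ∀ u v : A, -u * v - v * -u = -(u * v - v * u) := fun u v => by noncomm_ring
    rw [map_neg, h3, h2, coeff_scaled, gLog, PowerSeries.coeff_mk, smul_mul_assoc,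
      ← Units.val_pow_eq_pow_val, ← zpow_natCast (D.c ^ (1 : ℤ)), ← zpow_mul]
    have h4 : ∀ (g : Kq) (y : A), -(((((-1 : ℤˣ) : ℤ) : Kq) * g) • y) = g • y := fun g y => by
      have : (((((-1 : ℤˣ) : ℤ) : Kq) * g)) = -g := by push_cast; ring
      rw [this]
      exact (congrArg Neg.neg (neg_smul g y)).trans (neg_neg _)
    rw [h4]
    rw [show l - s * (k : ℤ) - s * (r : ℤ) = l - s * ((k + r : ℕ) : ℤ) by push_cast; ring,
      show -(((-1 : ℤˣ) : ℤ) * (r : ℤ)) = 1 * (r : ℤ) by push_cast; ring]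

theorem cross (hn : 2 ≤ n) (s : ℤˣ) {i j : Fin (n + 1)} {ρ R : Kq⟦X⟧}
    (hρ : PowerSeries.constantCoeff ρ ≠ 0) (hR : eulerD ρ = R * ρ)
    (hP : crossLog n D.c s R = PowerSeries.mk fun r => pij n (qr s r) r i j •
      (((D.c ^ (2 * r : ℤ) : Aˣ) : A) - ((D.c ^ (-(2 * r) : ℤ) : Aˣ) : A))) (a b : ℕ) :
    crossCoeff (crossLeft n D.c s ρ) (D.H s i) (D.H (-s) j) a b =
      crossCoeff' (crossRight n D.c s ρ) (D.H s i) (D.H (-s) j) a b := by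
  refine crossSeries_of_heisComm (by omega) D.c_central hρ hR s (D.eulerD_H s i) (D.L_zero s i)
    (D.eulerD_H (-s) j) (D.L_zero (-s) j) (fun b => ?_) (fun r => ?_) ?_ a b
  · rw [coeff_zero_H]; exact D.hU_zpow_H _ _ _ _ _
  · rw [coeff_zero_H]; exact (D.hU_zpow_L _ _ _ _ _).symm
  · rw [hP]; exact D.L_heis hn s i j

theorem X_X_diag (i : Fin n) (m l : ℤ) (hl : (d i : ℤ) ∣ l) :
    D.X 1 i m * D.X (-1) i l - D.X (-1) i l * D.X 1 i m = (qi i - (qi i)⁻¹) •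
      (((D.c ^ (m - l) : Aˣ) : A) * (((D.cLast i) : Aˣ) : A) * signCoeff (D.psi (-1) i) (-1) (-(m + l)) -
        ((D.c ^ (l - m) : Aˣ) : A) * (((D.cLast i)⁻¹ : Aˣ) : A) * signCoeff (D.psi 1 i) 1 (-(m + l))) := by
  rw [signCoeff_psi, X, X, comm_smul_aux, D.x_x, if_pos ⟨rfl, hl⟩]
  have h1 := D.signCoeff_psi 1 i (m + l)
  rw [h1, neg_neg, mul_smul_comm, mul_smul_comm, ← smul_sub, smul_smul, smul_smul]
  have e1 : (((-1 : ℤˣ) : ℤ)) = -1 := rfl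
  have e2 : (((1 : ℤˣ) : ℤ)) = 1 := rfl
  rw [e1, e2, zpow_neg_one, zpow_one]
  have h3 : ∀ v y : A, v * (D.cLast i : A) * ((((D.cLast i)⁻¹ : Aˣ) : A) * y) = v * y := fun v y => by
    rw [mul_assoc, ← mul_assoc (D.cLast i : A), Units.mul_inv, one_mul]
  have h4 : ∀ v y : A, v * (((D.cLast i)⁻¹ : Aˣ) : A) * ((D.cLast i : A) * y) = v * y := fun v y => by
    rw [mul_assoc, ← mul_assoc (((D.cLast i)⁻¹ : Aˣ) : A), Units.inv_mul, one_mul]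
  rw [h3, h4, neg_sub]
  congr 1
  have h5 : q ^ ((i.val + 1 : ℤ) * (m + l)) =
      q ^ ((i.val + 1 : ℤ) * m) * q ^ ((i.val + 1 : ℤ) * l) := by
    rw [← zpow_add₀ q_ne_zero]; congr 1; ring
  rw [h5]
  have h6 := inv_mul_cancel₀ (qi_sub_ne_zero i)
  linear_combination ((qi i - (qi i)⁻¹) * q ^ ((i.val + 1 : ℤ) * m) *
    q ^ ((i.val + 1 : ℤ) * l)) * h6

theorem X_X_of_ne {i j : Fin n} (hij : i ≠ j) (m l : ℤ) :
    D.X 1 i m * D.X (-1) j l - D.X (-1) j l * D.X 1 i m = 0 := by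
  rw [X, X, comm_smul_aux, D.x_x, if_neg (fun h => hij h.1), smul_zero]

theorem X_odd (s : ℤˣ) (i : Fin n) (hi : IsLast i) {m : ℤ} (hm : Odd m) : D.X s i m = 0 := by
  rw [X, D.x_odd s i hi m hm, smul_zero]

theorem X_X (i j : Fin n) (hj : ¬ IsLast j) (m l : ℤ) :
    D.X 1 i m * D.X (-1) j l - D.X (-1) j l * D.X 1 i m =
    if i = j then (qi i - (qi i)⁻¹) •
      (((D.c ^ (m - l) : Aˣ) : A) * signCoeff (D.psi (-1) i) (-1) (-(m + l))
      - ((D.c ^ (l - m) : Aˣ) : A) * signCoeff (D.psi 1 i) 1 (-(m + l))) else 0 := by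
  split_ifs with h
  · subst h
    have hc : D.cLast i = 1 := if_neg hj
    have hd : d i = 1 := if_neg hj
    rw [D.X_X_diag i m l (by rw [hd]; exact one_dvd _), hc]
    simp
  · exact D.X_X_of_ne h m l

/-- For i = j, `X_X_diag` settles the case of even modes. If a mode is odd, the commutator vanishes,
and any term surviving the parity tests involves an odd coefficient of the even series ψ_n. -/
theorem X_X_last (i j : Fin n) (hj : IsLast j) (m l : ℤ) :
    D.X 1 i m * D.X (-1) j l - D.X (-1) j l * D.X 1 i m =
    if i = j then (qi j - (qi j)⁻¹) •
      ((if Even m then ((D.c ^ (m - l + 2) : Aˣ) : A) * signCoeff (D.psi (-1) i) (-1) (-(m + l)) else 0) -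
      (if Even l then ((D.c ^ (l - m - 2) : Aˣ) : A) * signCoeff (D.psi 1 i) 1 (-(m + l)) else 0))
    else 0 := by
  split_ifs with h hm hl hl
  · subst h
    have hc : D.cLast i = D.c ^ (2 : ℤ) := if_pos hj
    have hd : d i = 2 := if_pos hj
    rw [D.X_X_diag i m l (by rw [hd]; exact even_iff_two_dvd.mp hl), hc, ← Units.val_mul,
      ← Units.val_mul, ← zpow_neg, ← zpow_add, ← zpow_add, ← sub_eq_add_neg (l - m)]
  · subst h
    have hl' := Int.not_even_iff_odd.mp hl
    have h2 := D.signCoeff_psi_odd (-1) hj (hm.add_odd hl').neg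
    rw [D.X_odd (-1) i hj hl', h2]
    simp
  · subst h
    have hm' := Int.not_even_iff_odd.mp hm
    have h2 := D.signCoeff_psi_odd 1 hj (hm'.add_even hl).neg
    rw [D.X_odd 1 i hj hm', h2]
    simp
  · subst h
    rw [D.X_odd (-1) i hj (Int.not_even_iff_odd.mp hl)]
    simp
  · exact D.X_X_of_ne h m l

/-- The image of `X^s_i(u q^i)`. -/
theorem smul_X (s : ℤˣ) (i : Fin n) (m : ℤ) : q ^ (-((i.val + 1 : ℤ) * m)) • D.X s i m =
    (qi i - (qi i)⁻¹) • D.x s i m := by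
  rw [X, smul_smul]
  congr 1
  have h : q ^ (-((i.val + 1 : ℤ) * m)) * q ^ ((i.val + 1 : ℤ) * m) = 1 := by
    rw [← zpow_add₀ q_ne_zero, neg_add_cancel, zpow_zero]
  linear_combination (qi i - (qi i)⁻¹) * h

theorem quad_aux {a b p : Kq} {x x' y y' : A}
    (h : x' * y - p • (y * x') = p • (x * y') - y' * x) :
    (a • x') * (b • y) - p • ((a • x) * (b • y')) =
      p • ((b • y) * (a • x')) - (b • y') * (a • x) := by
  simp only [smul_mul_smul_comm, mul_comm b a, smul_comm p, ← smul_sub]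
  congr 1
  rw [sub_eq_sub_iff_add_eq_add] at h ⊢
  rw [h, add_comm]

theorem quad_X (s : ℤˣ) (i j : Fin n) (m l e : ℤ) (he : (dd i j : ℤ) = e) :
    (q ^ (-((i.val + 1 : ℤ) * (m + e))) • D.X s i (m + e)) * (q ^ (-((j.val + 1 : ℤ) * l)) • D.X s j l) -
      q ^ ((s : ℤ) * form i j) • ((q ^ (-((i.val + 1 : ℤ) * m)) • D.X s i m) *
        (q ^ (-((j.val + 1 : ℤ) * (l + e))) • D.X s j (l + e)))
    = q ^ ((s : ℤ) * form i j) • ((q ^ (-((j.val + 1 : ℤ) * l)) • D.X s j l) *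
        (q ^ (-((i.val + 1 : ℤ) * (m + e))) • D.X s i (m + e))) -
      (q ^ (-((j.val + 1 : ℤ) * (l + e))) • D.X s j (l + e)) *
        (q ^ (-((i.val + 1 : ℤ) * m)) • D.X s i m) := by
  have hp : qi i ^ ((s : ℤ) * cartan i j) = q ^ ((s : ℤ) * form i j) := by
    rw [qi_zpow, form]; congr 1; ring
  have h := D.quad s i j m l
  rw [hp, he] at h
  rw [smul_X, smul_X, smul_X, smul_X]
  exact quad_aux h

theorem serre_X (s : ℤˣ) (i j : Fin n) (hij : i ≠ j) (hA : cartan i j = 0 ∨ cartan i j = -1)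
    (m : Fin (1 - cartan i j).toNat → ℤ) (l : ℤ) :
    TwistedAffine.serre (qi i) (D.X s i) (D.X s j l) m = 0 := by
  have := serre_smul (qi i) (D.x s i) (D.x s j l) m
    (fun k => (qi i - (qi i)⁻¹) * q ^ ((i.val + 1 : ℤ) * k))
    ((qi j - (qi j)⁻¹) * q ^ ((j.val + 1 : ℤ) * l))
  rw [D.serre s i j hij hA, smul_zero] at this
  exact this

theorem serre_two_X (s : ℤˣ) (i j : Fin n) (hA : cartan i j = -2) (m : Fin 2 → ℤ) (l : ℤ) :
    (∑ π : Equiv.Perm (Fin 2),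
      (q ^ (2 * (s : ℤ)) • serreTwo (D.X s i) (D.X s j l) (m (π 0) + 1) (m (π 1)) +
        serreTwo (D.X s i) (D.X s j l) (m (π 0)) (m (π 1) + 1))) = 0 := by
  set f : ℤ → Kq := fun k => (qi i - (qi i)⁻¹) * q ^ ((i.val + 1 : ℤ) * k) with hf
  set e : Kq := (qi j - (qi j)⁻¹) * q ^ ((j.val + 1 : ℤ) * l) with he
  have h0 : ∀ a b, serreTwo (D.X s i) (D.X s j l) a b =
      (f a * f b * e) • serreTwo (D.x s i) (D.x s j l) a b := fun a b =>
    serreTwo_smul (D.x s i) (D.x s j l) a b f e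
  have hff : ∀ a b, f a * f b = (qi i - (qi i)⁻¹) ^ 2 * q ^ ((i.val + 1 : ℤ) * (a + b)) :=
    fun a b => by
      rw [hf, mul_add, zpow_add₀ q_ne_zero]; ring
  have hq := q_ne_zero
  have hsum : ∀ π : Equiv.Perm (Fin 2), m (π 0) + m (π 1) = m 0 + m 1 := fun π => by
    have := Equiv.sum_comp π m
    rwa [Fin.sum_univ_two, Fin.sum_univ_two] at this
  have hm : ∀ π : Equiv.Perm (Fin 2), (i.val + 1 : ℤ) * (m (π 0) + 1 + m (π 1)) =
      (i.val + 1 : ℤ) * (m 0 + m 1 + 1) := fun π => by rw [← hsum π]; ring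
  have hm' : ∀ π : Equiv.Perm (Fin 2), (i.val + 1 : ℤ) * (m (π 0) + (m (π 1) + 1)) =
      (i.val + 1 : ℤ) * (m 0 + m 1 + 1) := fun π => by rw [← hsum π]; ring
  simp only [h0, smul_smul, hff, hm, hm']
  rcases Int.units_eq_one_or s with rfl | rfl
  · refine Eq.trans ?_ ((congrArg (fun y => (q * ((qi i - (qi i)⁻¹) ^ 2 *
      q ^ ((i.val + 1 : ℤ) * (m 0 + m 1 + 1)) * e)) • y)
        (D.serre_two 1 i j hA m l)).trans (smul_zero _))
    rw [Finset.smul_sum]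
    refine Finset.sum_congr rfl fun π _ => ?_
    rw [smul_add, smul_smul, smul_smul]
    simp only [Units.val_one, mul_one]
    have : (q : Kq) ^ (2 : ℤ) = q * q := by rw [← pow_two]; rfl
    rw [this]
    congr 2
    · ring
    · field_simp
  -- For the lower sign Drinfeld's relation is used at m + 1, since it shifts modes down; its two
  -- terms then appear in exchanged order.
  · refine Eq.trans ?_ ((congrArg (fun y => (q⁻¹ * ((qi i - (qi i)⁻¹) ^ 2 *
      q ^ ((i.val + 1 : ℤ) * (m 0 + m 1 + 1)) * e)) • y)
        (D.serre_two (-1) i j hA (fun k => m k + 1) l)).trans (smul_zero _))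
    rw [Finset.smul_sum]
    refine Finset.sum_congr rfl fun π _ => ?_
    rw [smul_add, smul_smul, smul_smul]
    simp only [Units.val_neg, Units.val_one, add_neg_cancel_right]
    rw [add_comm]
    have : (q : Kq) ^ (2 * -1 : ℤ) = q⁻¹ * q⁻¹ := by
      rw [show (2 * -1 : ℤ) = -1 + -1 by norm_num, zpow_add₀ hq, zpow_neg_one]
    rw [this]
    congr 2
    · field_simp
    · ring

end DrData

/-! ### Homomorphisms from the extended algebra -/

namespace DrData

variable {n : ℕ} {A : Type*} [Ring A] [Algebra Kq A] (D : DrData n A)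

/-- The images of the generators of the extended algebra. -/
def genMap : ExtGen n → A
  | .X s i m => D.X s i m
  | .h s j m => PowerSeries.coeff m (D.H s j)
  | .qc => D.c
  | .qcInv => ((D.c)⁻¹ : Aˣ)

/-- The homomorphism from the free algebra. -/
def freeMap : Ext.Free n →ₐ[Kq] A := FreeAlgebra.lift Kq D.genMap

theorem freeMap_X (s : ℤˣ) (i : Fin n) (m : ℤ) : D.freeMap (Ext.X s i m) = D.X s i m := by
  simp [freeMap, Ext.X, genMap]

theorem freeMap_h (s : ℤˣ) (j : Fin (n + 1)) (m : ℕ) :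
    D.freeMap (Ext.h s j m) = PowerSeries.coeff m (D.H s j) := by
  simp [freeMap, Ext.h, genMap]

theorem freeMap_qc : D.freeMap (FreeAlgebra.ι Kq ExtGen.qc) = D.c := by
  simp [freeMap, genMap]

theorem freeMap_qcInv : D.freeMap (FreeAlgebra.ι Kq ExtGen.qcInv) = ((D.c)⁻¹ : Aˣ) := by
  simp [freeMap, genMap]

theorem freeMap_qcPow (z : ℤ) : D.freeMap (Ext.qcPow z) = ((D.c ^ z : Aˣ) : A) := by
  have h1 := map_zpw (D.freeMap : Ext.Free n →+* A) (FreeAlgebra.ι Kq ExtGen.qc)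
    (FreeAlgebra.ι Kq ExtGen.qcInv) z
  refine h1.trans ?_
  rw [← zpw_units]
  congr 1
  · exact D.freeMap_qc
  · exact D.freeMap_qcInv

theorem map_hSer (s : ℤˣ) (j : Fin (n + 1)) :
    PowerSeries.map (D.freeMap : Ext.Free n →+* A) (Ext.hSer s j) = D.H s j := by
  ext m
  rw [PowerSeries.coeff_map, Ext.hSer, PowerSeries.coeff_mk]
  exact D.freeMap_h s j m

theorem freeMap_psiSer (s : ℤˣ) (i : Fin n) (m : ℕ) :
    D.freeMap (PowerSeries.coeff m (Ext.psiSer s i)) = PowerSeries.coeff m (D.psi s i) := by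
  have h1 : PowerSeries.map (D.freeMap : Ext.Free n →+* A) (Ext.psiSer s i) = D.psi s i := by
    rw [Ext.psiSer, map_mul, map_invSeries, map_hSer, map_hSer, ← Hinv_mul_H_succ, Hinv,
      ← coeff_zero_Hinv]
    congr 2
    refine (D.freeMap_h _ _ _).trans ?_
    rw [coeff_zero_H, coeff_zero_Hinv, Units.val_neg]
  rw [← h1, PowerSeries.coeff_map]
  rfl

theorem freeMap_psiZ (s : ℤˣ) (i : Fin n) (m : ℤ) :
    D.freeMap (Ext.psiZ s i m) = signCoeff (D.psi s i) s m := by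
  rw [Ext.psiZ, signCoeff]
  split_ifs
  · exact D.freeMap_psiSer _ _ _
  · exact map_zero _

theorem freeMap_Xq (s : ℤˣ) (i : Fin n) (m : ℤ) :
    D.freeMap (Ext.Xq s i m) = q ^ (-((i.val + 1 : ℤ) * m)) • D.X s i m := by
  rw [Ext.Xq, map_smul, freeMap_X]

theorem freeMap_hhLeft (ρ : ℤˣ → Kq⟦X⟧) (s : ℤˣ) (i j : Fin (n + 1)) (a b : ℕ) :
    D.freeMap (Ext.hhLeft ρ s i j a b) =
      crossCoeff (crossLeft n D.c s (ρ s)) (D.H s i) (D.H (-s) j) a b := by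
  refine (map_crossCoeff (D.freeMap : Ext.Free n →+* A) _ _ _ a b).trans ?_
  rw [map_mul, map_scaled, map_scaled, map_hSer, map_hSer, freeMap_qcPow, freeMap_qcPow, crossLeft]

theorem freeMap_hhRight (ρ : ℤˣ → Kq⟦X⟧) (s : ℤˣ) (i j : Fin (n + 1)) (a b : ℕ) :
    D.freeMap (Ext.hhRight ρ s i j a b) =
      crossCoeff' (crossRight n D.c s (ρ s)) (D.H s i) (D.H (-s) j) a b := by
  refine (map_crossCoeff' (D.freeMap : Ext.Free n →+* A) _ _ _ a b).trans ?_
  rw [map_mul, map_scaled, map_scaled, map_hSer, map_hSer, freeMap_qcPow, freeMap_qcPow, crossRight]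

theorem freeMap_coeff_scaled (T : Kq⟦X⟧) (z : ℤ) (k : ℕ) :
    D.freeMap (PowerSeries.coeff k (scaled T (Ext.qcPow z))) =
      PowerSeries.coeff k (scaled T ((D.c ^ z : Aˣ) : A)) := by
  rw [coeff_scaled, coeff_scaled, map_smul, map_pow, freeMap_qcPow]

theorem freeMap_rel (hn : 2 ≤ n) {a b : Ext.Free n} (h : Ext.Rel n a b) :
    D.freeMap a = D.freeMap b := by
  induction h with
  | qc_mul => rw [map_mul, freeMap_qc, freeMap_qcInv, map_one, Units.mul_inv]
  | qcInv_mul => rw [map_mul, freeMap_qc, freeMap_qcInv, map_one, Units.inv_mul]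
  | qc_central g => rw [map_mul, map_mul, freeMap_qc]; exact D.c_central _
  | h_zero s j =>
    rw [map_mul, freeMap_h, freeMap_h, coeff_zero_H, coeff_zero_H, ← Units.val_mul, Units.val_neg,
      ← zpow_add, add_neg_cancel, zpow_zero, map_one, Units.val_one]
  | h_last i hi =>
    rw [map_mul, freeMap_h, freeMap_h, coeff_zero_H, coeff_zero_H, ← Units.val_mul,
      D.hU_succ_last i hi, Units.val_one, zpow_one, zpow_one, mul_inv_cancel, map_one, Units.val_one]
  | X_odd s i hi m => rw [freeMap_X, D.X_odd s i hi ⟨m, rfl⟩, map_zero]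
  | psi_odd s i hi m => rw [freeMap_psiSer, D.psi_odd s i hi ⟨m, rfl⟩, map_zero]
  | h_h s i j a b =>
    rw [map_mul, map_mul, freeMap_h, freeMap_h]
    exact D.H_commute s i j a b
  | h_h_eq s i a b =>
    rw [freeMap_hhLeft, freeMap_hhRight]
    exact D.cross hn s (R := 0) (by simp) (by simp) (crossLog_zero n D.c s i) a b
  | h_h_lt s i j hij hi a b =>
    rw [freeMap_hhLeft, freeMap_hhRight]
    have := D.cross hn s (constantCoeff_rhoSer_ne_zero n s i) (eulerD_rhoSer n s i)
      (crossLog_rhoLog n D.c s (show i.val < j.val from hij)) a b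
    rwa [rhoSer, if_neg hi] at this
  | h_h_last s i hi a b =>
    rw [freeMap_hhLeft, freeMap_hhRight]
    have := D.cross hn s (i := i.castSucc) (j := i.succ) (constantCoeff_rhoSer_ne_zero n s i)
      (eulerD_rhoSer n s i) (crossLog_rhoLog n D.c s (by simp)) a b
    rwa [rhoSer, if_pos hi] at this
  | h_Xp s i j a l =>
    simp only [map_mul, map_sum, freeMap_h, freeMap_X, freeMap_coeff_scaled]
    exact D.H_Xp hn s i j a l
  | h_Xm s i j a l =>
    simp only [map_mul, map_sum, freeMap_h, freeMap_X, freeMap_coeff_scaled]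
    exact D.H_Xm hn s i j a l
  | quad s i j hi hj m l =>
    simp only [map_sub, map_mul, map_smul, freeMap_Xq]
    have hd : ((dd i j : ℕ) : ℤ) = 1 := by
      rw [dd, d, d, if_neg hi, if_neg hj]; rfl
    exact D.quad_X s i j m l 1 hd
  | quad_last s i j hj m l =>
    simp only [map_sub, map_mul, map_smul, freeMap_Xq]
    have hd : ((dd i j : ℕ) : ℤ) = 2 := by
      rw [dd, d, d, if_pos hj]; split_ifs <;> rfl
    exact D.quad_X s i j m l 2 hd
  | X_X i j hj m l =>
    rw [map_sub, map_mul, map_mul, freeMap_X, freeMap_X, D.X_X i j hj]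
    split_ifs
    · rw [map_smul, map_sub, map_mul, map_mul, freeMap_qcPow, freeMap_qcPow, freeMap_psiZ,
        freeMap_psiZ]
    · rw [map_zero]
  | X_X_last i j hj m l =>
    have h1 : ∀ (P : Prop) [Decidable P] (a : Ext.Free n),
        D.freeMap (if P then a else 0) = if P then D.freeMap a else 0 := fun P _ a => by
      split_ifs
      · rfl
      · exact map_zero _
    rw [map_sub, map_mul, map_mul, freeMap_X, freeMap_X, D.X_X_last i j hj, h1, map_smul, map_sub,
      h1, h1, map_mul, map_mul, freeMap_qcPow, freeMap_qcPow, freeMap_psiZ, freeMap_psiZ]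
  | serre s i j hij hA m l =>
    rw [map_serre, map_zero]
    simp only [freeMap_X]
    exact D.serre_X s i j hij hA m l
  | serre_two s i j hA m l =>
    rw [map_sum, map_zero, ← D.serre_two_X s i j hA m l]
    refine Finset.sum_congr rfl fun π _ => ?_
    rw [map_add, map_smul, map_serreTwo, map_serreTwo]
    simp only [freeMap_X]

/-- The homomorphism from the extended algebra. -/
def toHom (hn : 2 ≤ n) : UqExt n →ₐ[Kq] A :=
  RingQuot.liftAlgHom Kq ⟨D.freeMap, fun _ _ => D.freeMap_rel hn⟩

theorem toHom_mk (hn : 2 ≤ n) (y : Ext.Free n) : D.toHom hn (UqExt.mk n y) = D.freeMap y :=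
  RingQuot.liftAlgHom_mkAlgHom_apply _ _ _ _

theorem kU_eq (i : Fin n) : D.kU i = D.cLast i * (D.hU i.castSucc * (D.hU i.succ)⁻¹) := by
  rw [hU_castSucc]; group

theorem toHom_map_k (hn : 2 ≤ n) {ς : UqA n →ₐ[Kq] UqExt n} (h : IsCurrentMap n ς) (i : Fin n) :
    D.toHom hn (ς (UqA.mk n (Dr.k i))) = D.kU i := by
  rw [kU_eq]
  by_cases hi : IsLast i
  · rw [h.map_k_last i hi, map_mul, map_pow, toHom_mk, UqExt.h, toHom_mk, freeMap_qcPow, freeMap_h,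
      coeff_zero_H, D.hU_succ_last i hi, cLast, if_pos hi, inv_inv, Units.val_one, zpow_one, pow_two,
      Units.val_mul, Units.val_mul]
  · rw [h.map_k i hi, map_mul, UqExt.h, UqExt.h, toHom_mk, toHom_mk, freeMap_h, freeMap_h,
      coeff_zero_H, coeff_zero_H, cLast, if_neg hi, one_mul, Units.val_mul, Units.val_neg,
      Units.val_one, zpow_neg_one, zpow_one]

theorem toHom_map_x (hn : 2 ≤ n) {ς : UqA n →ₐ[Kq] UqExt n} (h : IsCurrentMap n ς) (s : ℤˣ)
    (i : Fin n) (m : ℤ) : D.toHom hn (ς (UqA.mk n (Dr.x s i m))) = D.x s i m := by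
  rw [h.map_x, map_smul, map_smul, toHom_mk, freeMap_X, smul_X, smul_smul,
    inv_mul_cancel₀ (qi_sub_ne_zero i), one_smul]

theorem coeff_psi_smul (s : ℤˣ) (i : Fin n) (m : ℕ) :
    q ^ (-((s : ℤ) * (i.val + 1 : ℤ) * m)) • (((D.cLast i ^ (s : ℤ) : Aˣ) : A) *
      PowerSeries.coeff m (D.psi (-s) i)) = PowerSeries.coeff m (D.phi s i) := by
  rw [psi, PowerSeries.coeff_C_mul, ← mul_assoc, ← Units.val_mul, ← zpow_add, Units.val_neg,
    add_neg_cancel, zpow_zero, Units.val_one, one_mul, twist, PowerSeries.coeff_mk, smul_smul,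
    neg_neg, ← zpow_natCast, ← zpow_mul, ← zpow_add₀ q_ne_zero]
  have : -((s : ℤ) * (i.val + 1 : ℤ) * m) + -(-(s : ℤ) * (i.val + 1 : ℤ)) * m = 0 := by ring
  rw [this, zpow_zero, one_smul]

theorem toHom_map_phi (hn : 2 ≤ n) {ς : UqA n →ₐ[Kq] UqExt n} (h : IsCurrentMap n ς) (s : ℤˣ)
    (i : Fin n) (m : ℕ) :
    D.toHom hn (ς (UqA.mk n (Dr.phi s i m))) = PowerSeries.coeff m (D.phi s i) := by
  have h1 : D.toHom hn (PowerSeries.coeff m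
      (UqExt.hSer (-s) i.succ * UqExt.hInvSer (-s) i.castSucc)) =
      PowerSeries.coeff m (D.psi (-s) i) := by
    rw [← freeMap_psiSer, ← D.toHom_mk hn, UqExt.mk_coeff_psiSer]; rfl
  rw [← coeff_psi_smul]
  by_cases hi : IsLast i
  · rw [h.map_phi_last s i hi, map_smul, map_mul, h1, toHom_mk, freeMap_qcPow, cLast, if_pos hi,
      zpow_mul]
  · rw [h.map_phi s i hi, map_smul, h1, cLast, if_neg hi, one_zpow, Units.val_one, one_mul]

end DrData

/-- Elements of an algebra obtained from a homomorphism from the quantum affine algebra and a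
square root of the image of `k_n`. -/
def DrData.ofHom {n : ℕ} {A : Type*} [Ring A] [Algebra Kq A] {F : Dr.Free n →ₐ[Kq] A}
    (hF : ∀ ⦃a b⦄, Dr.Rel n a b → F a = F b) (K : Aˣ)
    (c_central : ∀ y, Commute (F (FreeAlgebra.ι Kq DrGen.qc)) y)
    (K_kU : ∀ i, Commute (K : A) (F (Dr.k i)))
    (K_sq : ∀ i : Fin n, IsLast i → F (Dr.k i) = K * K)
    (K_a : ∀ s i r, Commute (K : A) (F (Dr.aPart s i r)))
    (K_x : ∀ i : Fin n, IsLast i → ∀ (s : ℤˣ) j l, (K : A) * F (Dr.x s j l) =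
      q ^ ((s : ℤ) * epsRoot' i.castSucc j) • (F (Dr.x s j l) * (K : A))) : DrData n A :=
  have hc : ∀ z : ℤ, F (Dr.qcPow z) = (((⟨F (FreeAlgebra.ι Kq DrGen.qc),
      F (FreeAlgebra.ι Kq DrGen.qcInv), by rw [← map_mul, hF Dr.Rel.qc_mul, map_one],
      by rw [← map_mul, hF Dr.Rel.qcInv_mul, map_one]⟩ : Aˣ) ^ z : Aˣ) : A) := fun z => by
    rw [← zpw_units]; exact map_zpw (F : Dr.Free n →+* A) _ _ _
  have hphi : ∀ s i m, F (Dr.phiZ s i m) = signCoeff (phiSer F s i) s m := fun s i m => by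
    rw [Dr.phiZ, signCoeff]
    split_ifs
    · rw [phiSer, PowerSeries.coeff_mk]
    · exact map_zero _
  have haPart : ∀ (s : ℤˣ) (i : Fin n) (r : ℕ) (hr : r ≠ 0), Dr.aPart s i r =
      Dr.a i ⟨(s : ℤ) * r, mul_ne_zero s.ne_zero (Int.natCast_ne_zero.mpr hr)⟩ :=
    fun s i r hr => dif_neg hr
  { c := ⟨F (FreeAlgebra.ι Kq DrGen.qc), F (FreeAlgebra.ι Kq DrGen.qcInv),
      by rw [← map_mul, hF Dr.Rel.qc_mul, map_one], by rw [← map_mul, hF Dr.Rel.qcInv_mul, map_one]⟩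
    K := K
    kU := Dr.kUnit hF
    x := fun s i m => F (Dr.x s i m)
    a := fun s i r => F (Dr.aPart s i r)
    phi := phiSer F
    c_central := c_central
    K_kU := fun i => Units.ext (K_kU i)
    kU_commute := fun i j => Units.ext (by
      have := hF (Dr.Rel.k_k i j)
      rw [map_mul, map_mul] at this
      exact this)
    K_sq := fun i hi => Units.ext (K_sq i hi)
    K_a := K_a
    kU_a := Dr.k_commute_aPart hF
    K_x := K_x
    kU_x := fun i s j l => by
      have h1 := congrArg (· * F (Dr.k i)) (hF (Dr.Rel.k_x s i j l))
      simp only [map_mul, map_smul] at h1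
      rw [mul_assoc (_ * _), ← map_mul F (Dr.kInv i), hF (Dr.Rel.kInv_mul i), map_one, mul_one,
        smul_mul_assoc, qi_zpow] at h1
      refine h1.trans ?_
      rw [form]
      congr 2; ring
    a_zero := fun s i => by rw [aPart_zero, map_zero]
    a_odd := fun s i hi r hr => by
      rw [haPart s i r (by rintro rfl; simp at hr), hF (Dr.Rel.a_odd i hi _ _), map_zero]
      rcases Int.units_eq_one_or s with rfl | rfl
      · simpa using hr
      · simpa using hr
    a_commute := Dr.aPart_commute hF
    a_heis := fun s i j r l hr hl => by
      have := hF (Dr.Rel.a_a i j ⟨(s : ℤ) * r, mul_ne_zero s.ne_zero (Int.natCast_ne_zero.mpr hr)⟩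
        ⟨((-s : ℤˣ) : ℤ) * l, mul_ne_zero (-s).ne_zero (Int.natCast_ne_zero.mpr hl)⟩)
      rw [map_sub, map_mul, map_mul, ← haPart s i r hr, ← haPart (-s) j l hl] at this
      rw [this]
      by_cases h : r = l
      · subst h
        rw [if_pos (by push_cast; ring), if_pos rfl, map_smul, map_sub, hc, hc]
      · rw [if_neg, if_neg h, map_zero]
        intro h1
        have h2 : (s : ℤ) * r = (s : ℤ) * l := by push_cast at h1; linarith
        exact h (sign_mul_inj hr h2).2
    a_x := fun s σ i j r l hr => by
      have := hF (Dr.Rel.a_x σ i j ⟨(s : ℤ) * r,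
        mul_ne_zero s.ne_zero (Int.natCast_ne_zero.mpr hr)⟩ l)
      rw [map_sub, map_mul, map_mul, map_smul, map_mul, ← haPart s i r hr, hc] at this
      rw [this]
      congr 5
      rcases Int.units_eq_one_or s with rfl | rfl <;> simp
    eulerD_phi := Dr.eulerD_phiSer' hF
    phi_zero := fun s i => by rw [coeff_zero_phiSer, Dr.zpw_k hF]
    x_odd := fun s i hi m hm => by
      obtain ⟨k, rfl⟩ := hm
      rw [hF (Dr.Rel.x_odd s i hi k), map_zero]
    x_x := fun i j m l => by
      have := hF (Dr.Rel.x_x i j m l)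
      rw [map_sub, map_mul, map_mul] at this
      rw [this]
      split_ifs
      · rw [map_smul, map_sub, map_mul, map_mul, hc, hc, hphi, hphi]
      · rw [map_zero]
    quad := fun s i j m l => by
      have := hF (Dr.Rel.quad s i j m l)
      simpa only [map_sub, map_mul, map_smul] using this
    serre := fun s i j hij hA m l => by
      have := hF (Dr.Rel.serre s i j hij hA m l)
      rwa [map_serre, map_zero] at this
    serre_two := fun s i j hA m l => by
      have := hF (Dr.Rel.serre_two s i j hA m l)
      simpa only [map_sum, map_zero, map_add, map_smul, map_serreTwo] using this }

/-! ### Grading automorphisms of the quantum affine algebra -/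

namespace Dr

variable {n : ℕ} {B : Type*} [Ring B] [Algebra Kq B] (F : Free n →ₐ[Kq] B) (e : Fin n → ℤ)

/-- The images of the generators under a homomorphism composed with the grading automorphism
`x^s_{j,m} ↦ q^{s e_j} x^s_{j,m}`. -/
def gradeGen : DrGen n → B
  | .x s j m => q ^ ((s : ℤ) * e j) • F (x s j m)
  | g => F (FreeAlgebra.ι Kq g)

/-- A homomorphism composed with the grading automorphism `x^s_{j,m} ↦ q^{s e_j} x^s_{j,m}`. -/
def grade : Free n →ₐ[Kq] B := FreeAlgebra.lift Kq (gradeGen F e)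

theorem grade_x (s : ℤˣ) (j : Fin n) (m : ℤ) :
    grade F e (x s j m) = q ^ ((s : ℤ) * e j) • F (x s j m) := FreeAlgebra.lift_ι_apply _ _

theorem grade_a (i : Fin n) (l : {l : ℤ // l ≠ 0}) : grade F e (a i l) = F (a i l) :=
  FreeAlgebra.lift_ι_apply _ _

theorem grade_k (i : Fin n) : grade F e (k i) = F (k i) := FreeAlgebra.lift_ι_apply _ _

theorem grade_kInv (i : Fin n) : grade F e (kInv i) = F (kInv i) := FreeAlgebra.lift_ι_apply _ _

theorem grade_qc : grade F e (FreeAlgebra.ι Kq DrGen.qc) = F (FreeAlgebra.ι Kq DrGen.qc) :=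
  FreeAlgebra.lift_ι_apply _ _

theorem grade_qcInv :
    grade F e (FreeAlgebra.ι Kq DrGen.qcInv) = F (FreeAlgebra.ι Kq DrGen.qcInv) :=
  FreeAlgebra.lift_ι_apply _ _

theorem grade_qcPow (z : ℤ) : grade F e (qcPow z) = F (qcPow z) := by
  refine (map_zpw (grade F e : Free n →+* B) _ _ z).trans
    (Eq.trans ?_ (map_zpw (F : Free n →+* B) _ _ z).symm)
  congr 1
  · exact grade_qc F e
  · exact grade_qcInv F e

theorem grade_aPart (s : ℤˣ) (i : Fin n) (r : ℕ) : grade F e (aPart s i r) = F (aPart s i r) := by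
  rw [aPart]
  split_ifs
  · rw [map_zero, map_zero]
  · exact grade_a F e _ _

theorem grade_phi (s : ℤˣ) (i : Fin n) (m : ℕ) : grade F e (phi s i m) = F (phi s i m) := by
  have h : phiSer (grade F e) s i = phiSer F s i := by
    rw [phiSer_eq, phiSer_eq, grade_k, grade_kInv]
    simp only [grade_aPart]
  simpa only [phiSer, PowerSeries.coeff_mk] using congrArg (PowerSeries.coeff m) h

theorem grade_phiZ (s : ℤˣ) (i : Fin n) (m : ℤ) : grade F e (phiZ s i m) = F (phiZ s i m) := by
  rw [phiZ]
  split_ifs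
  · exact grade_phi F e _ _ _
  · rw [map_zero, map_zero]

theorem grade_x_mul_x (s t : ℤˣ) (i j : Fin n) (m l : ℤ) :
    grade F e (x s i m * x t j l) =
      q ^ ((s : ℤ) * e i + (t : ℤ) * e j) • F (x s i m * x t j l) := by
  rw [map_mul, map_mul, grade_x, grade_x, smul_mul_smul_comm, zpow_add₀ q_ne_zero]

variable {F}

/-- Every defining relation is homogeneous for the root lattice grading, in which the k_i, a_{i,l}
and q^{±c/2} have degree zero. -/
theorem grade_rel (hF : ∀ ⦃a b⦄, Rel n a b → F a = F b) ⦃y z : Free n⦄ (h : Rel n y z) :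
    grade F e y = grade F e z := by
  have hF' := hF h
  have hite : ∀ (G : Free n →ₐ[Kq] B) (P : Prop) [Decidable P] (a : Free n),
      G (if P then a else 0) = if P then G a else 0 := fun G P _ a => by
    split_ifs
    · rfl
    · exact map_zero _
  induction h with
  | qc_mul => simpa only [map_mul, map_one, grade_qc, grade_qcInv] using hF'
  | qcInv_mul => simpa only [map_mul, map_one, grade_qc, grade_qcInv] using hF'
  | qc_central g =>
    cases g with
    | x s i m =>
      rw [map_mul, map_mul] at hF' ⊢
      rw [grade_qc]
      change _ * grade F e (x s i m) = grade F e (x s i m) * _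
      rw [grade_x, mul_smul_comm, smul_mul_assoc]
      exact congrArg _ hF'
    | a i l =>
      rw [map_mul, map_mul] at hF' ⊢
      rw [grade_qc]
      change _ * grade F e (a i l) = grade F e (a i l) * _
      rw [grade_a]
      exact hF'
    | k i =>
      rw [map_mul, map_mul] at hF' ⊢
      rw [grade_qc]
      change _ * grade F e (k i) = grade F e (k i) * _
      rw [grade_k]
      exact hF'
    | kInv i =>
      rw [map_mul, map_mul] at hF' ⊢
      rw [grade_qc]
      change _ * grade F e (kInv i) = grade F e (kInv i) * _
      rw [grade_kInv]
      exact hF'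
    | qc => rfl
    | qcInv => simpa only [map_mul, grade_qc, grade_qcInv] using hF'
  | x_odd s i hi m => rw [grade_x, hF', map_zero, map_zero, smul_zero]
  | a_odd i hi l hl => rw [grade_a, hF', map_zero, map_zero]
  | k_mul i => simpa only [map_mul, map_one, grade_k, grade_kInv] using hF'
  | kInv_mul i => simpa only [map_mul, map_one, grade_k, grade_kInv] using hF'
  | k_k i j => simpa only [map_mul, grade_k] using hF'
  | k_a i j l => simpa only [map_mul, grade_k, grade_a] using hF'
  | k_x s i j m =>
    simp only [map_mul, map_smul, grade_k, grade_kInv, grade_x, mul_smul_comm,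
      smul_mul_assoc] at hF' ⊢
    rw [hF', smul_comm]
  | a_a i j m l =>
    simpa only [hite, map_sub, map_mul, map_smul, grade_a, grade_qcPow] using hF'
  | a_x s i j m l =>
    simp only [map_sub, map_mul, map_smul, grade_a, grade_qcPow, grade_x, mul_smul_comm,
      smul_mul_assoc] at hF' ⊢
    rw [← smul_sub, hF', smul_comm]
  | x_x i j m l =>
    rw [map_sub, grade_x_mul_x, grade_x_mul_x, add_comm, ← smul_sub, ← map_sub, hF', hite, hite]
    split_ifs with hij
    -- The commutator of x^+_i with x^-_i has degree zero, as do the coefficients of φ^±_i.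
    · rw [← hij.1, Units.val_one, Units.val_neg, Units.val_one]
      rw [show -1 * e i + 1 * e i = 0 by ring, zpow_zero, one_smul]
      simp only [map_sub, map_mul, map_smul, grade_qcPow, grade_phiZ]
    · rw [smul_zero]
  | quad s i j m l =>
    simp only [map_sub, map_smul] at hF' ⊢
    simp only [grade_x_mul_x, add_comm ((s : ℤ) * e j)]
    rw [smul_comm (qi i ^ _), smul_comm (qi i ^ _), ← smul_sub, ← smul_sub, hF']
  | serre s i j hij hA m l =>
    rw [map_serre, map_zero] at hF' ⊢
    simp only [grade_x]
    rw [serre_smul, hF', smul_zero]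
  | serre_two s i j hA m l =>
    simp only [map_sum, map_zero, map_add, map_smul, map_serreTwo, grade_x, serreTwo_smul] at hF' ⊢
    simp only [smul_comm q, smul_comm q⁻¹]
    simp only [← smul_add, ← Finset.smul_sum]
    rw [hF', smul_zero]

theorem k_mul_x (hF : ∀ ⦃a b⦄, Rel n a b → F a = F b) (s : ℤˣ) (i j : Fin n) (l : ℤ) :
    F (k i) * F (x s j l) = q ^ ((s : ℤ) * form i j) • (F (x s j l) * F (k i)) := by
  have h1 := congrArg (· * F (k i)) (hF (Rel.k_x s i j l))
  simp only [map_mul, map_smul] at h1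
  rw [mul_assoc (_ * _), ← map_mul F (kInv i), hF (Rel.kInv_mul i), map_one, mul_one,
    smul_mul_assoc, qi_zpow] at h1
  refine h1.trans ?_
  rw [form]
  congr 2; ring

end Dr

/-! ### Adjoining a square root of `k_n` -/

section Sqrt

/-- The matrix whose square is `g` times the identity. -/
def sqrtUnit {B : Type*} [Ring B] (g : Bˣ) : (Matrix (Fin 2) (Fin 2) B)ˣ where
  val := !![0, (g : B); 1, 0]
  inv := !![0, 1; ((g⁻¹ : Bˣ) : B), 0]
  val_inv := by simp [Matrix.one_fin_two]
  inv_val := by simp [Matrix.one_fin_two]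

theorem sqrtUnit_val {B : Type*} [Ring B] (g : Bˣ) : (sqrtUnit g : Matrix (Fin 2) (Fin 2) B) = !![0, (g : B); 1, 0] :=
  rfl

variable {B : Type*} [Ring B] [Algebra Kq B]

/-- The algebra of diagonal matrices `diag(b, τ(b))`. -/
def twoCopies (τ : B →ₐ[Kq] B) : B →ₐ[Kq] Matrix (Fin 2) (Fin 2) B where
  toFun b := !![b, 0; 0, τ b]
  map_one' := by rw [map_one, Matrix.one_fin_two]
  map_mul' a b := by simp
  map_zero' := by ext i j; fin_cases i <;> fin_cases j <;> simp
  map_add' a b := by ext i j; fin_cases i <;> fin_cases j <;> simp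
  commutes' r := by
    ext i j
    fin_cases i <;> fin_cases j <;> simp [Matrix.algebraMap_matrix_apply]

theorem twoCopies_apply (τ : B →ₐ[Kq] B) (b : B) : twoCopies τ b = !![b, 0; 0, τ b] := rfl

theorem twoCopies_injective (τ : B →ₐ[Kq] B) : Function.Injective (twoCopies τ) := fun a b h => by
  simpa [twoCopies_apply] using congrFun (congrFun h 0) 0

theorem sqrtUnit_commute {τ : B →ₐ[Kq] B} {g : Bˣ} {b : B} (hτ : τ b = b)
    (h : Commute (g : B) b) :
    Commute (sqrtUnit g : Matrix (Fin 2) (Fin 2) B) (twoCopies τ b) := by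
  rw [Commute, SemiconjBy, sqrtUnit_val, twoCopies_apply, hτ, Matrix.mul_fin_two,
    Matrix.mul_fin_two]
  simp [h.eq]

/-- The off-diagonal entries of the two products require b = p τ(b) and g τ(b) = p b g. The twist τ
thus carries one factor p, and g supplies two. -/
theorem sqrtUnit_smul {τ : B →ₐ[Kq] B} {g : Bˣ} {b : B} {p : Kq} (hp : p ≠ 0)
    (hτ : τ b = p⁻¹ • b) (h : (g : B) * b = (p * p) • (b * g)) :
    (sqrtUnit g : Matrix (Fin 2) (Fin 2) B) * twoCopies τ b =
      p • (twoCopies τ b * (sqrtUnit g : Matrix (Fin 2) (Fin 2) B)) := by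
  rw [sqrtUnit_val, twoCopies_apply, hτ, Matrix.mul_fin_two, Matrix.mul_fin_two]
  have h1 : (g : B) * p⁻¹ • b = p • (b * g) := by
    rw [mul_smul_comm, h, smul_smul, inv_mul_cancel_left₀ hp]
  simp [h1, Matrix.smul_of, smul_smul, mul_inv_cancel₀ hp]

end Sqrt

/-! ### Injectivity through matrices over the quantum affine algebra -/

namespace UqA

variable {n : ℕ}

theorem mk_surjective : Function.Surjective (mk n) := RingQuot.mkAlgHom_surjective Kq _

theorem qc_central (y : UqA n) : Commute (mk n (FreeAlgebra.ι Kq DrGen.qc)) y :=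
  commute_all_of_generators mk_surjective
    (fun g => by
      have := mk_rel (Dr.Rel.qc_central (n := n) g)
      rw [map_mul, map_mul] at this
      exact this) y

/-- The automorphism `x^s_{j,m} ↦ q^{s e_j} x^s_{j,m}`. -/
def gradeHom (e : Fin n → ℤ) : UqA n →ₐ[Kq] UqA n :=
  RingQuot.liftAlgHom Kq ⟨Dr.grade (mk n) e, Dr.grade_rel e fun _ _ => mk_rel⟩

theorem gradeHom_mk (e : Fin n → ℤ) (y : Dr.Free n) :
    gradeHom e (mk n y) = Dr.grade (mk n) e y :=
  RingQuot.liftAlgHom_mkAlgHom_apply _ _ _ _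

end UqA

/-- Elements of the algebra of two by two matrices obtained from a homomorphism from the quantum
affine algebra and a grading endomorphism. -/
def DrData.ofGrading {n : ℕ} {B : Type*} [Ring B] [Algebra Kq B] {F : Dr.Free n →ₐ[Kq] B}
    (hF : ∀ ⦃a b⦄, Dr.Rel n a b → F a = F b)
    (hc : ∀ y, Commute (F (FreeAlgebra.ι Kq DrGen.qc)) y) {i₀ : Fin n} (h₀ : IsLast i₀)
    {τ : B →ₐ[Kq] B}
    (hτ : ∀ y, τ (F y) = Dr.grade F (fun j => -epsRoot' i₀.castSucc j) y) :
    DrData n (Matrix (Fin 2) (Fin 2) B) :=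
  DrData.ofHom (F := (twoCopies τ).comp F) (fun _ _ h => congrArg (twoCopies τ) (hF h))
    (sqrtUnit (Dr.kUnit hF i₀))
    (fun y => by
      have h1 : (twoCopies τ).comp F (FreeAlgebra.ι Kq DrGen.qc) =
          Matrix.scalar (Fin 2) (F (FreeAlgebra.ι Kq DrGen.qc)) := by
        rw [AlgHom.comp_apply, twoCopies_apply, hτ, Dr.grade_qc]
        ext i j
        fin_cases i <;> fin_cases j <;> simp
      rw [h1]
      exact Matrix.scalar_commute _ hc _)
    (fun i => sqrtUnit_commute ((hτ _).trans (Dr.grade_k F _ i)) (by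
      have := hF (Dr.Rel.k_k i₀ i)
      rw [map_mul, map_mul] at this
      exact this))
    (fun i hi => by
      obtain rfl : i = i₀ := Fin.ext (by omega)
      rw [AlgHom.comp_apply, twoCopies_apply, hτ, Dr.grade_k, sqrtUnit_val, Matrix.mul_fin_two]
      simp [Dr.kUnit])
    (fun s i r => sqrtUnit_commute ((hτ _).trans (Dr.grade_aPart F _ s i r)) (Dr.k_commute_aPart hF i₀ s i r))
    (fun i hi s j l => by
      obtain rfl : i = i₀ := Fin.ext (by omega)
      refine sqrtUnit_smul (zpow_ne_zero _ q_ne_zero) ?_ ?_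
      · refine (hτ _).trans ((Dr.grade_x F _ s j l).trans ?_)
        rw [← zpow_neg, mul_neg]
        rfl
      · refine (Dr.k_mul_x hF s i j l).trans ?_
        rw [← zpow_add₀ q_ne_zero, ← two_epsRoot' i j hi]
        congr 2; ring)

/-- No left inverse of ς is constructed. It suffices that ς followed by a homomorphism to matrices
is the diagonal embedding b ↦ diag(b, τ(b)), whose first entry recovers b. -/
theorem IsCurrentMap.injective {n : ℕ} (hn : 2 ≤ n) {ς : UqA n →ₐ[Kq] UqExt n}
    (h : IsCurrentMap n ς) : Function.Injective ς := by
  let i₀ : Fin n := ⟨n - 1, by omega⟩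
  have h₀ : IsLast i₀ := Nat.sub_add_cancel (by omega)
  -- The square root of k_n scales x^±_j by q^{±(ε_n, α_j)}; by `sqrtUnit_smul` the twist must scale
  -- by the inverse.
  let τ := UqA.gradeHom fun j => -epsRoot' i₀.castSucc j
  let D : DrData n (Matrix (Fin 2) (Fin 2) (UqA n)) :=
    DrData.ofGrading (F := UqA.mk n) (fun _ _ => UqA.mk_rel) UqA.qc_central h₀ (τ := τ)
      (UqA.gradeHom_mk _)
  -- By `Dr.hom_ext` the comparison is only needed on q^{c/2}, the currents, the k_i and the series
  -- φ, where the values of ς are prescribed.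
  have h1 : ((D.toHom hn).comp ς).comp (UqA.mk n) = (twoCopies τ).comp (UqA.mk n) := by
    refine Dr.hom_ext (fun _ _ hab => congrArg ((D.toHom hn).comp ς) (UqA.mk_rel hab))
      (fun _ _ hab => congrArg (twoCopies τ) (UqA.mk_rel hab)) ?_ ?_ ?_ ?_
    · have hq : (Dr.qcPow 1 : Dr.Free n) = FreeAlgebra.ι Kq DrGen.qc := by
        simp [Dr.qcPow, zpw]
      have hc := congrArg (D.toHom hn) h.map_qc
      rw [DrData.toHom_mk, DrData.freeMap_qcPow, zpow_one, hq] at hc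
      exact hc
    · exact fun s i m => D.toHom_map_x hn h s i m
    · exact fun i => D.toHom_map_k hn h i
    · exact fun s i m => (D.toHom_map_phi hn h s i m).trans (PowerSeries.coeff_mk m
        fun m => (twoCopies τ).comp (UqA.mk n) (Dr.phi s i m))
  have h2 : ∀ y, D.toHom hn (ς y) = twoCopies τ y := fun y => by
    obtain ⟨y, rfl⟩ := UqA.mk_surjective y
    exact DFunLike.congr_fun h1 y
  intro a b hab
  exact twoCopies_injective τ (by rw [← h2, ← h2, hab])

end

end TwistedAffine

theorem mainTheorem6 (n : ℕ) (hn : 2 ≤ n) :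
    (∃! ς : TwistedAffine.UqA n →ₐ[TwistedAffine.Kq] TwistedAffine.UqExt n,
        TwistedAffine.IsCurrentMap n ς) ∧
      ∀ ς : TwistedAffine.UqA n →ₐ[TwistedAffine.Kq] TwistedAffine.UqExt n,
        TwistedAffine.IsCurrentMap n ς → Function.Injective ς := by
  have h := TwistedAffine.UqExt.isCurrentMap_toHom (n := n) (by omega)
  exact ⟨⟨_, h, fun ς hς => hς.unique h⟩, fun ς hς => hς.injective hn⟩
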